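/- We work in type-two effectivity: points of a space $\mathcal X$ are named by infinite sequences through a representation (a partial surjection $\delta$ from sequences onto $\mathcal X$); functions are named by codes of sequence operators realizing them on names; and computable means realized by a type-two machine. Open sets $U\in\mathcal O(\mathcal X)$ are named by names of their characteristic functions into the Sierpinski space, and $[0,\infty]_<$ is $[0,\infty]$ with the lower topology (names are increasing sequences of nonnegative rationals converging to the number). Let $(\mathcal X,d)$ be an effectively separable computable metric space: $d:\mathcal X\times\mathcal X\to\mathbb R$ is computable; from a point $x$ and an open $U\ni x$ one can compute $\varepsilon>0$ with $B_\varepsilon(x)\subset U$; and there is a computable sequence of points that is dense in $\mathcal X$. A probability valuation on $\mathcal X$ is a continuous $\nu:\mathcal O(\mathcal X)\to[0,\infty]_<$ with $\nu(\emptyset)=0$, $\nu(U)+\nu(V)=\nu(U\cup V)+\nu(U\cap V)$ and $\nu(\mathcal X)=1$. Let $\Omega=\{0,1\}^\omega$ with the uniform probability measure $P$. A lower-measurable set is an equivalence class of decreasing sequences $(W_n)$ of open subsets of $\Omega$ with $P(W_m)\ge P(W_n)-2^{-n}$ for $m>n$, where $(W_n)\sim(W_n')$ iff for every $\varepsilon>0$,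 $P(W_m\cap W'_m)\ge\max(P(W_m),P(W'_m))-\varepsilon$ for all large $m$; its measure is $\sup_n (P(W_n)-2^{-n})$, and it is named by naming a representing sequence. A random variable $X$ in $\mathcal X$ is a continuous map $X^{-1}$ from $\mathcal O(\mathcal X)$ to lower-measurable sets that preserves $\emptyset$, the whole space, and binary intersections and unions; $\Pr(X\in U)=P(X^{-1}(U))$. A simple continuous random variable is a continuous function $\Omega\to\mathcal X$ with finitely many values. The Fan metric is $d_F(X,Y)=\sup\{\varepsilon\in\mathbb Q,\ \varepsilon>0\mid \Pr(d(X,Y)>\varepsilon)>\varepsilon\}$ (with $\sup\emptyset=0$). Then one can construct, from a probability valuation, a random variable with that distribution. More precisely, there is a computable operator which, for every probability valuation $\nu$ on $\mathcal X$ and every name of $\nu$, outputs a name of a pair consisting of a random variable $X$ on $\Omega$ and a sequence $(X_n)_{n\in\mathbb N}$ of simple continuous random variables, such that 1. $\Pr(X\in U)=\nu(U)$ for every open $U\subset\mathcal X$; 2. $(X_n)$ is a fast Cauchy sequence: $d_F(X_m,X_n)<2^{-\min(m,n)}$ for all $m,n$; 3. $X$ is its effective limit: $d_F(X_n,X)\le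 2^{-n}$ for all $n$. -/

import Mathlib

open Set Filter Topology MeasureTheory TopologicalSpace
open scoped ENNReal

/-! ### Type-two computability on sequences -/

/-- The prefix of length `n` of a sequence. -/
def seqPrefix (q : ℕ → ℕ) (n : ℕ) : List ℕ := (List.range n).map q

/-- The word function coded by a sequence `p`, through the standard numbering of words. -/
def wordFun (p : ℕ → ℕ) (u : List ℕ) : List ℕ :=
  Denumerable.ofNat (List ℕ) (p (Encodable.encode u))

/-- The partial continuous operator coded by `p` is defined at `q` with value `r`: what is on the
output tape after a prefix of `q` has been read is a prefix of `r`, and all of `r` gets written.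
The type-two machine-computable operators are exactly those coded by a computable `p`. -/
def Maps (p q r : ℕ → ℕ) : Prop :=
  (∀ n, ∃ m, wordFun p (seqPrefix q n) = seqPrefix r m) ∧
    ∀ m, ∃ n, ∃ k, m ≤ k ∧ wordFun p (seqPrefix q n) = seqPrefix r k

/-- Pairing of two sequences by interleaving. -/
def pairSeq (p q : ℕ → ℕ) (n : ℕ) : ℕ := if n % 2 = 0 then p (n / 2) else q (n / 2)

/-- First component of a paired sequence. -/
def fstSeq (p : ℕ → ℕ) (n : ℕ) : ℕ := p (2 * n)

/-- Second component of a paired sequence. -/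
def sndSeq (p : ℕ → ℕ) (n : ℕ) : ℕ := p (2 * n + 1)

/-- A naming relation: `A p x` says that the sequence `p` is a name of `x`. -/
abbrev Naming (X : Type*) := (ℕ → ℕ) → X → Prop

/-- A representation of `X`: a partial surjection from sequences onto `X`, given by its graph. -/
structure TTERepresentation (X : Type*) where
  IsName : Naming X
  unique : ∀ {p x y}, IsName p x → IsName p y → x = y
  surjective : ∀ x, ∃ p, IsName p x

namespace Naming

/-- Names of pairs. -/
def prod {X Y : Type*} (A : Naming X) (B : Naming Y) : Naming (X × Y) :=
  fun p z => A (fstSeq p) z.1 ∧ B (sndSeq p) z.2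

/-- Names of sequences of points. -/
def seq {X : Type*} (A : Naming X) : Naming (ℕ → X) :=
  fun p s => ∀ n, A (fun k => p (Nat.pair n k)) (s n)

/-- Names of functions (the exponential type): `p` codes an operator that takes each name of `x`
to a name of `f x`. -/
def fn {X Y : Type*} (A : Naming X) (B : Naming Y) : Naming (X → Y) :=
  fun p f => ∀ q x, A q x → ∃ r, Maps p q r ∧ B r (f x)

/-- Elements that have a computable name. -/
def IsComputable {X : Type*} (A : Naming X) (x : X) : Prop :=
  ∃ p : ℕ → ℕ, Computable p ∧ A p x

end Naming

/-! ### Basic types -/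

/-- The Sierpinski type: a nonzero entry in the name signals truth. -/
def sierpinskiNaming : Naming Prop := fun p a => (∃ n, p n ≠ 0) ↔ a

/-- A numbering of the nonnegative rationals. -/
def nnratOfNat (n : ℕ) : ℚ := ((Nat.unpair n).1 : ℚ) / ((Nat.unpair n).2 + 1)

/-- A numbering of the rationals. -/
def ratOfNat (n : ℕ) : ℚ :=
  (((Nat.unpair (Nat.unpair n).1).1 : ℚ) - ((Nat.unpair (Nat.unpair n).1).2 : ℚ)) /
    ((Nat.unpair n).2 + 1)

/-- The real numbers: names are rapidly converging sequences of rationals. -/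
def realNaming : Naming ℝ := fun p x => ∀ n, |(ratOfNat (p n) : ℝ) - x| ≤ (2 : ℝ)⁻¹ ^ n

/-- `[0,∞]` under the lower topology: names are increasing sequences of nonnegative rationals
with the named number as supremum. -/
noncomputable def lowerNaming : Naming ℝ≥0∞ := fun p a =>
  Monotone (fun n => nnratOfNat (p n)) ∧
    ⨆ n, ENNReal.ofReal (nnratOfNat (p n) : ℝ) = a

/-- Names of open sets: names of their characteristic functions into the Sierpinski type. A set
has a name exactly if it is open in the final topology of the naming. -/
def openNaming {X : Type*} (A : Naming X) : Naming (Set X) :=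
  fun p U => Naming.fn A sierpinskiNaming p (fun x => x ∈ U)

/-! ### Computable metric spaces -/

/-- The metric space `X` with the representation `δ` is a computable metric space: the metric is
computable, and from a point `x` and an open set `U` (in the sense of the type) containing it one
can compute `ε = 2⁻ⁿ` with `ball x ε ⊆ U`. The second condition follows from lower computability of
`(x, U) ↦ d(x, X \ U)`, and it also holds for every effective metric space with its Cauchy
representation. -/
structure IsComputableMetricSpace {X : Type*} [MetricSpace X] (δ : TTERepresentation X) : Prop where
  dist_computable :
    (Naming.fn (Naming.prod δ.IsName δ.IsName) realNaming).IsComputable (fun z => dist z.1 z.2)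
  ball_computable : ∃ e : ℕ → ℕ, Computable e ∧
    ∀ (p u : ℕ → ℕ) (x : X) (U : Set X), δ.IsName p x → openNaming δ.IsName u U → x ∈ U →
      ∃ r, Maps e (pairSeq p u) r ∧ Metric.ball x ((2 : ℝ)⁻¹ ^ (r 0)) ⊆ U

/-- There is a computable dense sequence. -/
def IsEffectivelySeparable {X : Type*} [TopologicalSpace X] (δ : TTERepresentation X) : Prop :=
  ∃ ξ : ℕ → X, (Naming.seq δ.IsName).IsComputable ξ ∧ DenseRange ξ

/-! ### Valuations -/

/-- Valuations: continuous functions from the open sets to `[0,∞]` under the lower topology that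
vanish on the empty set and are modular. -/
structure OpenValuation (X : Type*) [TopologicalSpace X] where
  toFun : Opens X → ℝ≥0∞
  empty : toFun ⊥ = 0
  modular : ∀ U V, toFun U + toFun V = toFun (U ⊔ V) + toFun (U ⊓ V)
  continuous : ∀ V : ℕ → Opens X, Monotone V → toFun (⨆ n, V n) = ⨆ n, toFun (V n)

/-- The type of valuations is a subtype of the function type `O(X) → [0,∞]`: a name of `ν` computes
lower approximations to `ν U` from names of `U`. -/
def valuationNaming {X : Type*} [TopologicalSpace X] (A : Naming X) : Naming (OpenValuation X) :=
  fun p ν => Naming.fn (fun u (U : Opens X) => openNaming A u (U : Set X)) lowerNaming p ν.toFun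

/-! ### The base space and its lower-measurable sets -/

/-- The Cantor space. -/
abbrev Cantor := ℕ → Bool

/-- The uniform (fair coin) measure on the Cantor space. -/
noncomputable def coin : Measure Cantor :=
  Measure.infinitePi fun _ => (PMF.uniformOfFintype Bool).toMeasure

instance : IsProbabilityMeasure coin := by unfold coin; infer_instance

/-- The standard names of points of the Cantor space. -/
def cantorNaming : Naming Cantor := fun p ω => ∀ n, p n = (ω n).toNat

/-- Fast monotone lower-Cauchy sequences of open sets of the Cantor space. -/
structure LowerCauchySeq where
  sets : ℕ → Opens Cantor
  anti : Antitone sets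
  fast : ∀ n m, n < m → coin (sets n) ≤ coin (sets m) + (2 : ℝ≥0∞)⁻¹ ^ n

namespace LowerCauchySeq

/-- Equivalence of lower-Cauchy sequences. -/
def Equiv (U V : LowerCauchySeq) : Prop :=
  ∀ ε : ℝ≥0∞, 0 < ε → ∃ n, ∀ m, n ≤ m →
    max (coin (U.sets m)) (coin (V.sets m)) ≤ coin (U.sets m ⊓ V.sets m : Opens Cantor) + ε

/-- The intersection, an auxiliary tool for showing that operations respect equivalence. -/
def inter (U : LowerCauchySeq) : Set Cantor := ⋂ n, (U.sets n : Set Cantor)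

theorem tendsto_inter (U : LowerCauchySeq) :
    Tendsto (fun n => coin (U.sets n)) atTop (𝓝 (coin U.inter)) :=
  tendsto_measure_iInter_atTop (fun n => (U.sets n).isOpen.measurableSet.nullMeasurableSet)
    (fun _ _ h => U.anti h) ⟨0, measure_ne_top _ _⟩

theorem measurable_inter (U : LowerCauchySeq) : MeasurableSet U.inter :=
  MeasurableSet.iInter fun n => (U.sets n).isOpen.measurableSet

theorem tendsto_inter_inf (U V : LowerCauchySeq) :
    Tendsto (fun n => coin (U.sets n ⊓ V.sets n : Opens Cantor)) atTop
      (𝓝 (coin (U.inter ∩ V.inter))) := by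
  have h : U.inter ∩ V.inter = ⋂ n, ((U.sets n ⊓ V.sets n : Opens Cantor) : Set Cantor) := by
    ext x; simp [inter, forall_and]
  rw [h]
  exact tendsto_measure_iInter_atTop
    (fun n => (U.sets n ⊓ V.sets n).isOpen.measurableSet.nullMeasurableSet)
    (fun _ _ h => inf_le_inf (U.anti h) (V.anti h)) ⟨0, measure_ne_top _ _⟩

theorem ae_of_measure_inter {A B : Set Cantor} (hA : MeasurableSet A) (hB : MeasurableSet B)
    (h : coin A ≤ coin (A ∩ B)) : (A ≤ᵐ[coin] B) := by
  have h1 : (A ∩ B : Set Cantor) =ᵐ[coin] A :=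
    ae_eq_of_subset_of_measure_ge inter_subset_left h (hA.inter hB).nullMeasurableSet
      (measure_ne_top _ _)
  exact h1.symm.le.trans (LE.le.eventuallyLE inter_subset_right)

theorem equiv_iff (U V : LowerCauchySeq) : Equiv U V ↔ U.inter =ᵐ[coin] V.inter := by
  constructor
  · intro h
    have key : max (coin U.inter) (coin V.inter) ≤ coin (U.inter ∩ V.inter) := by
      refine ENNReal.le_of_forall_pos_le_add fun ε hε _ => ?_
      obtain ⟨n, hn⟩ := h ε (by exact_mod_cast hε)
      exact le_of_tendsto_of_tendsto (U.tendsto_inter.max V.tendsto_inter)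
        ((tendsto_inter_inf U V).add_const _) (eventually_atTop.2 ⟨n, hn⟩)
    refine (ae_of_measure_inter U.measurable_inter V.measurable_inter
      ((le_max_left _ _).trans key)).antisymm
      (ae_of_measure_inter V.measurable_inter U.measurable_inter ?_)
    rw [inter_comm]
    exact (le_max_right _ _).trans key
  · intro h ε hε
    have e1 : coin (U.inter ∩ V.inter) = coin U.inter :=
      by
      have h2 := (ae_eq_refl U.inter).inter h.symm
      rw [inter_self] at h2
      exact measure_congr h2
    have e2 : coin V.inter = coin U.inter := (measure_congr h).symm
    have ht : Tendsto (fun m => max (coin (U.sets m)) (coin (V.sets m))) atTop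
        (𝓝 (coin U.inter)) := by
      have := U.tendsto_inter.max V.tendsto_inter
      rwa [e2, max_self] at this
    have hlt : coin U.inter < coin U.inter + ε :=
      ENNReal.lt_add_right (measure_ne_top _ _) hε.ne'
    have hev := ht.eventually (gt_mem_nhds hlt)
    obtain ⟨n, hn⟩ := eventually_atTop.1 hev
    refine ⟨n, fun m hm => (hn m hm).le.trans ?_⟩
    rw [← e1]
    refine add_le_add_left ?_ ε
    exact measure_mono (inter_subset_inter (iInter_subset _ m) (iInter_subset _ m))

instance setoid : Setoid LowerCauchySeq where
  r := Equiv
  iseqv :=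
    { refl := fun U => (equiv_iff U U).2 (ae_eq_refl _)
      symm := fun h => (equiv_iff _ _).2 ((equiv_iff _ _).1 h).symm
      trans := fun h k => (equiv_iff _ _).2 (((equiv_iff _ _).1 h).trans ((equiv_iff _ _).1 k)) }

/-- The lower measure `sup (P(Uₙ) - 2⁻ⁿ)`. -/
noncomputable def measure (U : LowerCauchySeq) : ℝ≥0∞ :=
  ⨆ n, (coin (U.sets n) - (2 : ℝ≥0∞)⁻¹ ^ n)

theorem measure_eq (U : LowerCauchySeq) : U.measure = coin U.inter := by
  apply le_antisymm
  · refine iSup_le fun n => ?_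
    rw [tsub_le_iff_right]
    exact ge_of_tendsto (U.tendsto_inter.add_const _)
      (eventually_atTop.2 ⟨n + 1, fun m hm => U.fast n m hm⟩)
  · have ht : Tendsto (fun n => coin (U.sets n) - (2 : ℝ≥0∞)⁻¹ ^ n) atTop
        (𝓝 (coin U.inter - 0)) :=
      ENNReal.Tendsto.sub U.tendsto_inter
        (ENNReal.tendsto_pow_atTop_nhds_zero_of_lt_one (by simp)) (Or.inr (by simp))
    rw [tsub_zero] at ht
    exact le_of_tendsto' ht fun n => le_iSup (fun n => coin (U.sets n) - (2 : ℝ≥0∞)⁻¹ ^ n) n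

/-- The constant sequence of an open set. -/
def const (U : Opens Cantor) : LowerCauchySeq where
  sets _ := U
  anti := antitone_const
  fast _ _ _ := le_self_add

theorem inter_const (U : Opens Cantor) : (const U).inter = U :=
  iInter_const (U : Set Cantor)

theorem loss_le (U : LowerCauchySeq) {n m : ℕ} (h : n < m) :
    coin ((U.sets n : Set Cantor) \ U.sets m) ≤ (2 : ℝ≥0∞)⁻¹ ^ n := by
  rw [measure_sdiff (U.anti h.le) (U.sets m).isOpen.measurableSet.nullMeasurableSet
    (measure_ne_top _ _), tsub_le_iff_left]
  exact U.fast n m h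

theorem two_halves (n : ℕ) : (2 : ℝ≥0∞)⁻¹ ^ (n + 1) + (2 : ℝ≥0∞)⁻¹ ^ (n + 1) = (2 : ℝ≥0∞)⁻¹ ^ n := by
  rw [pow_succ, ← mul_add, ENNReal.inv_two_add_inv_two, mul_one]

theorem fast_of_subset (U V : LowerCauchySeq) {n m : ℕ} (h : n < m) {A B : Set Cantor}
    (hAB : A ⊆ B ∪ (((U.sets (n + 1) : Set Cantor) \ U.sets (m + 1)) ∪
      ((V.sets (n + 1) : Set Cantor) \ V.sets (m + 1)))) :
    coin A ≤ coin B + (2 : ℝ≥0∞)⁻¹ ^ n := by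
  refine (measure_mono hAB).trans ((measure_union_le _ _).trans ?_)
  rw [← two_halves n]
  gcongr
  refine (measure_union_le _ _).trans ?_
  gcongr
  · exact U.loss_le (by omega)
  · exact V.loss_le (by omega)

/-- Intersection: termwise, shifted by one so that the result is again fast. -/
def inf (U V : LowerCauchySeq) : LowerCauchySeq where
  sets n := U.sets (n + 1) ⊓ V.sets (n + 1)
  anti _ _ h := inf_le_inf (U.anti (by omega)) (V.anti (by omega))
  fast n m h := by
    refine fast_of_subset U V h fun x hx => ?_
    simp only [Opens.coe_inf, mem_inter_iff, mem_union, Set.mem_sdiff] at hx ⊢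
    tauto

/-- Union: termwise, shifted by one so that the result is again fast. -/
def sup (U V : LowerCauchySeq) : LowerCauchySeq where
  sets n := U.sets (n + 1) ⊔ V.sets (n + 1)
  anti _ _ h := sup_le_sup (U.anti (by omega)) (V.anti (by omega))
  fast n m h := by
    refine fast_of_subset U V h fun x hx => ?_
    simp only [Opens.coe_sup, mem_union, Set.mem_sdiff] at hx ⊢
    tauto

theorem mem_inter_succ (U : LowerCauchySeq) (x : Cantor) :
    x ∈ U.inter ↔ ∀ n, x ∈ U.sets (n + 1) := by
  simp only [inter, mem_iInter, SetLike.mem_coe]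
  exact ⟨fun h n => h _, fun h n => U.anti (Nat.le_succ n) (h n)⟩

theorem inter_inf (U V : LowerCauchySeq) : (U.inf V).inter = U.inter ∩ V.inter := by
  ext x
  rw [Set.mem_inter_iff, mem_inter_succ U, mem_inter_succ V, ← forall_and]
  simp [inter, inf]

theorem inter_sup (U V : LowerCauchySeq) : (U.sup V).inter = U.inter ∪ V.inter := by
  ext x
  rw [Set.mem_union, mem_inter_succ U, mem_inter_succ V]
  simp only [inter, sup, mem_iInter, SetLike.mem_coe, Opens.mem_sup]
  constructor
  · intro h
    by_contra! hc
    obtain ⟨⟨n, hn⟩, m, hm⟩ := hc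
    rcases h (max n m) with h1 | h1
    · exact hn (U.anti (by omega) h1)
    · exact hm (V.anti (by omega) h1)
  · rintro (h | h) n
    · exact Or.inl (h n)
    · exact Or.inr (h n)

end LowerCauchySeq

/-- Lower-measurable sets of the Cantor space with the uniform measure. -/
def LowerMeasurableSet := Quotient LowerCauchySeq.setoid

namespace LowerMeasurableSet

/-- The lower measure. -/
noncomputable def measure : LowerMeasurableSet → ℝ≥0∞ :=
  Quotient.lift LowerCauchySeq.measure fun U V h => by
    rw [U.measure_eq, V.measure_eq]
    exact measure_congr ((LowerCauchySeq.equiv_iff U V).1 h)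

/-- An open set as a lower-measurable set. -/
def ofOpen (U : Opens Cantor) : LowerMeasurableSet := Quotient.mk _ (LowerCauchySeq.const U)

/-- Intersection of lower-measurable sets. -/
def inf : LowerMeasurableSet → LowerMeasurableSet → LowerMeasurableSet :=
  Quotient.map₂ LowerCauchySeq.inf fun U U' h V V' k => (LowerCauchySeq.equiv_iff _ _).2 <| by
    rw [LowerCauchySeq.inter_inf, LowerCauchySeq.inter_inf]
    exact ((LowerCauchySeq.equiv_iff _ _).1 h).inter ((LowerCauchySeq.equiv_iff _ _).1 k)

/-- Union of lower-measurable sets. -/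
def sup : LowerMeasurableSet → LowerMeasurableSet → LowerMeasurableSet :=
  Quotient.map₂ LowerCauchySeq.sup fun U U' h V V' k => (LowerCauchySeq.equiv_iff _ _).2 <| by
    rw [LowerCauchySeq.inter_sup, LowerCauchySeq.inter_sup]
    exact ((LowerCauchySeq.equiv_iff _ _).1 h).union ((LowerCauchySeq.equiv_iff _ _).1 k)

/-- Names of lower-measurable sets: names of representing sequences of open sets. -/
def naming : Naming LowerMeasurableSet := fun p W =>
  ∃ U : LowerCauchySeq, Quotient.mk _ U = W ∧
    Naming.seq (openNaming cantorNaming) p (fun n => (U.sets n : Set Cantor))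

theorem measure_ofOpen (U : Opens Cantor) : (ofOpen U).measure = coin U := by
  change (LowerCauchySeq.const U).measure = _
  rw [LowerCauchySeq.measure_eq, LowerCauchySeq.inter_const]

theorem inf_ofOpen (U V : Opens Cantor) : ofOpen (U ⊓ V) = inf (ofOpen U) (ofOpen V) :=
  Quotient.sound <| (LowerCauchySeq.equiv_iff _ _).2 <| by
    rw [LowerCauchySeq.inter_inf]; simp only [LowerCauchySeq.inter_const]; rfl

theorem sup_ofOpen (U V : Opens Cantor) : ofOpen (U ⊔ V) = sup (ofOpen U) (ofOpen V) :=
  Quotient.sound <| (LowerCauchySeq.equiv_iff _ _).2 <| by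
    rw [LowerCauchySeq.inter_sup]; simp only [LowerCauchySeq.inter_const]; rfl

end LowerMeasurableSet

/-! ### Random variables -/

/-- A random variable over the Cantor space with the uniform measure: a measurable function given by
its preimage operation from open sets to lower-measurable sets. Continuity of the operation is
stated as compatibility with increasing unions. -/
structure RandomVariable (X : Type*) [TopologicalSpace X] where
  preimage : Opens X → LowerMeasurableSet
  preimage_empty : preimage ⊥ = LowerMeasurableSet.ofOpen ⊥
  preimage_univ : preimage ⊤ = LowerMeasurableSet.ofOpen ⊤
  preimage_inf : ∀ U V, preimage (U ⊓ V) = (preimage U).inf (preimage V)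
  preimage_sup : ∀ U V, preimage (U ⊔ V) = (preimage U).sup (preimage V)
  continuous : ∀ V : ℕ → Opens X, Monotone V →
    (preimage (⨆ n, V n)).measure = ⨆ n, (preimage (V n)).measure

namespace RandomVariable

variable {X Y : Type*} [TopologicalSpace X] [TopologicalSpace Y]

/-- The distribution `Pr(Z ∈ U)`. -/
noncomputable def prob (Z : RandomVariable X) (U : Opens X) : ℝ≥0∞ := (Z.preimage U).measure

/-- Names of random variables: names of the preimage operation, as an element of the function type
from open sets of `X` to lower-measurable sets. -/
def naming (A : Naming X) : Naming (RandomVariable X) := fun p Z =>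
  Naming.fn (fun u (U : Opens X) => openNaming A u (U : Set X)) LowerMeasurableSet.naming p
    Z.preimage

/-- A continuous random variable as a random variable. -/
def ofContinuous (f : C(Cantor, X)) : RandomVariable X where
  preimage U := LowerMeasurableSet.ofOpen (U.comap f)
  preimage_empty := by congr 1
  preimage_univ := by congr 1
  preimage_inf U V := LowerMeasurableSet.inf_ofOpen (U.comap f) (V.comap f)
  preimage_sup U V := LowerMeasurableSet.sup_ofOpen (U.comap f) (V.comap f)
  continuous V hV := by
    simp only [LowerMeasurableSet.measure_ofOpen]
    rw [← Monotone.measure_iUnion]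
    · congr 1
      ext x
      simp
    · exact fun _ _ h x hx => hV h hx

/-- The probability that the product `Z × T` lies in the open set `W`: the supremum, over the finite
unions of open rectangles inside `W`, of the probability of the union of the sets
`Z⁻¹(U) ∩ T⁻¹(V)`. -/
noncomputable def jointProb (Z : RandomVariable X) (T : RandomVariable Y) (W : Set (X × Y)) :
    ℝ≥0∞ :=
  ⨆ (l : List (Opens X × Opens Y)) (_ : ∀ R ∈ l, (R.1 : Set X) ×ˢ (R.2 : Set Y) ⊆ W),
    ((l.map fun R => (Z.preimage R.1).inf (T.preimage R.2)).foldr LowerMeasurableSet.sup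
      (LowerMeasurableSet.ofOpen ⊥)).measure

/-- The Fan metric: the supremum of the rationals `ε > 0` with `Pr(d(Z,T) > ε) > ε`. -/
noncomputable def fanDist {X : Type*} [MetricSpace X] (Z T : RandomVariable X) : ℝ≥0∞ :=
  sSup {e | ∃ ε : ℚ, 0 < ε ∧ e = ENNReal.ofReal (ε : ℝ) ∧
    e < jointProb Z T {z | (ε : ℝ) < dist z.1 z.2}}

end RandomVariable

/-- Names of continuous random variables, as elements of the function type. -/
def continuousRVNaming {X : Type*} [TopologicalSpace X] (A : Naming X) : Naming C(Cantor, X) :=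
  fun p f => Naming.fn cantorNaming A p f

/-! ### Primitive recursive bookkeeping -/

-- The random variable is obtained by cutting the unit interval into pieces whose lengths depend
-- continuously on a point of the space, and then averaging the cuts over the valuation.
--
-- At a point `x`, the running maxima of bump functions of radius `2⁻ʲ` around the dense points `ξ
-- k` increase from 0 to 1 in finitely many steps and so cut `[0,1]` into successive intervals. An
-- interval with index `k` is nondegenerate only if `x` is within `2⁻ʲ` of `ξ k`. A node `s` of the
-- tree at `x` is the common refinement, for `j = 0, 1, ...`, of the intervals with indices `s₀, s₁,
-- ...`. It is computed by clamping with `max` and `min`, without division. Integrating both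
-- endpoints over the measure extending the valuation `ν` gives one tree, whose cells are read as
-- sets of binary expansions in the Cantor space.
--
-- The preimage of an open `U` is the union of the cells of those nodes that are nondegenerate only
-- at points of `U`. Everything rests on the identity that this preimage meets the cell of `s` in
-- measure `∫_U mass_x(s) dν` (`TreeFamily.coin_cell_inter_preimage`). Both sides are additive over
-- children, so they need only be compared at a deep level, where nondegenerate nodes have small
-- support. At the root it says that the distribution is `ν`. No point of the space is attached to
-- an element of the Cantor space: the space need not be complete, and preimages suffice.
--
-- For computability, the integral of the length of an interval is bounded from below by counting
-- grid points, which turns it into finite sums of valuations of open sets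
-- (`lt_integral_iff_exists_grid`). Since the total mass is 1, this bounds the endpoints from both
-- sides. The inclusion of a support in `U` cannot be confirmed from a name of `U`. The preimage is
-- therefore named from outside, by the cells of which more than the fraction `1 - 2⁻ⁿ` is mapped
-- into `U`. This condition is semidecidable, and by the identity the excess has measure at most
-- `2⁻ⁿ` (`TreeFamily.coin_outer_diff`). The simple variable `Xₙ` sends a dyadic interval inside a
-- cell of depth `n + 4` to the dense point named by the last entry of the node, and ignores a set
-- of measure at most `2⁻ⁿ⁻³`.
--
-- All algorithms are expressed through `SemiDec`, semidecidability relative to an oracle. It is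
-- closed under finite logical operations and existential search, and `exists_code` turns a function
-- with semidecidable graph into an operator.

attribute [fun_prop] Primrec PrimrecPred
attribute [fun_prop] Primrec.id Primrec.const Primrec.comp Primrec.pair PrimrecPred.and
  PrimrecPred.or PrimrecPred.not

section PrimrecRules

variable {α β γ σ : Type*} [Primcodable α] [Primcodable β] [Primcodable γ] [Primcodable σ]

-- Closure rules are in composed form, so that the decidable tests inside the searches below are
-- recognised as primitive recursive by `fun_prop`.
@[fun_prop] theorem Primrec.fst_rule {f : α → β × γ} (h : Primrec f) : Primrec fun a => (f a).1 :=
  Primrec.fst.comp h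

@[fun_prop] theorem Primrec.snd_rule {f : α → β × γ} (h : Primrec f) : Primrec fun a => (f a).2 :=
  Primrec.snd.comp h

@[fun_prop] theorem Primrec.add_rule {f g : α → ℕ} (hf : Primrec f) (hg : Primrec g) :
    Primrec fun a => f a + g a := Primrec.nat_add.comp hf hg

@[fun_prop] theorem Primrec.sub_rule {f g : α → ℕ} (hf : Primrec f) (hg : Primrec g) :
    Primrec fun a => f a - g a := Primrec.nat_sub.comp hf hg

@[fun_prop] theorem Primrec.mul_rule {f g : α → ℕ} (hf : Primrec f) (hg : Primrec g) :
    Primrec fun a => f a * g a := Primrec.nat_mul.comp hf hg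

@[fun_prop] theorem Primrec.div_rule {f g : α → ℕ} (hf : Primrec f) (hg : Primrec g) :
    Primrec fun a => f a / g a := Primrec.nat_div.comp hf hg

@[fun_prop] theorem Primrec.mod_rule {f g : α → ℕ} (hf : Primrec f) (hg : Primrec g) :
    Primrec fun a => f a % g a := Primrec.nat_mod.comp hf hg

@[fun_prop] theorem Primrec.pow_rule {f g : α → ℕ} (hf : Primrec f) (hg : Primrec g) :
    Primrec fun a => f a ^ g a :=
  (Primrec₂.unpaired'.1 Nat.Primrec.pow : Primrec₂ fun m n : ℕ => m ^ n).comp hf hg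

@[fun_prop] theorem Primrec.natPair_rule {f g : α → ℕ} (hf : Primrec f) (hg : Primrec g) :
    Primrec fun a => Nat.pair (f a) (g a) := Primrec₂.natPair.comp hf hg

@[fun_prop] theorem Primrec.unpair_rule {f : α → ℕ} (hf : Primrec f) :
    Primrec fun a => Nat.unpair (f a) := Primrec.unpair.comp hf

@[fun_prop] theorem Primrec.encode_rule {f : α → β} (hf : Primrec f) :
    Primrec fun a => Encodable.encode (f a) := Primrec.encode.comp hf

@[fun_prop] theorem Primrec.decode_rule {f : α → ℕ} (hf : Primrec f) :
    Primrec fun a => (Encodable.decode (f a) : Option β) := Primrec.decode.comp hf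

@[fun_prop] theorem Primrec.ofNatList_rule {f : α → ℕ} (hf : Primrec f) :
    Primrec fun a => Denumerable.ofNat (List ℕ) (f a) := (Primrec.ofNat (List ℕ)).comp hf

@[fun_prop] theorem Primrec.length_rule {f : α → List β} (hf : Primrec f) :
    Primrec fun a => (f a).length := Primrec.list_length.comp hf

@[fun_prop] theorem Primrec.range_rule {f : α → ℕ} (hf : Primrec f) :
    Primrec fun a => List.range (f a) := Primrec.list_range.comp hf

@[fun_prop] theorem Primrec.take_rule {f : α → ℕ} {g : α → List β} (hf : Primrec f)
    (hg : Primrec g) : Primrec fun a => (g a).take (f a) := Primrec.list_take.comp hf hg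

@[fun_prop] theorem Primrec.getElem?_rule {f : α → List β} {g : α → ℕ} (hf : Primrec f)
    (hg : Primrec g) : Primrec fun a => (f a)[g a]? := Primrec.list_getElem?.comp hf hg

@[fun_prop] theorem Primrec.getD_rule {f : α → List β} {g : α → ℕ} (d : β) (hf : Primrec f)
    (hg : Primrec g) : Primrec fun a => (f a).getD (g a) d := (Primrec.list_getD d).comp hf hg

@[fun_prop] theorem Primrec.map_rule {f : α → List β} {g : α → β → σ} (hf : Primrec f)
    (hg : Primrec fun p : α × β => g p.1 p.2) : Primrec fun a => (f a).map (g a) :=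
  Primrec.list_map hf hg

@[fun_prop] theorem Primrec.some_rule {f : α → β} (hf : Primrec f) : Primrec fun a => some (f a) :=
  Primrec.option_some.comp hf

@[fun_prop] theorem Primrec.listSum_rule {f : α → List ℕ} (hf : Primrec f) :
    Primrec fun a => (f a).sum := by
  have h : Primrec fun l : List ℕ => l.sum :=
    (Primrec.list_foldr (f := fun l : List ℕ => l) (g := fun _ => 0)
      (h := fun _ p => p.1 + p.2) Primrec.id (Primrec.const 0)
      (show Primrec fun q : List ℕ × ℕ × ℕ => q.2.1 + q.2.2 by fun_prop)).of_eq fun l => by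
        induction l with
        | nil => rfl
        | cons a l ih => simp [← ih]
  exact h.comp hf

@[fun_prop] theorem PrimrecPred.eq_rule {f g : α → β} (hf : Primrec f) (hg : Primrec g) :
    PrimrecPred fun a => f a = g a := Primrec.eq.comp hf hg

theorem PrimrecPred.const_true : PrimrecPred fun _ : α => True :=
  (PrimrecPred.eq_rule (Primrec.const 0) (Primrec.const 0)).of_eq fun _ => by simp

@[fun_prop] theorem PrimrecPred.lt_rule {f g : α → ℕ} (hf : Primrec f) (hg : Primrec g) :
    PrimrecPred fun a => f a < g a := Primrec.nat_lt.comp hf hg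

@[fun_prop] theorem PrimrecPred.le_rule {f g : α → ℕ} (hf : Primrec f) (hg : Primrec g) :
    PrimrecPred fun a => f a ≤ g a := Primrec.nat_le.comp hf hg

@[fun_prop] theorem PrimrecPred.comp_rule {p : β → Prop} {f : α → β} (hp : PrimrecPred p)
    (hf : Primrec f) : PrimrecPred fun a => p (f a) := hp.comp hf

@[fun_prop] theorem PrimrecPred.exists_mem_rule {f : α → List β} {p : α → β → Prop}
    (hf : Primrec f) (hp : PrimrecPred fun q : α × β => p q.1 q.2) :
    PrimrecPred fun a => ∃ b ∈ f a, p a b :=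
  (PrimrecRel.exists_mem_list (R := fun b a => p a b)
    (hp.comp (Primrec.snd.pair Primrec.fst))).comp hf Primrec.id

@[fun_prop] theorem PrimrecPred.forall_mem_rule {f : α → List β} {p : α → β → Prop}
    (hf : Primrec f) (hp : PrimrecPred fun q : α × β => p q.1 q.2) :
    PrimrecPred fun a => ∀ b ∈ f a, p a b :=
  (PrimrecRel.forall_mem_list (R := fun b a => p a b)
    (hp.comp (Primrec.snd.pair Primrec.fst))).comp hf Primrec.id

@[fun_prop] theorem PrimrecPred.exists_lt_rule {f : α → ℕ} {p : α → ℕ → Prop}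
    (hf : Primrec f) (hp : PrimrecPred fun q : α × ℕ => p q.1 q.2) :
    PrimrecPred fun a => ∃ b < f a, p a b :=
  (PrimrecPred.exists_mem_rule (f := fun a => List.range (f a)) (by fun_prop) hp).of_eq fun a => by
    simp

@[fun_prop] theorem PrimrecPred.forall_lt_rule {f : α → ℕ} {p : α → ℕ → Prop}
    (hf : Primrec f) (hp : PrimrecPred fun q : α × ℕ => p q.1 q.2) :
    PrimrecPred fun a => ∀ b < f a, p a b :=
  (PrimrecPred.forall_mem_rule (f := fun a => List.range (f a)) (by fun_prop) hp).of_eq fun a => by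
    simp

@[fun_prop] theorem PrimrecPred.exists_option_rule {f : α → Option β} {p : α → β → Prop}
    (hf : Primrec f) (hp : PrimrecPred fun q : α × β => p q.1 q.2) :
    PrimrecPred fun a => ∃ b, f a = some b ∧ p a b :=
  (PrimrecPred.exists_mem_rule (Primrec.optionToList.comp hf) hp).of_eq fun a => by
    simp [Option.mem_toList]

@[fun_prop] theorem Primrec.ite_rule {c : α → Prop} [DecidablePred c] {f g : α → σ}
    (hc : PrimrecPred c) (hf : Primrec f) (hg : Primrec g) :
    Primrec fun a => if c a then f a else g a := Primrec.ite hc hf hg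

@[fun_prop] theorem Primrec.findIdx_rule {f : α → List β} {p : α → β → Prop}
    [∀ a b, Decidable (p a b)] (hf : Primrec f) (hp : PrimrecPred fun q : α × β => p q.1 q.2) :
    Primrec fun a => (f a).findIdx fun b => decide (p a b) :=
  Primrec.list_findIdx hf (primrecPred_iff_primrec_decide.1 hp)

end PrimrecRules

/-! ### Prefixes -/

@[simp] theorem length_seqPrefix (q : ℕ → ℕ) (n : ℕ) : (seqPrefix q n).length = n := by
  simp [seqPrefix]

@[simp] theorem take_seqPrefix (q : ℕ → ℕ) (m n : ℕ) :
    (seqPrefix q n).take m = seqPrefix q (min m n) := by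
  rw [seqPrefix, ← List.map_take, List.take_range, seqPrefix]

theorem getElem?_seqPrefix (q : ℕ → ℕ) (n k : ℕ) :
    (seqPrefix q n)[k]? = if k < n then some (q k) else none := by
  by_cases h : k < n
  · simp [seqPrefix, h]
  · simp only [h, if_false]; simp [not_lt.1 h]

theorem getElem?_seqPrefix_eq_some {q : ℕ → ℕ} {n k v : ℕ} :
    (seqPrefix q n)[k]? = some v ↔ k < n ∧ q k = v := by
  rw [getElem?_seqPrefix]; split_ifs <;> simp [*]

theorem getD_seqPrefix {q : ℕ → ℕ} {n k : ℕ} (h : k < n) (d : ℕ) :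
    (seqPrefix q n).getD k d = q k := by
  rw [List.getD_eq_getElem?_getD, getElem?_seqPrefix, if_pos h, Option.getD_some]

/-- Being a prefix becomes a finite conjunction of statements about single values, which can be
checked through the graph of the sequence. -/
theorem eq_seqPrefix_iff {q : ℕ → ℕ} {n : ℕ} {l : List ℕ} :
    l = seqPrefix q n ↔ l.length = n ∧ ∀ k < l.length, q k = l.getD k 0 := by
  constructor
  · rintro rfl
    refine ⟨by simp, fun k hk => ?_⟩
    rw [length_seqPrefix] at hk
    rw [getD_seqPrefix hk]
  · rintro ⟨rfl, h⟩
    apply List.ext_getElem (by simp)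
    intro k h1 h2
    have := h k h1
    simp [seqPrefix, this, h1]

/-! ### Relations that are semidecidable from an oracle -/

/-- The relation `R i a` is semidecidable, uniformly in the instance `i`, from the sequence `orc i`
as an oracle. -/
def SemiDec {I α : Type*} [Primcodable α] (orc : I → ℕ → ℕ) (R : I → α → Prop) : Prop :=
  ∃ T : List ℕ × α × ℕ → Prop, PrimrecPred T ∧
    ∀ i a, R i a ↔ ∃ s b, T (seqPrefix (orc i) s, a, b)

namespace SemiDec

variable {I J α β γ : Type*} [Primcodable α] [Primcodable β] [Primcodable γ]
  {orc : I → ℕ → ℕ} {R S : I → α → Prop}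

theorem congr (h : SemiDec orc R) (e : ∀ i a, S i a ↔ R i a) : SemiDec orc S := by
  obtain ⟨T, hT, hR⟩ := h
  exact ⟨T, hT, fun i a => (e i a).trans (hR i a)⟩

/-- A semidecidable relation holds if some prefix of the oracle has been read that witnesses it. -/
theorem exists_stage (h : SemiDec orc R) : ∃ T : List ℕ × α → Prop, PrimrecPred T ∧
    (∀ i a m n, m ≤ n → T (seqPrefix (orc i) m, a) → T (seqPrefix (orc i) n, a)) ∧
    ∀ i a, R i a ↔ ∃ n, T (seqPrefix (orc i) n, a) := by
  obtain ⟨T, hT, hR⟩ := h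
  -- The number `c` codes the length of a short prefix and an old witness. Bounding `c` by the
  -- length read makes acceptance decidable and monotone; the short prefix is recovered by `take`.
  refine ⟨fun p => ∃ c < p.1.length, T (p.1.take c.unpair.1, p.2, c.unpair.2), by fun_prop, ?_, ?_⟩
  · rintro i a m n hmn ⟨c, hc, hT⟩
    simp only [length_seqPrefix, take_seqPrefix] at hc hT ⊢
    have h1 := Nat.unpair_left_le c
    refine ⟨c, by omega, ?_⟩
    rwa [show min c.unpair.1 n = min c.unpair.1 m by omega]
  · intro i a
    rw [hR]
    constructor
    · rintro ⟨s, b, h⟩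
      refine ⟨Nat.pair s b + 1, Nat.pair s b, by simp, ?_⟩
      have := Nat.left_le_pair s b
      simp only [Nat.unpair_pair, take_seqPrefix]
      rwa [show min s (Nat.pair s b + 1) = s by omega]
    · rintro ⟨n, c, hc, h⟩
      rw [take_seqPrefix] at h
      exact ⟨_, _, h⟩

theorem of_stage {T : List ℕ × α → Prop} (hT : PrimrecPred T)
    (h : ∀ i a, R i a ↔ ∃ n, T (seqPrefix (orc i) n, a)) : SemiDec orc R :=
  ⟨fun p => T (p.1, p.2.1), by fun_prop, fun i a => by simp [h]⟩

theorem of_primrec {P : α → Prop} (hP : PrimrecPred P) : SemiDec orc fun _ a => P a :=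
  of_stage (T := fun p => P p.2) (by fun_prop) fun i a => by simp

theorem and (hR : SemiDec orc R) (hS : SemiDec orc S) : SemiDec orc fun i a => R i a ∧ S i a := by
  obtain ⟨T, hT, mT, eT⟩ := hR.exists_stage
  obtain ⟨T', hT', mT', eT'⟩ := hS.exists_stage
  refine of_stage (T := fun p => T p ∧ T' p) (by fun_prop) fun i a => ?_
  rw [eT, eT']
  constructor
  · rintro ⟨⟨m, hm⟩, n, hn⟩
    exact ⟨max m n, mT _ _ _ _ (le_max_left _ _) hm, mT' _ _ _ _ (le_max_right _ _) hn⟩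
  · rintro ⟨n, h1, h2⟩
    exact ⟨⟨n, h1⟩, n, h2⟩

theorem or (hR : SemiDec orc R) (hS : SemiDec orc S) : SemiDec orc fun i a => R i a ∨ S i a := by
  obtain ⟨T, hT, -, eT⟩ := hR.exists_stage
  obtain ⟨T', hT', -, eT'⟩ := hS.exists_stage
  refine of_stage (T := fun p => T p ∨ T' p) (by fun_prop) fun i a => ?_
  rw [eT, eT', exists_or]

theorem comp (hR : SemiDec orc R) {g : β → α} (hg : Primrec g) :
    SemiDec orc fun i b => R i (g b) := by
  obtain ⟨T, hT, eT⟩ := hR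
  exact ⟨fun p => T (p.1, g p.2.1, p.2.2), by fun_prop, fun i a => eT i (g a)⟩

theorem ex {R : I → α → β → Prop} (hR : SemiDec orc fun i (p : α × β) => R i p.1 p.2) :
    SemiDec orc fun i a => ∃ b, R i a b := by
  obtain ⟨T, hT, eT⟩ := hR
  -- The new witness pairs a code of `b` with the old witness.
  refine ⟨fun p => ∃ b, (Encodable.decode p.2.2.unpair.1 : Option β) = some b ∧
    T (p.1, (p.2.1, b), p.2.2.unpair.2), by fun_prop, fun i a => ?_⟩
  constructor
  · rintro ⟨b, hb⟩
    obtain ⟨s, c, h⟩ := (eT i (a, b)).1 hb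
    exact ⟨s, Nat.pair (Encodable.encode b) c, b, by simp, by simpa using h⟩
  · rintro ⟨s, c, b, -, h⟩
    exact ⟨b, (eT i (a, b)).2 ⟨s, _, h⟩⟩

/-- Finitely many acceptances have a common stage, because stages are monotone. -/
theorem ball {R : I → α → β → Prop} (hR : SemiDec orc fun i (p : α × β) => R i p.1 p.2)
    {f : α → List β} (hf : Primrec f) : SemiDec orc fun i a => ∀ b ∈ f a, R i a b := by
  obtain ⟨T, hT, mT, eT⟩ := hR.exists_stage
  refine of_stage (T := fun p => ∀ b ∈ f p.2, T (p.1, p.2, b)) (by fun_prop) fun i a => ?_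
  change _ ↔ ∃ n, ∀ b ∈ f a, T (seqPrefix (orc i) n, a, b)
  constructor
  · intro h
    generalize f a = l at h ⊢
    induction l with
    | nil => simp
    | cons b l ih =>
      obtain ⟨n, hn⟩ := ih fun c hc => h c (List.mem_cons_of_mem _ hc)
      obtain ⟨m, hm⟩ := (eT i (a, b)).1 (h b List.mem_cons_self)
      refine ⟨max m n, fun c hc => ?_⟩
      rcases List.mem_cons.1 hc with rfl | hc
      · exact mT _ _ _ _ (le_max_left _ _) hm
      · exact mT _ _ _ _ (le_max_right _ _) (hn c hc)
  · rintro ⟨n, hn⟩ b hb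
    exact (eT i (a, b)).2 ⟨n, hn b hb⟩

theorem forall_lt {R : I → α → ℕ → Prop} (hR : SemiDec orc fun i (p : α × ℕ) => R i p.1 p.2)
    {f : α → ℕ} (hf : Primrec f) : SemiDec orc fun i a => ∀ k < f a, R i a k :=
  (hR.ball (f := fun a => List.range (f a)) (by fun_prop)).congr fun i a => by simp

theorem exists_lt {R : I → α → ℕ → Prop} (hR : SemiDec orc fun i (p : α × ℕ) => R i p.1 p.2)
    {f : α → ℕ} (hf : Primrec f) : SemiDec orc fun i a => ∃ k < f a, R i a k :=
  SemiDec.ex (R := fun i a k => k < f a ∧ R i a k) ((of_primrec (by fun_prop)).and hR)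

theorem oracle : SemiDec orc fun i (p : ℕ × ℕ) => orc i p.1 = p.2 :=
  of_stage (T := fun p => p.1[p.2.1]? = some p.2.2) (by fun_prop) fun i a => by
    simp only [getElem?_seqPrefix_eq_some]
    exact ⟨fun h => ⟨_, Nat.lt_succ_self _, h⟩, fun ⟨n, _, h⟩ => h⟩

theorem of_prefix {P : List ℕ × α → Prop} (hP : PrimrecPred P) {f : α → ℕ} (hf : Primrec f) :
    SemiDec orc fun i a => P (seqPrefix (orc i) (f a), a) :=
  of_stage (T := fun p => p.1.length = f p.2 ∧ P p) (by fun_prop) fun i a => by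
    simp

theorem pull (hR : SemiDec orc R) (f : J → I) : SemiDec (fun j => orc (f j)) fun j => R (f j) := by
  obtain ⟨T, hT, eT⟩ := hR
  exact ⟨T, hT, fun i a => eT _ _⟩

/-- Change of oracle, if the old oracle can be computed from the new one. -/
theorem of_graph (hR : SemiDec orc R) {orc' : I → ℕ → ℕ}
    (h : SemiDec orc' fun i (p : ℕ × ℕ) => orc i p.1 = p.2) : SemiDec orc' R := by
  obtain ⟨T, hT, eT⟩ := hR
  -- A word is guessed, verified entry by entry to be a prefix of the old oracle, and then given to
  -- the old test.
  have h1 : SemiDec orc' fun i (p : α × List ℕ × ℕ) =>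
      (∀ k < p.2.1.length, orc i k = p.2.1.getD k 0) ∧ T (p.2.1, p.1, p.2.2) := by
    refine (forall_lt (R := fun i (p : α × List ℕ × ℕ) k => orc i k = p.2.1.getD k 0)
      (h.comp (g := fun q : (α × List ℕ × ℕ) × ℕ => (q.2, q.1.2.1.getD q.2 0)) (by fun_prop))
      (by fun_prop)).and (of_primrec (by fun_prop))
  refine (SemiDec.ex (R := fun i a (p : List ℕ × ℕ) =>
    (∀ k < p.1.length, orc i k = p.1.getD k 0) ∧ T (p.1, a, p.2)) h1).congr fun i a => ?_
  rw [eT]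
  constructor
  · rintro ⟨s, b, hb⟩
    exact ⟨(_, b), (eq_seqPrefix_iff.1 rfl).2, hb⟩
  · rintro ⟨⟨l, b⟩, h1, h2⟩
    refine ⟨l.length, b, ?_⟩
    rwa [← eq_seqPrefix_iff.2 ⟨rfl, h1⟩]

theorem fst_oracle {o1 o2 : I → ℕ → ℕ} :
    SemiDec (fun i => pairSeq (o1 i) (o2 i)) fun i (p : ℕ × ℕ) => o1 i p.1 = p.2 :=
  (oracle.comp (g := fun p : ℕ × ℕ => (2 * p.1, p.2)) (by fun_prop)).congr fun i p => by
    simp [pairSeq]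

theorem snd_oracle {o1 o2 : I → ℕ → ℕ} :
    SemiDec (fun i => pairSeq (o1 i) (o2 i)) fun i (p : ℕ × ℕ) => o2 i p.1 = p.2 :=
  (oracle.comp (g := fun p : ℕ × ℕ => (2 * p.1 + 1, p.2)) (by fun_prop)).congr fun i p => by
    simp [pairSeq, Nat.add_mod, show (2 * p.1 + 1) / 2 = p.1 by omega]

/-- The graph of the prefix function of a sequence with semidecidable graph. -/
theorem graph_prefix {f : I → α → ℕ → ℕ}
    (hf : SemiDec orc fun i (p : α × ℕ × ℕ) => f i p.1 p.2.1 = p.2.2) :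
    SemiDec orc fun i (p : (α × ℕ) × List ℕ) => seqPrefix (f i p.1.1) p.1.2 = p.2 := by
  have h1 : SemiDec orc fun i (p : (α × ℕ) × List ℕ) => p.2.length = p.1.2 ∧
      ∀ k < p.2.length, f i p.1.1 k = p.2.getD k 0 :=
    (of_primrec (by fun_prop)).and (forall_lt
      (R := fun i (p : (α × ℕ) × List ℕ) k => f i p.1.1 k = p.2.getD k 0)
      (hf.comp (g := fun q : ((α × ℕ) × List ℕ) × ℕ => (q.1.1.1, q.2, q.1.2.getD q.2 0))
        (by fun_prop)) (by fun_prop))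
  exact h1.congr fun i p => by rw [← eq_seqPrefix_iff, eq_comm]

end SemiDec

/-! ### Codes of operators -/

/-- The prefix of a paired sequence, from the prefixes of the components. -/
def pairPrefix (l m : List ℕ) : List ℕ :=
  (List.range l.length).map fun n => if n % 2 = 0 then l.getD (n / 2) 0 else m.getD (n / 2) 0

theorem pairPrefix_seqPrefix (p q : ℕ → ℕ) (n : ℕ) :
    pairPrefix (seqPrefix p n) (seqPrefix q n) = seqPrefix (pairSeq p q) n := by
  unfold pairPrefix
  rw [length_seqPrefix]
  conv_rhs => rw [seqPrefix]
  refine List.map_congr_left fun k hk => ?_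
  rw [List.mem_range] at hk
  rw [getD_seqPrefix (by omega), getD_seqPrefix (by omega), pairSeq]

@[fun_prop] theorem Primrec.pairPrefix_rule {α : Type*} [Primcodable α] {f g : α → List ℕ}
    (hf : Primrec f) (hg : Primrec g) : Primrec fun a => pairPrefix (f a) (g a) := by
  unfold pairPrefix; fun_prop

open Classical in
/-- The first value below the length of `l` that the stage predicate `T` accepts at `k`, or the
length of `l` if there is none. -/
noncomputable def stageValue {α : Type*} (T : List ℕ × α × ℕ × ℕ → Prop) (l : List ℕ) (a : α)
    (k : ℕ) : ℕ :=
  (List.range l.length).findIdx fun v => decide (T (l, a, k, v))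

open Classical in
/-- The longest initial segment of values that have been found by the stage `l`. -/
noncomputable def stageOutput {α : Type*} (T : List ℕ × α × ℕ × ℕ → Prop) (l : List ℕ) (a : α) :
    List ℕ :=
  (List.range ((List.range l.length).findIdx
    fun k => decide (stageValue T l a k = l.length))).map
      fun k => stageValue T l a k

@[fun_prop] theorem Primrec.stageValue_rule {α β : Type*} [Primcodable α] [Primcodable β]
    {T : List ℕ × α × ℕ × ℕ → Prop} (hT : PrimrecPred T) {f : β → List ℕ} {g : β → α} {h : β → ℕ}
    (hf : Primrec f) (hg : Primrec g) (hh : Primrec h) :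
    Primrec fun b => stageValue T (f b) (g b) (h b) := by
  unfold stageValue; fun_prop

@[fun_prop] theorem Primrec.stageOutput_rule {α β : Type*} [Primcodable α] [Primcodable β]
    {T : List ℕ × α × ℕ × ℕ → Prop} (hT : PrimrecPred T) {f : β → List ℕ} {g : β → α}
    (hf : Primrec f) (hg : Primrec g) : Primrec fun b => stageOutput T (f b) (g b) := by
  unfold stageOutput; fun_prop

theorem List.findIdx_range_lt_iff {n m : ℕ} {p : ℕ → Bool} (h : (List.range n).findIdx p = m)
    (hm : m < n) : p m = true := by
  subst h
  have := List.findIdx_getElem (xs := List.range n) (p := p) (w := by simpa using hm)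
  simpa using this

theorem List.not_of_lt_findIdx_range {n m : ℕ} {p : ℕ → Bool} (h : m < (List.range n).findIdx p) :
    p m = false := by
  have := List.not_of_lt_findIdx h
  simpa using this

theorem stageValue_le {α : Type*} (T : List ℕ × α × ℕ × ℕ → Prop) (l : List ℕ) (a : α) (k : ℕ) :
    stageValue T l a k ≤ l.length := by
  unfold stageValue
  exact List.findIdx_le_length.trans_eq List.length_range

/-- An accepted value is the true one, so every output is a prefix of `r`. Monotonicity of the
stages ensures that each value is eventually found and stays found. -/
theorem exists_stageOutput {α : Type*} {T : List ℕ × α × ℕ × ℕ → Prop} {o : ℕ → ℕ} {a : α}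
    {r : ℕ → ℕ} (mono : ∀ b m n, m ≤ n → T (seqPrefix o m, b) → T (seqPrefix o n, b))
    (hr : ∀ k v, r k = v ↔ ∃ n, T (seqPrefix o n, a, k, v)) :
    (∀ n, ∃ m, stageOutput T (seqPrefix o n) a = seqPrefix r m) ∧
    ∀ m, ∃ n, ∃ k, m ≤ k ∧ stageOutput T (seqPrefix o n) a = seqPrefix r k := by
  classical
  have h1 : ∀ n k, stageValue T (seqPrefix o n) a k ≠ n →
      stageValue T (seqPrefix o n) a k = r k := by
    intro n k hk
    have h2 := stageValue_le T (seqPrefix o n) a k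
    rw [length_seqPrefix] at h2
    have h3 := List.findIdx_range_lt_iff (n := (seqPrefix o n).length)
      (m := stageValue T (seqPrefix o n) a k) (p := fun v => decide (T (seqPrefix o n, a, k, v)))
      rfl (by rw [length_seqPrefix]; omega)
    exact ((hr k _).2 ⟨n, by simpa using h3⟩).symm
  have h2 : ∀ n, stageOutput T (seqPrefix o n) a = seqPrefix r ((List.range n).findIdx
      fun k => decide (stageValue T (seqPrefix o n) a k = n)) := by
    intro n
    unfold stageOutput
    rw [length_seqPrefix]
    conv_rhs => rw [seqPrefix]
    refine List.map_congr_left fun k hk => h1 n k ?_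
    rw [List.mem_range] at hk
    simpa using List.not_of_lt_findIdx_range hk
  refine ⟨fun n => ⟨_, h2 n⟩, fun m => ?_⟩
  -- The stage `N` has to exceed the values too, since values are only searched below the length
  -- read. With `m < N`, an index below `m` returned by `findIdx` is a genuine failure and not the
  -- default.
  have h3 : ∃ N, m < N ∧ ∀ k < m, r k < N ∧ T (seqPrefix o N, a, k, r k) := by
    clear h1 h2
    induction m with
    | zero => exact ⟨1, by simp⟩
    | succ m ih =>
      obtain ⟨N, h4, h5⟩ := ih
      obtain ⟨n, hn⟩ := (hr m _).1 rfl
      refine ⟨max (max (N + 1) n) (r m + 1), by omega, fun k hk => ?_⟩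
      rcases Nat.lt_succ_iff_lt_or_eq.1 hk with hk | rfl
      · exact ⟨by have := (h5 k hk).1; omega, mono _ _ _ (by omega) (h5 k hk).2⟩
      · exact ⟨by omega, mono _ _ _ (by omega) hn⟩
  obtain ⟨N, h4, h5⟩ := h3
  refine ⟨N, _, ?_, h2 N⟩
  by_contra! hlt
  have h6 := List.findIdx_range_lt_iff rfl (hlt.trans h4)
  set k := (List.range N).findIdx fun k => decide (stageValue T (seqPrefix o N) a k = N)
  have h7 : N ≤ stageValue T (seqPrefix o N) a k := (of_decide_eq_true h6).ge
  have h8 := List.not_of_lt_findIdx_range (n := (seqPrefix o N).length)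
    (p := fun v => decide (T (seqPrefix o N, a, k, v))) ((h5 k hlt).1.trans_le h7)
  simp [(h5 k hlt).2] at h8

/-- An operator with semidecidable graph has a code that can be computed from the oracle. -/
theorem exists_code {I J α : Type*} [Primcodable α] (base : J → I) (orc : I → ℕ → ℕ)
    (q : J → ℕ → ℕ) (r : J → α → ℕ → ℕ)
    (h : SemiDec (fun j => pairSeq (orc (base j)) (q j))
      fun j (p : α × ℕ × ℕ) => r j p.1 p.2.1 = p.2.2) :
    ∃ C : List ℕ × α × ℕ → ℕ, Primrec C ∧
      ∀ j a, Maps (fun k => C (seqPrefix (orc (base j)) k, a, k)) (q j) (r j a) := by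
  obtain ⟨T, hT, mT, eT⟩ := h.exists_stage
  -- The table entry at `k` belongs to the input word with code `k`. A word is no longer than its
  -- code, so the oracle prefix of length `k` can be cut to the length of the word.
  refine ⟨fun p => Encodable.encode (stageOutput T (pairPrefix
    (p.1.take (Denumerable.ofNat (List ℕ) p.2.2).length) (Denumerable.ofNat (List ℕ) p.2.2)) p.2.1),
    by fun_prop, fun j a => ?_⟩
  have key : ∀ n, wordFun (fun k => Encodable.encode (stageOutput T (pairPrefix
      ((seqPrefix (orc (base j)) k).take (Denumerable.ofNat (List ℕ) k).length)
      (Denumerable.ofNat (List ℕ) k)) a)) (seqPrefix (q j) n) =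
      stageOutput T (seqPrefix (pairSeq (orc (base j)) (q j)) n) a := by
    intro n
    have h1 := Encodable.length_le_encode (seqPrefix (q j) n)
    simp only [wordFun, Denumerable.ofNat_encode, length_seqPrefix, take_seqPrefix] at h1 ⊢
    rw [min_eq_left h1, pairPrefix_seqPrefix]
  have := exists_stageOutput (o := pairSeq (orc (base j)) (q j)) (a := a) (r := r j a)
    (fun b m n hmn => mT j b m n hmn) (fun k v => eT j (a, k, v))
  simpa only [Maps, key] using this

theorem SemiDec.graph_of_primrec {I α : Type*} [Primcodable α] {orc : I → ℕ → ℕ}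
    {C : List ℕ × α × ℕ → ℕ} (hC : Primrec C) :
    SemiDec orc fun i (p : α × ℕ × ℕ) => C (seqPrefix (orc i) p.2.1, p.1, p.2.1) = p.2.2 :=
  SemiDec.of_prefix (P := fun p : List ℕ × α × ℕ × ℕ => C (p.1, p.2.1, p.2.2.1) = p.2.2.2)
    (by fun_prop) (by fun_prop)

theorem Computable.seqPrefix {o : ℕ → ℕ} (ho : Computable o) :
    Computable fun n => seqPrefix o n := by
  have h : Computable fun n : ℕ => (Nat.rec [] (fun k l => l ++ [o k]) n : List ℕ) :=
    Computable.nat_rec (f := fun n : ℕ => n) (g := fun _ => ([] : List ℕ))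
      (h := fun _ (p : ℕ × List ℕ) => p.2 ++ [o p.1]) Computable.id (Computable.const _)
      ((Computable.list_concat.comp (Computable.snd.comp Computable.snd)
        (ho.comp (Computable.fst.comp Computable.snd))).to₂)
  refine h.of_eq fun n => ?_
  induction n with
  | zero => rfl
  | succ n ih =>
    simp only [ih]
    simp [_root_.seqPrefix, List.range_succ]

theorem Computable.pairSeq {p q : ℕ → ℕ} (hp : Computable p) (hq : Computable q) :
    Computable (pairSeq p q) := by
  have h : Computable fun n : ℕ => _root_.cond (decide (n % 2 = 0)) (p (n / 2)) (q (n / 2)) := by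
    have hd : Computable fun n : ℕ => n / 2 :=
      (show Primrec fun n : ℕ => n / 2 by fun_prop).to_comp
    refine Computable.cond ?_ (hp.comp hd) (hq.comp hd)
    exact (primrecPred_iff_primrec_decide.1 (show PrimrecPred fun n : ℕ => n % 2 = 0 by
      fun_prop)).to_comp
  exact h.of_eq fun n => by by_cases h : n % 2 = 0 <;> simp [_root_.pairSeq, h]

/-! ### Open sets with semidecidable membership -/

/-- A point together with a name of it. -/
structure NamedPoint {X : Type*} (A : Naming X) where
  name : ℕ → ℕ
  point : X
  isName : A name point

/-- Membership in the sets `V j a` is semidecidable from names of points. -/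
def SemiDecOpen {X J α : Type*} [Primcodable α] (A : Naming X) (orc : J → ℕ → ℕ)
    (V : J → α → Set X) : Prop :=
  SemiDec (fun t : J × NamedPoint A => pairSeq (orc t.1) t.2.name) fun t a => t.2.point ∈ V t.1 a

-- On a name of a point, the operator writes at position `k` whether the semidecision has accepted
-- by stage `k`. The output is an infinite sequence in either case, hence also a name of falsity.
open Classical in
theorem SemiDecOpen.exists_name {X J α : Type*} [Primcodable α] {A : Naming X} {orc : J → ℕ → ℕ}
    {V : J → α → Set X} (h : SemiDecOpen A orc V) : ∃ u : J → α → ℕ → ℕ,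
      (∀ j a, openNaming A (u j a) (V j a)) ∧
      SemiDec orc fun j (p : α × ℕ × ℕ) => u j p.1 p.2.1 = p.2.2 := by
  obtain ⟨T, hT, mT, eT⟩ := SemiDec.exists_stage h
  obtain ⟨C, hC, hm⟩ := exists_code (I := J) (J := J × NamedPoint A) (α := α) Prod.fst orc
    (fun t => t.2.name)
    (fun t a k => if T (seqPrefix (pairSeq (orc t.1) t.2.name) k, a) then 1 else 0)
    (SemiDec.of_prefix (P := fun p : List ℕ × α × ℕ × ℕ =>
      (if T (p.1, p.2.1) then 1 else 0) = p.2.2.2) (by fun_prop) (f := fun p => p.2.1)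
      (by fun_prop))
  refine ⟨fun j a k => C (seqPrefix (orc j) k, a, k), fun j a q x hq => ?_,
    SemiDec.graph_of_primrec hC⟩
  refine ⟨_, hm (j, ⟨q, x, hq⟩) a, ?_⟩
  have := eT (j, ⟨q, x, hq⟩) a
  simp only [sierpinskiNaming] at this ⊢
  rw [this]
  simp

/-! ### From valuations to Borel measures -/

namespace OpenValuation

variable {X : Type*}

/-- Monotonicity is not among the axioms; it follows from continuity along the sequence `U, V, V,
...`. -/
theorem mono [TopologicalSpace X] (ν : OpenValuation X) {U V : Opens X} (h : U ≤ V) :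
    ν.toFun U ≤ ν.toFun V := by
  have hm : Monotone fun n : ℕ => if n = 0 then U else V := by
    refine monotone_nat_of_le_succ fun n => ?_
    by_cases hn : n = 0 <;> simp [hn, h]
  have e : ⨆ n : ℕ, (if n = 0 then U else V) = V :=
    le_antisymm (iSup_le fun n => by split_ifs <;> simp [h]) (le_iSup_of_le 1 (by simp))
  have := ν.continuous _ hm
  rw [e] at this
  rw [this]
  exact le_iSup_of_le (f := fun n : ℕ => ν.toFun (if n = 0 then U else V)) 0 (by simp)

theorem sup_le [TopologicalSpace X] (ν : OpenValuation X) (U V : Opens X) :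
    ν.toFun (U ⊔ V) ≤ ν.toFun U + ν.toFun V := by
  rw [ν.modular]; exact le_self_add

/-- Modularity gives finite subadditivity, and continuity along the finite unions makes it
countable. -/
theorem iSup_le_tsum [TopologicalSpace X] (ν : OpenValuation X) (V : ℕ → Opens X) :
    ν.toFun (⨆ n, V n) ≤ ∑' n, ν.toFun (V n) := by
  have e : ⨆ n, V n = ⨆ n, partialSups V n := (iSup_partialSups_eq V).symm
  rw [e, ν.continuous _ (partialSups V).monotone]
  refine iSup_le fun n => ?_
  have : ν.toFun (partialSups V n) ≤ ∑ k ∈ Finset.range (n + 1), ν.toFun (V k) := by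
    induction n with
    | zero => simp
    | succ n ih =>
      rw [partialSups_add_one, Finset.sum_range_succ]
      exact (ν.sup_le _ _).trans (by gcongr)
  exact this.trans (ENNReal.sum_le_tsum _)

/-- The outer measure of a valuation. -/
noncomputable def outerMeasure [TopologicalSpace X] (ν : OpenValuation X) : OuterMeasure X :=
  inducedOuterMeasure (P := IsOpen) (fun s h => ν.toFun ⟨s, h⟩) isOpen_empty ν.empty

theorem iSup_mk [TopologicalSpace X] {f : ℕ → Set X} (h : ∀ i, IsOpen (f i)) :
    (⟨⋃ i, f i, isOpen_iUnion h⟩ : Opens X) = ⨆ i, ⟨f i, h i⟩ := by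
  ext x; simp

theorem outerMeasure_open [TopologicalSpace X] (ν : OpenValuation X) (U : Opens X) :
    ν.outerMeasure U = ν.toFun U :=
  inducedOuterMeasure_eq' (P := IsOpen) (m := fun s h => ν.toFun ⟨s, h⟩)
    (fun _ h => isOpen_iUnion h) (fun f h => by
      rw [iSup_mk h]
      exact ν.iSup_le_tsum _)
    (fun _ _ _ _ h => ν.mono h) U.isOpen

theorem outerMeasure_eq_iInf [TopologicalSpace X] (ν : OpenValuation X) (s : Set X) :
    ν.outerMeasure s = ⨅ (U : Set X) (h : IsOpen U) (_ : s ⊆ U), ν.toFun ⟨U, h⟩ :=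
  inducedOuterMeasure_eq_iInf (P := IsOpen) (m := fun s h => ν.toFun ⟨s, h⟩)
    (fun _ h => isOpen_iUnion h) (fun f h => by
      rw [iSup_mk h]
      exact ν.iSup_le_tsum _)
    (fun _ _ _ _ h => ν.mono h) s

/-- Two sets at positive distance are separated by the disjoint open sets of points closer to one
than to the other, and modularity is additivity on disjoint open sets. By Carathéodory's criterion,
Borel sets are then measurable. -/
theorem isMetric_outerMeasure [MetricSpace X] (ν : OpenValuation X) :
    ν.outerMeasure.IsMetric := by
  rintro s t ⟨r, hr0, hr⟩
  refine le_antisymm (measure_union_le s t) ?_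
  rw [ν.outerMeasure_eq_iInf (s ∪ t)]
  refine le_iInf fun W => le_iInf fun hW => le_iInf fun hst => ?_
  have hs : Continuous fun z : X => Metric.infEDist z s := Metric.continuous_infEDist
  have ht : Continuous fun z : X => Metric.infEDist z t := Metric.continuous_infEDist
  let A : Opens X := ⟨W ∩ {z | Metric.infEDist z s < Metric.infEDist z t},
    hW.inter (isOpen_lt hs ht)⟩
  let B : Opens X := ⟨W ∩ {z | Metric.infEDist z t < Metric.infEDist z s},
    hW.inter (isOpen_lt ht hs)⟩
  have hA : s ⊆ A := fun x hx => ⟨hst (Or.inl hx), by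
    rw [mem_ofPred_eq, Metric.infEDist_zero_of_mem hx]
    exact (pos_iff_ne_zero.2 hr0).trans_le (Metric.le_infEDist.2 fun y hy => hr x hx y hy)⟩
  have hB : t ⊆ B := fun x hx => ⟨hst (Or.inr hx), by
    rw [mem_ofPred_eq, Metric.infEDist_zero_of_mem hx]
    refine (pos_iff_ne_zero.2 hr0).trans_le (Metric.le_infEDist.2 fun y hy => ?_)
    rw [edist_comm]
    exact hr y hy x hx⟩
  have hAB : A ⊓ B = ⊥ := by
    ext x
    simp only [Opens.coe_inf, Opens.coe_bot, mem_inter_iff, mem_empty_iff_false, iff_false]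
    rintro ⟨⟨_, h1⟩, _, h2⟩
    exact lt_asymm (show Metric.infEDist x s < _ from h1) h2
  calc ν.outerMeasure s + ν.outerMeasure t ≤ ν.outerMeasure A + ν.outerMeasure B := by
        gcongr
    _ = ν.toFun (A ⊔ B) := by
        rw [ν.outerMeasure_open, ν.outerMeasure_open, ν.modular, hAB, ν.empty, add_zero]
    _ ≤ ν.toFun ⟨W, hW⟩ := ν.mono (_root_.sup_le (fun x hx => hx.1) (fun x hx => hx.1))

/-- Every valuation on a metric space extends to a Borel measure. -/
theorem exists_measure [MetricSpace X] [MeasurableSpace X] [BorelSpace X] (ν : OpenValuation X) :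
    ∃ μ : Measure X, ∀ U : Opens X, μ U = ν.toFun U :=
  ⟨ν.outerMeasure.toMeasure ν.isMetric_outerMeasure.le_caratheodory, fun U => by
    rw [toMeasure_apply _ _ U.isOpen.measurableSet, ν.outerMeasure_open]⟩

end OpenValuation

/-! ### Counting grid cells inside an interval -/

/-- The cells of the grid of mesh `1 / K` that lie inside the interval from `a` to `b`. -/
noncomputable def gridCells (K : ℕ) (a b : ℝ) : Finset ℕ :=
  (Finset.range K).filter fun k => a * K < k ∧ (k : ℝ) + 1 < b * K

/-- The bound `k < K` is automatic because `b ≤ 1`. -/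
theorem gridCells_eq_Ico {K : ℕ} {a b : ℝ} (ha : 0 ≤ a) (hb : b ≤ 1) :
    gridCells K a b = Finset.Ico (⌊a * K⌋₊ + 1) (⌈b * K⌉₊ - 1) := by
  ext k
  simp only [gridCells, Finset.mem_filter, Finset.mem_range, Finset.mem_Ico, Nat.succ_le_iff,
    Nat.floor_lt (mul_nonneg ha (Nat.cast_nonneg K))]
  rw [show k < ⌈b * K⌉₊ - 1 ↔ k + 1 < ⌈b * K⌉₊ by omega, Nat.lt_ceil]
  push_cast
  refine ⟨fun h => h.2, fun h => ⟨?_, h⟩⟩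
  have h1 : b * K ≤ K := mul_le_of_le_one_left (Nat.cast_nonneg K) hb
  have h2 : (k : ℝ) < K := by linarith [h.2]
  exact_mod_cast h2

theorem card_gridCells_le {K : ℕ} {a b : ℝ} (ha : 0 ≤ a) (hab : a ≤ b) (hb : b ≤ 1) :
    ((gridCells K a b).card : ℝ) ≤ (b - a) * K := by
  rw [gridCells_eq_Ico ha hb, Nat.card_Ico]
  have hK : (0 : ℝ) ≤ K := Nat.cast_nonneg K
  have h0 : 0 ≤ (b - a) * K := mul_nonneg (by linarith) hK
  by_cases h : ⌊a * K⌋₊ + 1 ≤ ⌈b * K⌉₊ - 1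
  · rw [Nat.cast_sub h, Nat.cast_sub (by omega)]
    have h1 := Nat.lt_floor_add_one (a * K)
    have h2 := Nat.ceil_lt_add_one (mul_nonneg (ha.trans hab) hK)
    push_cast
    linarith
  · rw [Nat.sub_eq_zero_of_le (by omega)]
    simpa using h0

/-- At most one unit is lost at each end, hence the constant 2. -/
theorem le_card_gridCells {K : ℕ} {a b : ℝ} (ha : 0 ≤ a) (hb : b ≤ 1) :
    (b - a) * K - 2 ≤ ((gridCells K a b).card : ℝ) := by
  rw [gridCells_eq_Ico ha hb, Nat.card_Ico]
  have hK : (0 : ℝ) ≤ K := Nat.cast_nonneg K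
  have h1 := Nat.floor_le (mul_nonneg ha hK)
  have h2 := Nat.le_ceil (b * K)
  have h3 : ((⌈b * K⌉₊ : ℕ) : ℝ) ≤ (⌈b * K⌉₊ - 1 - (⌊a * K⌋₊ + 1) : ℕ) + ⌊a * K⌋₊ + 2 := by
    norm_cast
    omega
  linarith

/-! ### Dyadic intervals in the Cantor space -/

/-- The number written by the first `N` bits of a point. -/
def cantorVal : ℕ → Cantor → ℕ
  | 0, _ => 0
  | N + 1, ω => 2 * cantorVal N ω + (ω N).toNat

theorem cantorVal_lt (N : ℕ) (ω : Cantor) : cantorVal N ω < 2 ^ N := by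
  induction N with
  | zero => simp [cantorVal]
  | succ N ih =>
    have := Bool.toNat_le (ω N)
    rw [cantorVal, pow_succ]
    omega

theorem continuous_cantorVal (N : ℕ) : Continuous (cantorVal N) := by
  induction N with
  | zero => exact continuous_const
  | succ N ih =>
    have h : Continuous fun ω : Cantor => (ω N).toNat :=
      (continuous_of_discreteTopology (f := Bool.toNat)).comp (continuous_apply N)
    exact (continuous_const.mul ih).add h

theorem cantorVal_eq_iff {N v : ℕ} (hv : v < 2 ^ N) (ω : Cantor) :
    cantorVal N ω = v ↔ ∀ i < N, ω i = v.testBit (N - 1 - i) := by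
  induction N generalizing v with
  | zero => simp [cantorVal]; omega
  | succ N ih =>
    have h1 : cantorVal (N + 1) ω = v ↔ cantorVal N ω = v / 2 ∧ ω N = v.testBit 0 := by
      rw [cantorVal, Nat.testBit_zero]
      rcases ω N <;> simp <;> omega
    rw [h1, ih (by rw [pow_succ] at hv; omega), Nat.forall_lt_succ_right]
    refine and_congr (forall₂_congr fun i hi => ?_) (by simp)
    rw [← Nat.testBit_add_one, show N + 1 - 1 - i = N - 1 - i + 1 by omega]

theorem coin_cantorVal {N v : ℕ} (hv : v < 2 ^ N) :
    coin {ω | cantorVal N ω = v} = (2 : ℝ≥0∞)⁻¹ ^ N := by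
  have e : {ω : Cantor | cantorVal N ω = v} =
      Set.pi (Finset.range N) fun i => {v.testBit (N - 1 - i)} := by
    ext ω
    simp [cantorVal_eq_iff hv, Set.mem_pi]
  rw [e, coin, Measure.infinitePi_pi _ (fun i _ => measurableSet_singleton _)]
  simp

theorem coin_cantorVal_mem {N : ℕ} (s : Finset ℕ) (hs : ∀ v ∈ s, v < 2 ^ N) :
    coin {ω | cantorVal N ω ∈ s} = s.card * (2 : ℝ≥0∞)⁻¹ ^ N := by
  have e : {ω : Cantor | cantorVal N ω ∈ s} = ⋃ v ∈ s, {ω | cantorVal N ω = v} := by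
    ext ω; simp
  rw [e, measure_biUnion_finset]
  · rw [Finset.sum_congr rfl fun v hv => coin_cantorVal (hs v hv)]
    simp
  · intro v _ w _ hvw
    refine Set.disjoint_left.2 fun ω h1 h2 => hvw ?_
    rw [mem_ofPred_eq] at h1 h2
    exact h1.symm.trans h2
  · exact fun v _ => (continuous_cantorVal N).measurable (measurableSet_singleton v)

/-- The points whose first `N` bits put them strictly inside the interval from `a` to `b`. -/
def intervalStage (a b : ℝ) (N : ℕ) : Set Cantor :=
  {ω | a * 2 ^ N < cantorVal N ω ∧ (cantorVal N ω : ℝ) + 1 < b * 2 ^ N}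

/-- Both halves of a dyadic interval that is strictly inside are again strictly inside. -/
theorem intervalStage_mono (a b : ℝ) : Monotone (intervalStage a b) := by
  refine monotone_nat_of_le_succ fun N ω h => ?_
  simp only [intervalStage, mem_ofPred_eq, cantorVal, pow_succ] at h ⊢
  have h1 : ((ω N).toNat : ℝ) ≤ 1 := by exact_mod_cast Bool.toNat_le _
  have h2 : (0 : ℝ) ≤ ((ω N).toNat : ℝ) := Nat.cast_nonneg _
  push_cast
  constructor <;> linarith [h.1, h.2]

/-- The points that are strictly inside the interval from `a` to `b`, as binary expansions. -/
def intervalSet (a b : ℝ) : Set Cantor := ⋃ N, intervalStage a b N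

theorem isOpen_intervalSet (a b : ℝ) : IsOpen (intervalSet a b) := by
  refine isOpen_iUnion fun N => ?_
  have : intervalStage a b N = cantorVal N ⁻¹' {v | a * 2 ^ N < v ∧ (v : ℝ) + 1 < b * 2 ^ N} := rfl
  rw [this]
  exact (isOpen_discrete _).preimage (continuous_cantorVal N)

theorem coin_intervalStage {a b : ℝ} (N : ℕ) :
    coin (intervalStage a b N) = (gridCells (2 ^ N) a b).card * (2 : ℝ≥0∞)⁻¹ ^ N := by
  rw [← coin_cantorVal_mem (N := N) (gridCells (2 ^ N) a b) fun v hv =>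
    Finset.mem_range.1 (Finset.mem_filter.1 hv).1]
  congr 1
  ext ω
  simp [intervalStage, gridCells, cantorVal_lt]

/-- The dyadic intervals of level `N` that are strictly inside fill the interval up to `2 · 2⁻ᴺ`. -/
theorem coin_intervalSet {a b : ℝ} (ha : 0 ≤ a) (hab : a ≤ b) (hb : b ≤ 1) :
    coin (intervalSet a b) = ENNReal.ofReal (b - a) := by
  have h1 : Tendsto (fun N => coin (intervalStage a b N)) atTop (𝓝 (coin (intervalSet a b))) :=
    tendsto_measure_iUnion_atTop (intervalStage_mono a b)
  refine tendsto_nhds_unique h1 ?_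
  have h2 : ∀ N, coin (intervalStage a b N) =
      ENNReal.ofReal ((gridCells (2 ^ N) a b).card * (2 : ℝ)⁻¹ ^ N) := by
    intro N
    rw [coin_intervalStage, ENNReal.ofReal_mul (Nat.cast_nonneg _), ENNReal.ofReal_natCast,
      ENNReal.ofReal_pow (by norm_num), ENNReal.ofReal_inv_of_pos (by norm_num),
      ENNReal.ofReal_ofNat]
  simp only [h2]
  refine (ENNReal.continuous_ofReal.tendsto _).comp ?_
  have h3 : Tendsto (fun N : ℕ => (b - a) - 2 * (2 : ℝ)⁻¹ ^ N) atTop (𝓝 (b - a)) := by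
    have := (tendsto_pow_atTop_nhds_zero_of_lt_one (r := (2 : ℝ)⁻¹) (by norm_num)
      (by norm_num)).const_mul 2
    simpa using this.const_sub (b - a)
  refine tendsto_of_tendsto_of_tendsto_of_le_of_le h3 tendsto_const_nhds (fun N => ?_) fun N => ?_
  · have h4 := le_card_gridCells (K := 2 ^ N) ha hb
    have h5 : (0 : ℝ) < 2⁻¹ ^ N := by positivity
    have h6 : (2 : ℝ) ^ N * 2⁻¹ ^ N = 1 := by rw [← mul_pow]; norm_num
    push_cast at h4
    have h7 := mul_le_mul_of_nonneg_right h4 h5.le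
    have h8 : ((b - a) * 2 ^ N - 2) * (2 : ℝ)⁻¹ ^ N = b - a - 2 * 2⁻¹ ^ N := by
      rw [sub_mul, mul_assoc, h6, mul_one]
    linarith
  · have h4 := card_gridCells_le (K := 2 ^ N) ha hab hb
    have h5 : (0 : ℝ) < 2⁻¹ ^ N := by positivity
    have h6 : (2 : ℝ) ^ N * 2⁻¹ ^ N = 1 := by rw [← mul_pow]; norm_num
    push_cast at h4
    have h7 := mul_le_mul_of_nonneg_right h4 h5.le
    rwa [mul_assoc, h6, mul_one] at h7

theorem intervalSet_subset {a b a' b' : ℝ} (ha : a' ≤ a) (hb : b ≤ b') :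
    intervalSet a b ⊆ intervalSet a' b' := by
  refine iUnion_mono fun N ω h => ?_
  have h2 : (0 : ℝ) < 2 ^ N := by positivity
  exact ⟨(mul_le_mul_of_nonneg_right ha h2.le).trans_lt h.1,
    h.2.trans_le (mul_le_mul_of_nonneg_right hb h2.le)⟩

theorem disjoint_intervalSet {a b a' b' : ℝ} (h : b ≤ a') :
    Disjoint (intervalSet a b) (intervalSet a' b') := by
  refine Set.disjoint_left.2 fun ω h1 h2 => ?_
  obtain ⟨M, hM⟩ := mem_iUnion.1 h1
  obtain ⟨N, hN⟩ := mem_iUnion.1 h2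
  have hM := (intervalStage_mono a b (le_max_left M N) hM).2
  have hN := (intervalStage_mono a' b' (le_max_right M N) hN).1
  have := mul_le_mul_of_nonneg_right h (show (0 : ℝ) ≤ 2 ^ max M N by positivity)
  linarith

/-! ### Trees of intervals -/

/-- Incomparable nodes branch at a last common ancestor `c`, where disjointness of the children's
cells can be applied. -/
theorem List.prefix_trichotomy {α : Type*} (s t : List α) :
    s <+: t ∨ t <+: s ∨ ∃ c k l, k ≠ l ∧ c ++ [k] <+: s ∧ c ++ [l] <+: t := by
  induction s generalizing t with
  | nil => exact Or.inl List.nil_prefix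
  | cons a s ih =>
    cases t with
    | nil => exact Or.inr (Or.inl List.nil_prefix)
    | cons b t =>
      by_cases hab : a = b
      · subst hab
        rcases ih t with h | h | ⟨c, k, l, hkl, h1, h2⟩
        · exact Or.inl (by simpa [List.cons_prefix_cons] using h)
        · exact Or.inr (Or.inl (by simpa [List.cons_prefix_cons] using h))
        · exact Or.inr (Or.inr ⟨a :: c, k, l, hkl, by simpa [List.cons_prefix_cons] using h1,
            by simpa [List.cons_prefix_cons] using h2⟩)
      · exact Or.inr (Or.inr ⟨[], a, b, hab, by simp [List.cons_prefix_cons],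
          by simp [List.cons_prefix_cons]⟩)

/-- A tree of intervals: the unit interval is subdivided into countably many successive intervals,
and so on. -/
structure IntervalTree where
  lo : List ℕ → ℝ
  hi : List ℕ → ℝ
  lo_nil : lo [] = 0
  hi_nil : hi [] = 1
  lo_le_hi : ∀ s, lo s ≤ hi s
  lo_snoc_zero : ∀ s, lo (s ++ [0]) = lo s
  hi_snoc : ∀ s k, hi (s ++ [k]) = lo (s ++ [k + 1])
  tendsto : ∀ s, Tendsto (fun k => lo (s ++ [k])) atTop (𝓝 (hi s))

namespace IntervalTree

variable (T : IntervalTree)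

/-- The length of an interval. -/
noncomputable def mass (s : List ℕ) : ℝ≥0∞ := ENNReal.ofReal (T.hi s - T.lo s)

/-- The set of points of the Cantor space in an interval. -/
def cell (s : List ℕ) : Set Cantor := intervalSet (T.lo s) (T.hi s)

theorem lo_snoc_mono (s : List ℕ) : Monotone fun k => T.lo (s ++ [k]) :=
  monotone_nat_of_le_succ fun k => (T.lo_le_hi _).trans_eq (T.hi_snoc s k)

theorem lo_le_snoc (s : List ℕ) (k : ℕ) : T.lo s ≤ T.lo (s ++ [k]) :=
  (T.lo_snoc_zero s).symm.trans_le (T.lo_snoc_mono s (Nat.zero_le k))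

theorem lo_snoc_le (s : List ℕ) (k : ℕ) : T.lo (s ++ [k]) ≤ T.hi s :=
  (T.lo_snoc_mono s).ge_of_tendsto (T.tendsto s) k

theorem hi_snoc_le (s : List ℕ) (k : ℕ) : T.hi (s ++ [k]) ≤ T.hi s :=
  (T.hi_snoc s k).trans_le (T.lo_snoc_le s _)

theorem le_of_prefix {s t : List ℕ} (h : s <+: t) : T.lo s ≤ T.lo t ∧ T.hi t ≤ T.hi s := by
  obtain ⟨r, rfl⟩ := h
  induction r using List.reverseRecOn with
  | nil => simp
  | append_singleton r k ih =>
    rw [← List.append_assoc]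
    exact ⟨ih.1.trans (T.lo_le_snoc _ k), (T.hi_snoc_le _ k).trans ih.2⟩

theorem lo_nonneg (s : List ℕ) : 0 ≤ T.lo s :=
  T.lo_nil.symm.trans_le (T.le_of_prefix List.nil_prefix).1

theorem hi_le_one (s : List ℕ) : T.hi s ≤ 1 :=
  (T.le_of_prefix List.nil_prefix).2.trans_eq T.hi_nil

theorem lo_le_one (s : List ℕ) : T.lo s ≤ 1 := (T.lo_le_hi s).trans (T.hi_le_one s)

theorem hi_nonneg (s : List ℕ) : 0 ≤ T.hi s := (T.lo_nonneg s).trans (T.lo_le_hi s)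

theorem mass_nil : T.mass [] = 1 := by simp [mass, T.lo_nil, T.hi_nil]

theorem mass_ne_top (s : List ℕ) : T.mass s ≠ ∞ := ENNReal.ofReal_ne_top

/-- The sum telescopes, as each child ends where the next one starts and the left ends converge to
`hi s`. -/
theorem tsum_mass_snoc (s : List ℕ) : ∑' k, T.mass (s ++ [k]) = T.mass s := by
  have h : ∀ n, ∑ k ∈ Finset.range n, T.mass (s ++ [k]) =
      ENNReal.ofReal (T.lo (s ++ [n]) - T.lo s) := by
    intro n
    induction n with
    | zero => simp [T.lo_snoc_zero]
    | succ n ih =>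
      rw [Finset.sum_range_succ, ih, mass, T.hi_snoc, ← ENNReal.ofReal_add]
      · congr 1; ring
      · linarith [T.lo_le_snoc s n]
      · linarith [T.lo_snoc_mono s (Nat.le_succ n)]
  refine tendsto_nhds_unique (ENNReal.tendsto_nat_tsum _) ?_
  simp only [h]
  exact (ENNReal.continuous_ofReal.tendsto _).comp ((T.tendsto s).sub_const _)

theorem isOpen_cell (s : List ℕ) : IsOpen (T.cell s) := isOpen_intervalSet _ _

theorem coin_cell (s : List ℕ) : coin (T.cell s) = T.mass s :=
  coin_intervalSet (T.lo_nonneg s) (T.lo_le_hi s) (T.hi_le_one s)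

theorem cell_subset_of_prefix {s t : List ℕ} (h : s <+: t) : T.cell t ⊆ T.cell s :=
  intervalSet_subset (T.le_of_prefix h).1 (T.le_of_prefix h).2

theorem mass_ne_zero_of_mem {s : List ℕ} {ω : Cantor} (h : ω ∈ T.cell s) : T.mass s ≠ 0 := by
  intro h0
  rw [mass, ENNReal.ofReal_eq_zero, sub_nonpos] at h0
  -- A cell with `hi s ≤ lo s` is disjoint from itself.
  exact Set.disjoint_left.1 (disjoint_intervalSet h0) h h

theorem disjoint_snoc {s : List ℕ} {k l : ℕ} (h : k ≠ l) :
    Disjoint (T.cell (s ++ [k])) (T.cell (s ++ [l])) := by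
  wlog hkl : k < l generalizing k l
  · exact (this h.symm (by omega)).symm
  · exact disjoint_intervalSet ((T.hi_snoc s k).trans_le (T.lo_snoc_mono s hkl))

/-- Incomparable nodes lie below distinct children of one node, whose cells are disjoint. -/
theorem comparable_of_mem {s t : List ℕ} {ω : Cantor} (hs : ω ∈ T.cell s) (ht : ω ∈ T.cell t) :
    s <+: t ∨ t <+: s := by
  rcases List.prefix_trichotomy s t with h | h | ⟨c, k, l, hkl, h1, h2⟩
  · exact Or.inl h
  · exact Or.inr h
  · exact (Set.disjoint_left.1 (T.disjoint_snoc hkl) (T.cell_subset_of_prefix h1 hs)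
      (T.cell_subset_of_prefix h2 ht)).elim

/-- The open cells of the children omit the division points, so they fill the parent only up to a
null set; this is seen from the measures. -/
theorem iUnion_snoc_ae_eq (s : List ℕ) :
    (⋃ k, T.cell (s ++ [k]) : Set Cantor) =ᵐ[coin] T.cell s := by
  refine ae_eq_of_subset_of_measure_ge
    (iUnion_subset fun k => T.cell_subset_of_prefix (List.prefix_append _ _)) ?_
    (MeasurableSet.iUnion fun k => (T.isOpen_cell _).measurableSet).nullMeasurableSet
    (measure_ne_top _ _)
  rw [measure_iUnion (fun k l hkl => T.disjoint_snoc hkl)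
    fun k => (T.isOpen_cell _).measurableSet, T.coin_cell, ← T.tsum_mass_snoc]
  simp [T.coin_cell]

theorem coin_inter_cell (s : List ℕ) {A : Set Cantor} (hA : MeasurableSet A) :
    coin (T.cell s ∩ A) = ∑' k, coin (T.cell (s ++ [k]) ∩ A) := by
  rw [← measure_congr ((T.iUnion_snoc_ae_eq s).inter (ae_eq_refl A)), iUnion_inter,
    measure_iUnion]
  · exact fun k l hkl => (T.disjoint_snoc hkl).mono inter_subset_left inter_subset_left
  · exact fun k => (T.isOpen_cell _).measurableSet.inter hA

theorem coin_inter_cell_nil (A : Set Cantor) : coin (T.cell [] ∩ A) = coin A := by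
  have h : T.cell [] =ᵐ[coin] (univ : Set Cantor) := by
    refine ae_eq_of_subset_of_measure_ge (subset_univ _) ?_
      (T.isOpen_cell _).measurableSet.nullMeasurableSet (measure_ne_top _ _)
    rw [T.coin_cell, T.mass_nil, measure_univ]
  rw [measure_congr (h.inter (ae_eq_refl A)), univ_inter]

/-- Comparison of two functions on the tree that are additive over the children of each node. -/
theorem le_of_le_on_level {Φ Ψ : List ℕ → ℝ≥0∞} {N : ℕ}
    (hΦ : ∀ s, Φ s = ∑' k, Φ (s ++ [k])) (hΨ : ∀ s, Ψ s = ∑' k, Ψ (s ++ [k]))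
    (h : ∀ s : List ℕ, s.length = N → Φ s ≤ Ψ s) (s : List ℕ) (hs : s.length ≤ N) : Φ s ≤ Ψ s := by
  obtain ⟨d, hd⟩ := Nat.exists_eq_add_of_le hs
  induction d generalizing s with
  | zero => exact h s hd.symm
  | succ d ih =>
    rw [hΦ, hΨ]
    refine ENNReal.tsum_le_tsum fun k => ih _ (by simp; omega) (by simp; omega)

/-- The union of the cells of the nodes that satisfy `B`. -/
def cells (B : List ℕ → Prop) : Set Cantor := ⋃ (s) (_ : B s), T.cell s

theorem isOpen_cells (B : List ℕ → Prop) : IsOpen (T.cells B) :=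
  isOpen_iUnion fun s => isOpen_iUnion fun _ => T.isOpen_cell s

theorem mem_cells {B : List ℕ → Prop} {ω : Cantor} : ω ∈ T.cells B ↔ ∃ s, B s ∧ ω ∈ T.cell s := by
  simp [cells]

/-- Restricting to nodes of bounded depth provides a level from which inductions over the tree can
start. -/
theorem coin_cells_le {B : List ℕ → Prop} {A : Set Cantor} {c : ℝ≥0∞}
    (h : ∀ N : ℕ, coin (T.cells (fun s => B s ∧ s.length ≤ N) ∩ A) ≤ c) :
    coin (T.cells B ∩ A) ≤ c := by
  have e : T.cells B ∩ A = ⋃ N : ℕ, T.cells (fun s => B s ∧ s.length ≤ N) ∩ A := by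
    ext ω
    simp only [mem_inter_iff, mem_iUnion, mem_cells]
    constructor
    · rintro ⟨⟨s, hs, h⟩, hA⟩
      exact ⟨s.length, ⟨s, ⟨hs, le_rfl⟩, h⟩, hA⟩
    · rintro ⟨N, ⟨s, ⟨hs, -⟩, h⟩, hA⟩
      exact ⟨⟨s, hs, h⟩, hA⟩
  have hm : Monotone fun N : ℕ => T.cells (fun s => B s ∧ s.length ≤ N) ∩ A := by
    intro M N hMN
    refine inter_subset_inter_left _ fun ω hω => ?_
    obtain ⟨s, ⟨hs, hM⟩, h⟩ := T.mem_cells.1 hω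
    exact T.mem_cells.2 ⟨s, ⟨hs, hM.trans hMN⟩, h⟩
  rw [e, hm.measure_iUnion]
  exact iSup_le h

/-- If the set `A` takes at most the fraction `ε` of each cell of a node with `B`, then it takes at
most the measure `ε` of all these cells. -/
theorem coin_cells_inter_le {B : List ℕ → Prop} {A : Set Cantor} (hA : MeasurableSet A) {ε : ℝ≥0∞}
    (h : ∀ s, B s → coin (T.cell s ∩ A) ≤ ε * T.mass s) : coin (T.cells B ∩ A) ≤ ε := by
  refine T.coin_cells_le fun N => ?_
  set W := T.cells (fun s => B s ∧ s.length ≤ N) with hW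
  have hWm : MeasurableSet (W ∩ A) := (T.isOpen_cells _).measurableSet.inter hA
  -- Induction on the distance `d` to level `N`, over nodes without a proper ancestor in `B`. The
  -- descent stops at the first node with `B`, so that nested cells are not counted twice. A node of
  -- level `N` reached without meeting `B` has a cell disjoint from `W`.
  have key : ∀ d (s : List ℕ), s.length + d = N → (∀ t, t <+: s → t ≠ s → ¬ B t) →
      coin (T.cell s ∩ (W ∩ A)) ≤ ε * T.mass s := by
    intro d
    induction d with
    | zero =>
      intro s hs hB
      by_cases hBs : B s
      · exact (measure_mono (by gcongr; exact inter_subset_right)).trans (h s hBs)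
      · have : T.cell s ∩ (W ∩ A) = ∅ := by
          refine Set.eq_empty_of_forall_notMem ?_
          rintro ω ⟨h1, h2, -⟩
          obtain ⟨t, ⟨hBt, htN⟩, ht⟩ := T.mem_cells.1 h2
          rcases T.comparable_of_mem h1 ht with h3 | h3
          · rw [h3.eq_of_length_le (by omega)] at hBs
            exact hBs hBt
          · by_cases hts : t = s
            · exact hBs (hts ▸ hBt)
            · exact hB t h3 hts hBt
        rw [this, measure_empty]
        exact zero_le
    | succ d ih =>
      intro s hs hB
      by_cases hBs : B s
      · exact (measure_mono (by gcongr; exact inter_subset_right)).trans (h s hBs)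
      · rw [T.coin_inter_cell s hWm, ← T.tsum_mass_snoc, ← ENNReal.tsum_mul_left]
        refine ENNReal.tsum_le_tsum fun k => ih _ (by simp; omega) fun t ht hne => ?_
        rcases List.prefix_concat_iff.1 ht with h1 | h1
        · exact (hne (by simpa using h1)).elim
        · by_cases hts : t = s
          · exact hts ▸ hBs
          · exact hB t h1 hts
  have := key N [] (by simp) fun t ht hne => (hne (List.prefix_nil.1 ht)).elim
  rwa [T.coin_inter_cell_nil, T.mass_nil, mul_one] at this

end IntervalTree

/-! ### Continuous families of trees -/

/-- A continuous family of trees of intervals over `X`; the nodes that are visible at a point `x`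
shrink to `x`. -/
structure TreeFamily (X : Type*) [TopologicalSpace X] where
  tree : X → IntervalTree
  continuous_lo : ∀ s, Continuous fun x => (tree x).lo s
  continuous_hi : ∀ s, Continuous fun x => (tree x).hi s
  small : ∀ (U : Opens X) (x : X), x ∈ U → ∃ N : ℕ, ∀ s : List ℕ, s.length = N →
    (tree x).lo s < (tree x).hi s → ∀ y, (tree y).lo s < (tree y).hi s → y ∈ U

namespace TreeFamily

variable {X : Type*} [TopologicalSpace X] (F : TreeFamily X)

/-- The points at which the node `s` is visible. -/
def support (s : List ℕ) : Set X := {x | (F.tree x).lo s < (F.tree x).hi s}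

theorem isOpen_support (s : List ℕ) : IsOpen (F.support s) :=
  isOpen_lt (F.continuous_lo s) (F.continuous_hi s)

theorem support_subset_of_prefix {s t : List ℕ} (h : s <+: t) : F.support t ⊆ F.support s :=
  fun x (hx : (F.tree x).lo t < (F.tree x).hi t) => by
    have := (F.tree x).le_of_prefix h
    exact (this.1.trans_lt hx).trans_le this.2

theorem mass_eq_zero {s : List ℕ} {x : X} (h : x ∉ F.support s) : (F.tree x).mass s = 0 := by
  have h' : ¬ (F.tree x).lo s < (F.tree x).hi s := h
  rw [IntervalTree.mass, ENNReal.ofReal_eq_zero]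
  linarith

/-! ### Averaging a tree family over a measure. -/

variable [MeasurableSpace X] [BorelSpace X] (μ : Measure X)

theorem measurable_mass (s : List ℕ) : Measurable fun x => (F.tree x).mass s :=
  ((F.continuous_hi s).sub (F.continuous_lo s)).measurable.ennreal_ofReal

theorem setLIntegral_mass_snoc (A : Set X) (s : List ℕ) :
    ∫⁻ x in A, (F.tree x).mass s ∂μ = ∑' k, ∫⁻ x in A, (F.tree x).mass (s ++ [k]) ∂μ := by
  rw [← lintegral_tsum fun k => (F.measurable_mass _).aemeasurable]
  simp only [IntervalTree.tsum_mass_snoc]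

variable [IsProbabilityMeasure μ]

theorem integrable_lo (s : List ℕ) : Integrable (fun x => (F.tree x).lo s) μ :=
  Integrable.of_bound (F.continuous_lo s).measurable.aestronglyMeasurable 1
    (Eventually.of_forall fun x => by
      rw [Real.norm_of_nonneg ((F.tree x).lo_nonneg s)]; exact (F.tree x).lo_le_one s)

theorem integrable_hi (s : List ℕ) : Integrable (fun x => (F.tree x).hi s) μ :=
  Integrable.of_bound (F.continuous_hi s).measurable.aestronglyMeasurable 1
    (Eventually.of_forall fun x => by
      rw [Real.norm_of_nonneg ((F.tree x).hi_nonneg s)]; exact (F.tree x).hi_le_one s)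

/-- The tree of the mean values. -/
noncomputable def mean : IntervalTree where
  lo s := ∫ x, (F.tree x).lo s ∂μ
  hi s := ∫ x, (F.tree x).hi s ∂μ
  lo_nil := by simp [IntervalTree.lo_nil]
  hi_nil := by simp [IntervalTree.hi_nil]
  lo_le_hi s := integral_mono (F.integrable_lo μ s) (F.integrable_hi μ s) fun x =>
    (F.tree x).lo_le_hi s
  lo_snoc_zero s := by simp only [IntervalTree.lo_snoc_zero]
  hi_snoc s k := by simp only [IntervalTree.hi_snoc]
  tendsto s := tendsto_integral_of_dominated_convergence (fun _ => 1)
    (fun k => (F.continuous_lo _).measurable.aestronglyMeasurable) (integrable_const _)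
    (fun k => Eventually.of_forall fun x => by
      rw [Real.norm_of_nonneg ((F.tree x).lo_nonneg _)]; exact (F.tree x).lo_le_one _)
    (Eventually.of_forall fun x => (F.tree x).tendsto s)

theorem mass_mean (s : List ℕ) : (F.mean μ).mass s = ∫⁻ x, (F.tree x).mass s ∂μ := by
  unfold IntervalTree.mass
  rw [← ofReal_integral_eq_lintegral_ofReal (f := fun x => (F.tree x).hi s - (F.tree x).lo s)
    ((F.integrable_hi μ s).sub (F.integrable_lo μ s))
    (Eventually.of_forall fun x => sub_nonneg.2 ((F.tree x).lo_le_hi s))]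
  congr 1
  exact (integral_sub (F.integrable_hi μ s) (F.integrable_lo μ s)).symm

theorem setLIntegral_mass_of_support_subset {U : Set X} {s : List ℕ} (h : F.support s ⊆ U) :
    ∫⁻ x in U, (F.tree x).mass s ∂μ = (F.mean μ).mass s := by
  rw [F.mass_mean]
  refine setLIntegral_eq_of_support_subset fun x hx => h ?_
  by_contra hx'
  exact hx (F.mass_eq_zero hx')

/-- The set of points of the Cantor space that are mapped into `U`. -/
def preimage (U : Set X) : Set Cantor := (F.mean μ).cells fun s => F.support s ⊆ U

theorem isOpen_preimage (U : Set X) : IsOpen (F.preimage μ U) := (F.mean μ).isOpen_cells _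

theorem preimage_mono {U V : Set X} (h : U ⊆ V) : F.preimage μ U ⊆ F.preimage μ V := by
  intro ω hω
  obtain ⟨s, hs, hω⟩ := (F.mean μ).mem_cells.1 hω
  exact (F.mean μ).mem_cells.2 ⟨s, hs.trans h, hω⟩

/-- The equality is exact: two nodes whose cells share a point are comparable, and the support of
the deeper one lies in both sets. -/
theorem preimage_inter (U V : Set X) :
    F.preimage μ (U ∩ V) = F.preimage μ U ∩ F.preimage μ V := by
  refine Subset.antisymm (subset_inter (F.preimage_mono μ inter_subset_left)
    (F.preimage_mono μ inter_subset_right)) ?_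
  rintro ω ⟨hU, hV⟩
  obtain ⟨s, hs, hsω⟩ := (F.mean μ).mem_cells.1 hU
  obtain ⟨t, ht, htω⟩ := (F.mean μ).mem_cells.1 hV
  rcases (F.mean μ).comparable_of_mem hsω htω with h | h
  · exact (F.mean μ).mem_cells.2
      ⟨t, subset_inter ((F.support_subset_of_prefix h).trans hs) ht, htω⟩
  · exact (F.mean μ).mem_cells.2
      ⟨s, subset_inter hs ((F.support_subset_of_prefix h).trans ht), hsω⟩

/-- A node with empty support has mean mass zero, and its cell is then empty. -/
theorem preimage_empty : F.preimage μ ∅ = ∅ := by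
  refine Set.eq_empty_of_forall_notMem fun ω hω => ?_
  obtain ⟨s, hs, hsω⟩ := (F.mean μ).mem_cells.1 hω
  refine (F.mean μ).mass_ne_zero_of_mem hsω ?_
  rw [← F.setLIntegral_mass_of_support_subset μ hs]
  simp

/-- Both sides are additive over children, so a single level `M` below the nodes considered
suffices. A cell of that level meeting `W` lies below a node with support in `U`, and then the
integral over `U` is its full mass. -/
theorem coin_cell_inter_preimage_le (U : Set X) (s : List ℕ) :
    coin ((F.mean μ).cell s ∩ F.preimage μ U) ≤ ∫⁻ x in U, (F.tree x).mass s ∂μ := by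
  rw [inter_comm]
  refine (F.mean μ).coin_cells_le fun N => ?_
  set W := (F.mean μ).cells (fun s => F.support s ⊆ U ∧ s.length ≤ max N s.length) with hW
  set M := max N s.length
  set W := (F.mean μ).cells (fun s => F.support s ⊆ U ∧ s.length ≤ M) with hW
  have hWm : MeasurableSet W := ((F.mean μ).isOpen_cells _).measurableSet
  have key := IntervalTree.le_of_le_on_level (N := M)
    (Φ := fun s => coin ((F.mean μ).cell s ∩ W))
    (Ψ := fun s => ∫⁻ x in U, (F.tree x).mass s ∂μ)
    (fun s => (F.mean μ).coin_inter_cell s hWm) (F.setLIntegral_mass_snoc μ U) (fun s hs => ?_) s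
    (le_max_right _ _)
  · refine le_trans (measure_mono ?_) key
    rw [inter_comm]
    refine inter_subset_inter_right _ fun ω hω => ?_
    obtain ⟨t, ⟨ht, htN⟩, h⟩ := (F.mean μ).mem_cells.1 hω
    exact (F.mean μ).mem_cells.2 ⟨t, ⟨ht, htN.trans (le_max_left _ _)⟩, h⟩
  · by_cases h : ((F.mean μ).cell s ∩ W).Nonempty
    · obtain ⟨ω, h1, h2⟩ := h
      obtain ⟨t, ⟨ht, htM⟩, h3⟩ := (F.mean μ).mem_cells.1 h2
      have hts : t <+: s := by
        rcases (F.mean μ).comparable_of_mem h1 h3 with h | h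
        · rw [h.eq_of_length_le (by omega)]
        · exact h
      rw [F.setLIntegral_mass_of_support_subset μ ((F.support_subset_of_prefix hts).trans ht),
        ← (F.mean μ).coin_cell]
      exact measure_mono inter_subset_left
    · rw [Set.not_nonempty_iff_eq_empty.1 h, measure_empty]
      exact zero_le

/-- This is where the shrinking of supports enters. Let `V N` be the points of `U` whose visible
nodes of depth `N` all have support in `U`; by `small` these sets increase to `U`. A node of depth
`N` either has support in `U`, and its whole cell is in the preimage, or has mass zero at every
point of `V N`. -/
theorem le_coin_cell_inter_preimage (U : Opens X) (s : List ℕ) :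
    ∫⁻ x in U, (F.tree x).mass s ∂μ ≤ coin ((F.mean μ).cell s ∩ F.preimage μ U) := by
  let V : ℕ → Set X := fun N =>
    U \ ⋃ (t : List ℕ) (_ : t.length = N ∧ ¬ F.support t ⊆ U), F.support t
  have hVm : ∀ N, MeasurableSet (V N) := fun N => MeasurableSet.diff U.isOpen.measurableSet
    (MeasurableSet.iUnion fun t => MeasurableSet.iUnion fun _ =>
      (F.isOpen_support t).measurableSet)
  have hV : ∀ {N x}, x ∈ V N ↔ x ∈ U ∧ ∀ t : List ℕ, t.length = N → x ∈ F.support t →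
      F.support t ⊆ U := by
    intro N x
    simp only [V, Set.mem_sdiff, mem_iUnion, not_exists, SetLike.mem_coe]
    refine and_congr_right fun _ => forall_congr' fun t => ?_
    tauto
  have hmono : Monotone V := by
    refine monotone_nat_of_le_succ fun N x hx => ?_
    rw [hV] at hx ⊢
    refine ⟨hx.1, fun t ht hxt => ?_⟩
    have hp := List.take_prefix N t
    exact (F.support_subset_of_prefix hp).trans
      (hx.2 (t.take N) (by simp; omega) (F.support_subset_of_prefix hp hxt))
  have hU : (U : Set X) = ⋃ N, V N := by
    ext x
    rw [mem_iUnion]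
    refine ⟨fun hx => ?_, fun ⟨N, hN⟩ => (hV.1 hN).1⟩
    obtain ⟨N, hN⟩ := F.small U x hx
    exact ⟨N, hV.2 ⟨hx, fun t ht hxt y hy => hN t ht hxt y hy⟩⟩
  have key : ∀ N, s.length ≤ N → ∫⁻ x in V N, (F.tree x).mass s ∂μ ≤
      coin ((F.mean μ).cell s ∩ F.preimage μ U) := by
    intro N hN
    refine IntervalTree.le_of_le_on_level (N := N)
      (Φ := fun s => ∫⁻ x in V N, (F.tree x).mass s ∂μ)
      (Ψ := fun s => coin ((F.mean μ).cell s ∩ F.preimage μ U))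
      (F.setLIntegral_mass_snoc μ _)
      (fun s => (F.mean μ).coin_inter_cell s (F.isOpen_preimage μ _).measurableSet)
      (fun t ht => ?_) s hN
    by_cases hB : F.support t ⊆ U
    · have h1 : (F.mean μ).cell t ∩ F.preimage μ U = (F.mean μ).cell t :=
        inter_eq_left.2 fun ω hω => (F.mean μ).mem_cells.2 ⟨t, hB, hω⟩
      rw [h1, (F.mean μ).coin_cell, F.mass_mean]
      exact setLIntegral_le_lintegral _ _
    · have h1 : ∫⁻ x in V N, (F.tree x).mass t ∂μ = 0 := by
        rw [setLIntegral_congr_fun (g := fun _ => 0) (hVm N) fun x hx =>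
          F.mass_eq_zero fun hxt => hB ((hV.1 hx).2 t ht hxt)]
        simp
      rw [h1]
      exact zero_le
  rw [hU, setLIntegral_iUnion_of_directed _ hmono.directed_le]
  refine iSup_le fun N => ?_
  refine (lintegral_mono_set (hmono (le_max_left N s.length))).trans ?_
  rw [← hU]
  exact key _ (le_max_right _ _)

theorem coin_cell_inter_preimage (U : Opens X) (s : List ℕ) :
    coin ((F.mean μ).cell s ∩ F.preimage μ U) = ∫⁻ x in U, (F.tree x).mass s ∂μ :=
  (F.coin_cell_inter_preimage_le μ U s).antisymm (F.le_coin_cell_inter_preimage μ U s)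

theorem coin_preimage (U : Opens X) : coin (F.preimage μ U) = μ U := by
  rw [← (F.mean μ).coin_inter_cell_nil, F.coin_cell_inter_preimage]
  simp [IntervalTree.mass_nil]

/-- One inclusion is clear, and the measures agree by modularity of both measures and
`preimage_inter`, so the difference is null. -/
theorem preimage_union_ae_eq (U V : Opens X) : F.preimage μ ((U ⊔ V : Opens X) : Set X) =ᵐ[coin]
    (F.preimage μ U ∪ F.preimage μ V : Set Cantor) := by
  have h : F.preimage μ U ∪ F.preimage μ V ⊆ F.preimage μ ((U ⊔ V : Opens X) : Set X) :=
    union_subset (F.preimage_mono μ (le_sup_left (a := U)))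
      (F.preimage_mono μ (le_sup_right (a := U)))
  refine (ae_eq_of_subset_of_measure_ge h ?_
    ((F.isOpen_preimage μ _).union (F.isOpen_preimage μ _)).measurableSet.nullMeasurableSet
    (measure_ne_top _ _)).symm
  rw [F.coin_preimage]
  have h1 := measure_union_add_inter (μ := coin) (F.preimage μ U)
    (F.isOpen_preimage μ V).measurableSet
  have h2 := measure_union_add_inter (μ := μ) (U : Set X) V.isOpen.measurableSet
  rw [← F.preimage_inter, F.coin_preimage, F.coin_preimage, ← Opens.coe_inf, F.coin_preimage,
    ← h2, Opens.coe_inf] at h1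
  exact ((ENNReal.add_left_inj (measure_ne_top _ _)).1 h1).ge

/-- The random variable with the distribution `μ`. -/
noncomputable def randomVariable : RandomVariable X where
  preimage U := LowerMeasurableSet.ofOpen ⟨F.preimage μ U, F.isOpen_preimage μ U⟩
  preimage_empty := by
    congr 1
    ext1
    exact F.preimage_empty μ
  preimage_univ := Quotient.sound <| (LowerCauchySeq.equiv_iff _ _).2 <| by
    rw [LowerCauchySeq.inter_const, LowerCauchySeq.inter_const]
    refine ae_eq_of_subset_of_measure_ge (subset_univ _) ?_
      (F.isOpen_preimage μ _).measurableSet.nullMeasurableSet (measure_ne_top _ _)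
    change coin univ ≤ coin (F.preimage μ ((⊤ : Opens X) : Set X))
    rw [F.coin_preimage]
    simp
  preimage_inf U V := by
    rw [← LowerMeasurableSet.inf_ofOpen]
    congr 1
    ext1
    exact F.preimage_inter μ U V
  preimage_sup U V := by
    rw [← LowerMeasurableSet.sup_ofOpen]
    refine Quotient.sound <| (LowerCauchySeq.equiv_iff _ _).2 <| ?_
    rw [LowerCauchySeq.inter_const, LowerCauchySeq.inter_const]
    exact F.preimage_union_ae_eq μ U V
  continuous V hV := by
    simp only [LowerMeasurableSet.measure_ofOpen]
    change coin (F.preimage μ ((⨆ n, V n : Opens X) : Set X)) = ⨆ n, coin (F.preimage μ (V n))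
    simp only [F.coin_preimage]
    rw [Opens.coe_iSup, Monotone.measure_iUnion fun _ _ h => hV h]

theorem prob_randomVariable (U : Opens X) : (F.randomVariable μ).prob U = μ U := by
  rw [← F.coin_preimage]
  exact LowerMeasurableSet.measure_ofOpen _

/-! ### Approximation of preimages from outside -/

/-- The union of the cells that are mapped into `U` up to the fraction `2⁻ⁿ`. -/
def outer (U : Opens X) (n : ℕ) : Set Cantor := (F.mean μ).cells fun s =>
  (1 - (2 : ℝ≥0∞)⁻¹ ^ n) * (F.mean μ).mass s < ∫⁻ x in U, (F.tree x).mass s ∂μ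

theorem preimage_subset_outer (U : Opens X) (n : ℕ) : F.preimage μ U ⊆ F.outer μ U n := by
  intro ω hω
  obtain ⟨s, hs, hω⟩ := (F.mean μ).mem_cells.1 hω
  refine (F.mean μ).mem_cells.2 ⟨s, ?_, hω⟩
  have h0 := (F.mean μ).mass_ne_zero_of_mem hω
  rw [F.setLIntegral_mass_of_support_subset μ hs]
  refine (ENNReal.mul_lt_mul_left h0 ((F.mean μ).mass_ne_top s)
    (ENNReal.sub_lt_self ENNReal.one_ne_top one_ne_zero (by simp))).trans_eq (one_mul _)

theorem outer_anti (U : Opens X) : Antitone (F.outer μ U) := by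
  intro m n hmn ω hω
  obtain ⟨s, hs, hω⟩ := (F.mean μ).mem_cells.1 hω
  refine (F.mean μ).mem_cells.2 ⟨s, lt_of_le_of_lt ?_ hs, hω⟩
  gcongr ?_ * _
  exact tsub_le_tsub_left (pow_le_pow_of_le_one zero_le (by simp) hmn) _

/-- By the exact formula for the preimage in a cell, its complement takes at most the fraction `2⁻ⁿ`
of each selected cell, and `coin_cells_inter_le` adds this up over overlapping cells. -/
theorem coin_outer_diff (U : Opens X) (n : ℕ) :
    coin (F.outer μ U n \ F.preimage μ U) ≤ (2 : ℝ≥0∞)⁻¹ ^ n := by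
  rw [Set.sdiff_eq]
  refine (F.mean μ).coin_cells_inter_le (F.isOpen_preimage μ _).measurableSet.compl fun s hs => ?_
  have h1 := measure_inter_add_sdiff (μ := coin) ((F.mean μ).cell s)
    (F.isOpen_preimage μ U).measurableSet
  rw [F.coin_cell_inter_preimage, (F.mean μ).coin_cell] at h1
  rw [← Set.sdiff_eq]
  have h2 : (2 : ℝ≥0∞)⁻¹ ^ n ≤ 1 := pow_le_one₀ zero_le (by simp)
  have h3 : (F.mean μ).mass s = (1 - (2 : ℝ≥0∞)⁻¹ ^ n) * (F.mean μ).mass s +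
      (2 : ℝ≥0∞)⁻¹ ^ n * (F.mean μ).mass s := by
    rw [← add_mul, tsub_add_cancel_of_le h2, one_mul]
  rw [h3] at h1
  by_contra! hlt
  exact (ENNReal.add_lt_add hs hlt).ne' h1

/-- The approximations from outside as a fast monotone lower-Cauchy sequence. -/
noncomputable def outerSeq (U : Opens X) : LowerCauchySeq where
  sets n := ⟨F.outer μ U n, (F.mean μ).isOpen_cells _⟩
  anti _ _ h := F.outer_anti μ U h
  fast n m h := by
    change coin (F.outer μ U n) ≤ coin (F.outer μ U m) + _
    calc coin (F.outer μ U n) ≤ coin (F.preimage μ U) + coin (F.outer μ U n \ F.preimage μ U) := by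
          refine (measure_le_inter_add_sdiff coin _ (F.preimage μ U)).trans ?_
          gcongr
          exact inter_subset_right
      _ ≤ coin (F.outer μ U m) + _ := add_le_add (measure_mono (F.preimage_subset_outer μ U m))
          (F.coin_outer_diff μ U n)

/-- The outer sets contain the preimage with an excess tending to zero, so their intersection equals
it almost everywhere. -/
theorem mk_outerSeq (U : Opens X) :
    (Quotient.mk _ (F.outerSeq μ U) : LowerMeasurableSet) = (F.randomVariable μ).preimage U := by
  refine Quotient.sound <| (LowerCauchySeq.equiv_iff _ _).2 <| ?_
  rw [LowerCauchySeq.inter_const]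
  have h : F.preimage μ U ⊆ (F.outerSeq μ U).inter :=
    subset_iInter fun n => F.preimage_subset_outer μ U n
  refine (h.eventuallyLE.antisymm ?_).symm
  rw [ae_le_set]
  refine le_antisymm ?_ zero_le
  refine ge_of_tendsto' (ENNReal.tendsto_pow_atTop_nhds_zero_of_lt_one
    (r := (2 : ℝ≥0∞)⁻¹) (by simp)) fun n => ?_
  exact (measure_mono (sdiff_subset_sdiff_left (iInter_subset _ n))).trans
    (F.coin_outer_diff μ U n)

end TreeFamily

/-! ### The tree family of a dense sequence -/

section Bumps

variable {X : Type*} [MetricSpace X] (ξ : ℕ → X)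

/-- A bump function at `ξ k` of radius `2⁻ʲ`. -/
noncomputable def bump (j k : ℕ) (x : X) : ℝ := max 0 (min 1 (2 - 2 ^ (j + 1) * dist x (ξ k)))

/-- The maximum of the first `k` bumps of radius `2⁻ʲ`. -/
noncomputable def bumpMax (j : ℕ) : ℕ → X → ℝ
  | 0, _ => 0
  | k + 1, x => max (bumpMax j k x) (bump ξ j k x)

/-- The endpoint of the interval of the node `s` of the tree at `x`: the lower one for `e = 0`, the
upper one for `e = 1`. The first entry of the node refers to bumps of radius `2⁻ʲ`. -/
noncomputable def endpoint (e : ℝ) : List ℕ → ℕ → X → ℝ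
  | [], _, _ => e
  | k :: s, j, x => max (bumpMax ξ j k x) (min (bumpMax ξ j (k + 1) x) (endpoint e s (j + 1) x))

theorem bump_le_one (j k : ℕ) (x : X) : bump ξ j k x ≤ 1 :=
  max_le zero_le_one (min_le_left _ _)

theorem bumpMax_mono (j : ℕ) (x : X) : Monotone fun k => bumpMax ξ j k x :=
  monotone_nat_of_le_succ fun _ => le_max_left _ _

theorem bumpMax_nonneg (j k : ℕ) (x : X) : 0 ≤ bumpMax ξ j k x :=
  bumpMax_mono ξ j x (Nat.zero_le k)

theorem bumpMax_le_one (j k : ℕ) (x : X) : bumpMax ξ j k x ≤ 1 := by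
  induction k with
  | zero => exact zero_le_one
  | succ k ih => exact max_le ih (bump_le_one ξ j k x)

theorem dist_lt_of_bumpMax_lt {j k : ℕ} {x : X} (h : bumpMax ξ j k x < bumpMax ξ j (k + 1) x) :
    dist x (ξ k) < 2⁻¹ ^ j := by
  have h1 : 0 < bump ξ j k x := by
    by_contra! h0
    have := bumpMax_nonneg ξ j k x
    rw [bumpMax, max_eq_left (h0.trans this)] at h
    exact h.false
  have h2 : 0 < 2 - 2 ^ (j + 1) * dist x (ξ k) := by
    by_contra! h0
    rw [bump, max_eq_left ((min_le_right _ _).trans h0)] at h1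
    exact h1.false
  have h3 : (2 : ℝ)⁻¹ ^ j = 2 / 2 ^ (j + 1) := by
    rw [pow_succ, inv_pow]; field_simp
  rw [h3, lt_div_iff₀' (by positivity)]
  linarith

/-- A bump equals 1 within `2⁻ʲ⁻¹` of its centre, and density puts some centre that close. Hence the
subdivision at each point is exhausted after finitely many steps. -/
theorem exists_bumpMax_eq_one (hξ : DenseRange ξ) (j : ℕ) (x : X) :
    ∃ K, ∀ k, K ≤ k → bumpMax ξ j k x = 1 := by
  obtain ⟨k, hk⟩ := Metric.denseRange_iff.1 hξ x ((2 ^ (j + 1))⁻¹) (by positivity)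
  refine ⟨k + 1, fun l hl => le_antisymm (bumpMax_le_one ξ j l x) ?_⟩
  refine le_trans ?_ (bumpMax_mono ξ j x hl)
  refine le_trans ?_ (le_max_right _ _)
  refine le_max_of_le_right (le_min le_rfl ?_)
  have h2 : (0 : ℝ) < 2 ^ (j + 1) := by positivity
  have := mul_le_mul_of_nonneg_left hk.le h2.le
  rw [mul_inv_cancel₀ h2.ne'] at this
  linarith

theorem continuous_bumpMax (j k : ℕ) : Continuous (bumpMax ξ j k) := by
  induction k with
  | zero => exact continuous_const
  | succ k ih =>
    refine ih.max ?_
    unfold bump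
    fun_prop

theorem continuous_endpoint (e : ℝ) (s : List ℕ) (j : ℕ) : Continuous (endpoint ξ e s j) := by
  induction s generalizing j with
  | nil => exact continuous_const
  | cons k s ih =>
    exact (continuous_bumpMax ξ j k).max ((continuous_bumpMax ξ j (k + 1)).min (ih _))

theorem endpoint_mono {e e' : ℝ} (h : e ≤ e') (s : List ℕ) (j : ℕ) (x : X) :
    endpoint ξ e s j x ≤ endpoint ξ e' s j x := by
  induction s generalizing j with
  | nil => exact h
  | cons k s ih => exact max_le_max le_rfl (min_le_min le_rfl (ih _))

/-- The definition peels off the first entry, whereas the axioms of a tree concern the last one.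
Appending an entry only changes the innermost value being clamped. -/
theorem endpoint_snoc (e : ℝ) (s : List ℕ) (k j : ℕ) (x : X) :
    endpoint ξ e (s ++ [k]) j x = endpoint ξ (max (bumpMax ξ (j + s.length) k x)
      (min (bumpMax ξ (j + s.length) (k + 1) x) e)) s j x := by
  induction s generalizing j with
  | nil => rfl
  | cons l s ih =>
    simp only [List.cons_append, endpoint, ih, List.length_cons]
    rw [show j + 1 + s.length = j + (s.length + 1) by omega]

/-- If clamping leaves the two ends apart, then the clamping interval at every level is
nondegenerate, so the bump with that index is positive at `x`. -/
theorem dist_lt_of_endpoint_lt {s : List ℕ} {j : ℕ} {x : X}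
    (h : endpoint ξ 0 s j x < endpoint ξ 1 s j x) {i : ℕ} (hi : i < s.length) :
    dist x (ξ (s.getD i 0)) < 2⁻¹ ^ (j + i) := by
  induction s generalizing j i with
  | nil => simp at hi
  | cons k s ih =>
    rw [endpoint, endpoint] at h
    cases i with
    | zero =>
      rw [add_zero]
      refine dist_lt_of_bumpMax_lt ξ ?_
      by_contra! hle
      rw [List.getD_cons_zero] at hle
      rw [max_eq_left ((min_le_left _ _).trans hle), max_eq_left ((min_le_left _ _).trans hle)] at h
      exact h.false
    | succ i =>
      have := ih (j := j + 1) (i := i) (by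
        by_contra! hle
        exact (max_le_max le_rfl (min_le_min le_rfl hle)).not_gt h) (by simpa using hi)
      rw [show j + (i + 1) = j + 1 + i by omega]
      simpa using this

/-- The tree at a point. -/
noncomputable def pointTree (hξ : DenseRange ξ) (x : X) : IntervalTree where
  lo s := endpoint ξ 0 s 0 x
  hi s := endpoint ξ 1 s 0 x
  lo_nil := rfl
  hi_nil := rfl
  lo_le_hi s := endpoint_mono ξ zero_le_one s 0 x
  lo_snoc_zero s := by
    rw [endpoint_snoc, min_eq_right (bumpMax_nonneg _ _ _ _)]
    simp [bumpMax]
  hi_snoc s k := by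
    rw [endpoint_snoc, endpoint_snoc, min_eq_left (bumpMax_le_one _ _ _ _),
      max_eq_right (bumpMax_mono _ _ _ (Nat.le_succ k)), min_eq_right (bumpMax_nonneg _ _ _ _),
      max_eq_left (bumpMax_nonneg _ _ _ _)]
  tendsto s := by
    obtain ⟨K, hK⟩ := exists_bumpMax_eq_one ξ hξ (0 + s.length) x
    refine tendsto_const_nhds.congr' (eventually_atTop.2 ⟨K, fun k hk => ?_⟩)
    simp only [endpoint_snoc, hK k hk, hK (k + 1) (by omega)]
    simp

/-- The tree family of a dense sequence. -/
noncomputable def denseTree (hξ : DenseRange ξ) : TreeFamily X where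
  tree := pointTree ξ hξ
  continuous_lo s := continuous_endpoint ξ 0 s 0
  continuous_hi s := continuous_endpoint ξ 1 s 0
  small U x hx := by
    obtain ⟨ε, hε, hU⟩ := Metric.isOpen_iff.1 U.isOpen x hx
    obtain ⟨M, hM⟩ := exists_pow_lt_of_lt_one (half_pos hε) (show (2 : ℝ)⁻¹ < 1 by norm_num)
    -- Depth `M + 1` makes entry `M` available; it puts both `x` and `y` within `2⁻ᴹ < ε / 2` of the
    -- same dense point.
    refine ⟨M + 1, fun s hs hxs y hys => hU ?_⟩
    have h1 := dist_lt_of_endpoint_lt ξ hxs (i := M) (by omega)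
    have h2 := dist_lt_of_endpoint_lt ξ hys (i := M) (by omega)
    rw [zero_add] at h1 h2
    rw [Metric.mem_ball]
    have := dist_triangle_right y x (ξ (s.getD M 0))
    linarith

theorem denseTree_dist_lt (hξ : DenseRange ξ) {s : List ℕ} {x : X}
    (h : x ∈ (denseTree ξ hξ).support s) {i : ℕ} (hi : i < s.length) :
    dist x (ξ (s.getD i 0)) < 2⁻¹ ^ i := by
  simpa using dist_lt_of_endpoint_lt ξ h hi

/-! ### Thresholds -/

theorem lt_bumpMax_iff {c : ℝ} (hc : 0 ≤ c) (j k : ℕ) (x : X) :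
    c < bumpMax ξ j k x ↔ ∃ i < k, c < bump ξ j i x := by
  induction k with
  | zero => simp [bumpMax, hc]
  | succ k ih => rw [bumpMax, lt_max_iff, ih, Nat.exists_lt_succ_right]

theorem bumpMax_lt_iff {c : ℝ} (hc : 0 < c) (j k : ℕ) (x : X) :
    bumpMax ξ j k x < c ↔ ∀ i < k, bump ξ j i x < c := by
  induction k with
  | zero => simp [bumpMax, hc]
  | succ k ih => rw [bumpMax, max_lt_iff, ih, Nat.forall_lt_succ_right]

/-- Unfolding the nested `max` and `min` leaves a finite boolean combination of strict bounds on
bump maxima. The first case stops at the level `i` whose lower clamp already exceeds `c`; the second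
reaches the innermost value `e`. -/
theorem lt_endpoint_iff (c e : ℝ) (s : List ℕ) (j : ℕ) (x : X) :
    c < endpoint ξ e s j x ↔
      (∃ i < s.length, c < bumpMax ξ (j + i) (s.getD i 0) x ∧
        ∀ l < i, c < bumpMax ξ (j + l) (s.getD l 0 + 1) x) ∨
      (c < e ∧ ∀ i < s.length, c < bumpMax ξ (j + i) (s.getD i 0 + 1) x) := by
  induction s generalizing j with
  | nil => simp [endpoint]
  | cons k s ih =>
    rw [endpoint, lt_max_iff, lt_min_iff, ih, List.length_cons, Nat.exists_lt_succ_left,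
      Nat.forall_lt_succ_left]
    simp only [Nat.forall_lt_succ_left, add_zero, List.getD_cons_zero, List.getD_cons_succ,
      ← add_assoc, add_right_comm j _ 1]
    simp only [Nat.not_lt_zero, false_imp_iff, implies_true, and_true]
    constructor
    · rintro (h | ⟨h, ⟨i, hi, h1, h2⟩ | ⟨h1, h2⟩⟩)
      · exact Or.inl (Or.inl h)
      · exact Or.inl (Or.inr ⟨i, hi, h1, h, h2⟩)
      · exact Or.inr ⟨h1, h, h2⟩
    · rintro ((h | ⟨i, hi, h1, h, h2⟩) | ⟨h1, h, h2⟩)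
      · exact Or.inl h
      · exact Or.inr ⟨h, Or.inl ⟨i, hi, h1, h2⟩⟩
      · exact Or.inr ⟨h, Or.inr ⟨h1, h2⟩⟩

theorem endpoint_lt_iff (c e : ℝ) (s : List ℕ) (j : ℕ) (x : X) :
    endpoint ξ e s j x < c ↔
      (∃ i < s.length, bumpMax ξ (j + i) (s.getD i 0 + 1) x < c ∧
        ∀ l < i, bumpMax ξ (j + l) (s.getD l 0) x < c) ∨
      (e < c ∧ ∀ i < s.length, bumpMax ξ (j + i) (s.getD i 0) x < c) := by
  induction s generalizing j with
  | nil => simp [endpoint]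
  | cons k s ih =>
    rw [endpoint, max_lt_iff, min_lt_iff, ih, List.length_cons, Nat.exists_lt_succ_left,
      Nat.forall_lt_succ_left]
    simp only [Nat.forall_lt_succ_left, add_zero, List.getD_cons_zero, List.getD_cons_succ,
      ← add_assoc, add_right_comm j _ 1]
    simp only [Nat.not_lt_zero, false_imp_iff, implies_true, and_true]
    have hm : bumpMax ξ j (k + 1) x < c → bumpMax ξ j k x < c :=
      (bumpMax_mono ξ j x (Nat.le_succ k)).trans_lt
    constructor
    · rintro ⟨h, h' | ⟨i, hi, h1, h2⟩ | ⟨h1, h2⟩⟩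
      · exact Or.inl (Or.inl h')
      · exact Or.inl (Or.inr ⟨i, hi, h1, h, h2⟩)
      · exact Or.inr ⟨h1, h, h2⟩
    · rintro ((h | ⟨i, hi, h1, h, h2⟩) | ⟨h1, h, h2⟩)
      · exact ⟨hm h, Or.inl h⟩
      · exact ⟨h, Or.inr (Or.inl ⟨i, hi, h1, h2⟩)⟩
      · exact ⟨h, Or.inr (Or.inr ⟨h1, h2⟩)⟩

/-- A dyadic threshold for a bump becomes a dyadic threshold for the distance. The condition `A < 2
^ N` comes from the cap at 1 and makes the truncated subtraction exact. -/
theorem div_two_pow_lt_bump_iff (A N j k : ℕ) (x : X) : (A : ℝ) / 2 ^ N < bump ξ j k x ↔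
    A < 2 ^ N ∧ dist x (ξ k) < ((2 * 2 ^ N - A : ℕ) : ℝ) / 2 ^ (j + 1 + N) := by
  have h2 : (0 : ℝ) < 2 ^ N := by positivity
  have h3 : (0 : ℝ) < 2 ^ (j + 1) := by positivity
  have hA : ¬ (A : ℝ) / 2 ^ N < 0 := not_lt.2 (by positivity)
  rw [bump, lt_max_iff, or_iff_right hA, lt_min_iff, div_lt_one h2,
    show ((A : ℝ) < 2 ^ N) ↔ A < 2 ^ N by norm_cast]
  refine and_congr_right fun h => ?_
  rw [Nat.cast_sub (by omega), pow_add 2 (j + 1) N, lt_div_iff₀ (by positivity), lt_sub_comm,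
    ← mul_lt_mul_iff_left₀ h2, sub_mul, div_mul_cancel₀ _ h2.ne']
  push_cast
  rw [show dist x (ξ k) * (2 ^ (j + 1) * 2 ^ N) = 2 ^ (j + 1) * dist x (ξ k) * 2 ^ N by ring]

/-- Positivity of `A` disposes of the outer maximum with 0, and above `2 ^ N` the cap at 1 decides.
-/
theorem bump_lt_div_two_pow_iff {A : ℕ} (hA : 0 < A) (N j k : ℕ) (x : X) :
    bump ξ j k x < (A : ℝ) / 2 ^ N ↔
      2 ^ N < A ∨ A ≤ 2 ^ N ∧ ((2 * 2 ^ N - A : ℕ) : ℝ) / 2 ^ (j + 1 + N) < dist x (ξ k) := by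
  have h2 : (0 : ℝ) < 2 ^ N := by positivity
  have h0 : (0 : ℝ) < (A : ℝ) / 2 ^ N := div_pos (by exact_mod_cast hA) h2
  rw [bump, max_lt_iff, and_iff_right h0, min_lt_iff, one_lt_div h2,
    show ((2 : ℝ) ^ N < A) ↔ 2 ^ N < A by norm_cast]
  by_cases h : 2 ^ N < A
  · simp [h]
  · simp only [h, false_or, not_lt.1 h, true_and]
    rw [Nat.cast_sub (by omega), pow_add 2 (j + 1) N, div_lt_iff₀ (by positivity), sub_lt_comm,
      ← mul_lt_mul_iff_left₀ h2, sub_mul, div_mul_cancel₀ _ h2.ne']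
    push_cast
    rw [show dist x (ξ k) * (2 ^ (j + 1) * 2 ^ N) = 2 ^ (j + 1) * dist x (ξ k) * 2 ^ N by ring]

end Bumps

/-! ### Integrals from below -/

section LowerIntegral

variable {X : Type*}

/-- The points of `U` at which the grid cell `k` of mesh `2⁻ᴺ` is strictly inside the interval from
`α` to `β`. -/
def gridSet (U : Set X) (α β : X → ℝ) (N k : ℕ) : Set X :=
  U ∩ {x | α x < (k : ℝ) / 2 ^ N ∧ ((k + 1 : ℕ) : ℝ) / 2 ^ N < β x}

theorem isOpen_gridSet [TopologicalSpace X] {U : Set X} (hU : IsOpen U) {α β : X → ℝ}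
    (hα : Continuous α) (hβ : Continuous β) (N k : ℕ) : IsOpen (gridSet U α β N k) :=
  hU.inter ((isOpen_lt hα continuous_const).inter (isOpen_lt continuous_const hβ))

theorem mem_gridCells_iff {N k : ℕ} (hk : k < 2 ^ N) (a b : ℝ) : k ∈ gridCells (2 ^ N) a b ↔
    a < (k : ℝ) / 2 ^ N ∧ ((k + 1 : ℕ) : ℝ) / 2 ^ N < b := by
  have h2 : (0 : ℝ) < 2 ^ N := by positivity
  simp only [gridCells, Finset.mem_filter, Finset.mem_range, hk, true_and]
  rw [lt_div_iff₀ h2, div_lt_iff₀ h2]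
  push_cast
  rfl

variable [TopologicalSpace X] [MeasurableSpace X] [BorelSpace X] (μ : Measure X)
  [IsProbabilityMeasure μ]

-- Double counting of the pairs of a point of `U` and a grid cell inside its interval.
open Classical in
theorem sum_measureReal_gridSet {U : Set X} (hU : IsOpen U) {α β : X → ℝ} (hα : Continuous α)
    (hβ : Continuous β) (N : ℕ) :
    ∑ k ∈ Finset.range (2 ^ N), μ.real (gridSet U α β N k) =
      ∫ x in U, ((gridCells (2 ^ N) (α x) (β x)).card : ℝ) ∂μ := by
  have h : ∀ x ∈ U, ((gridCells (2 ^ N) (α x) (β x)).card : ℝ) =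
      ∑ k ∈ Finset.range (2 ^ N), (gridSet U α β N k).indicator (fun _ => (1 : ℝ)) x := by
    intro x hx
    have h1 : gridCells (2 ^ N) (α x) (β x) =
        (Finset.range (2 ^ N)).filter fun k => x ∈ gridSet U α β N k := by
      ext k
      rw [Finset.mem_filter, Finset.mem_range]
      constructor
      · intro hk
        have hk2 : k < 2 ^ N := Finset.mem_range.1 (Finset.mem_filter.1 hk).1
        exact ⟨hk2, hx, (mem_gridCells_iff hk2 _ _).1 hk⟩
      · rintro ⟨hk2, -, hk⟩
        exact (mem_gridCells_iff hk2 _ _).2 hk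
    rw [h1, Finset.card_filter]
    push_cast
    refine Finset.sum_congr rfl fun k _ => ?_
    by_cases hk : x ∈ gridSet U α β N k <;> simp [hk]
  have hm : ∀ k, MeasurableSet (gridSet U α β N k) := fun k =>
    (isOpen_gridSet hU hα hβ N k).measurableSet
  rw [setIntegral_congr_fun hU.measurableSet h, integral_finsetSum]
  · refine Finset.sum_congr rfl fun k _ => ?_
    rw [integral_indicator (hm k), Measure.restrict_restrict (hm k),
      inter_eq_left.2 (show gridSet U α β N k ⊆ U from inter_subset_left)]
    simp [Measure.real]
  · intro k _
    exact (integrable_indicator_iff (hm k)).2 (integrable_const _).integrableOn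

theorem integrable_sub_of_mem_unitInterval {α β : X → ℝ} (hα : Continuous α) (hβ : Continuous β)
    (h0 : ∀ x, 0 ≤ α x) (h : ∀ x, α x ≤ β x) (h1 : ∀ x, β x ≤ 1) :
    Integrable (fun x => β x - α x) μ :=
  Integrable.of_bound (hβ.sub hα).measurable.aestronglyMeasurable 1
    (Eventually.of_forall fun x => by
      rw [Real.norm_of_nonneg (sub_nonneg.2 (h x))]; linarith [h0 x, h1 x])

/-- The number of grid cells inside the interval at `x` is at most `2ᴺ (β x - α x)` and falls short
of it by at most 2. Thus the integral is the supremum of scaled finite sums of measures of open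
sets, the quantities that a valuation bounds from below. -/
theorem lt_integral_iff_exists_grid {U : Set X} (hU : IsOpen U) {α β : X → ℝ} (hα : Continuous α)
    (hβ : Continuous β) (h0 : ∀ x, 0 ≤ α x) (h : ∀ x, α x ≤ β x) (h1 : ∀ x, β x ≤ 1) (c : ℝ) :
    c < ∫ x in U, (β x - α x) ∂μ ↔
      ∃ N : ℕ, c * 2 ^ N < ∑ k ∈ Finset.range (2 ^ N), μ.real (gridSet U α β N k) := by
  have hi := (integrable_sub_of_mem_unitInterval μ hα hβ h0 h h1).integrableOn (s := U)
  have hup : ∀ N : ℕ, ∑ k ∈ Finset.range (2 ^ N), μ.real (gridSet U α β N k) ≤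
      (∫ x in U, (β x - α x) ∂μ) * 2 ^ N := by
    intro N
    rw [sum_measureReal_gridSet μ hU hα hβ, ← integral_mul_const]
    refine integral_mono_of_nonneg (Eventually.of_forall fun x => Nat.cast_nonneg _)
      (hi.mul_const _) (Eventually.of_forall fun x => ?_)
    simpa using card_gridCells_le (K := 2 ^ N) (h0 x) (h x) (h1 x)
  have hcard : ∀ N : ℕ, Integrable (fun x => ((gridCells (2 ^ N) (α x) (β x)).card : ℝ))
      (μ.restrict U) := by
    intro N
    refine Integrable.of_bound (C := 2 ^ N) ?_ (Eventually.of_forall fun x => ?_)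
    · refine Measurable.aestronglyMeasurable ?_
      have : (fun x => ((gridCells (2 ^ N) (α x) (β x)).card : ℝ)) = fun x =>
          ∑ k ∈ Finset.range (2 ^ N),
            (gridSet univ α β N k).indicator (fun _ => (1 : ℝ)) x := by
        classical
        ext x
        simp only [gridCells, Finset.card_filter]
        push_cast
        refine Finset.sum_congr rfl fun k hk => ?_
        have := mem_gridCells_iff (Finset.mem_range.1 hk) (α x) (β x)
        simp only [gridCells, Finset.mem_filter, hk, true_and] at this
        push_cast at this
        simp only [this, gridSet, univ_inter, Set.indicator_apply, mem_ofPred_eq, Nat.cast_add,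
          Nat.cast_one]
      rw [this]
      exact Finset.measurable_sum _ fun k _ => measurable_const.indicator
        (isOpen_gridSet isOpen_univ hα hβ N k).measurableSet
    · rw [Real.norm_of_nonneg (Nat.cast_nonneg _)]
      exact (Nat.cast_le.2 (Finset.card_filter_le _ _)).trans (by simp)
  have hlow : ∀ N : ℕ, (∫ x in U, (β x - α x) ∂μ) * 2 ^ N - 2 ≤
      ∑ k ∈ Finset.range (2 ^ N), μ.real (gridSet U α β N k) := by
    intro N
    rw [sum_measureReal_gridSet μ hU hα hβ, ← integral_mul_const]
    have h3 : ∫ x in U, ((β x - α x) * 2 ^ N - 2) ∂μ ≤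
        ∫ x in U, ((gridCells (2 ^ N) (α x) (β x)).card : ℝ) ∂μ := by
      refine integral_mono ((hi.mul_const _).sub (integrable_const _)) (hcard N) fun x => ?_
      simpa using le_card_gridCells (K := 2 ^ N) (h0 x) (h1 x)
    rw [integral_sub (hi.mul_const _) (integrable_const _)] at h3
    have h4 : ∫ _ in U, (2 : ℝ) ∂μ ≤ 2 := by
      rw [setIntegral_const, smul_eq_mul]
      linarith [measureReal_le_one (μ := μ) (s := U)]
    linarith
  constructor
  · intro hc
    -- The mesh is so fine that the counting loss 2 is less than `2ᴺ` times the gap to `c`.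
    obtain ⟨N, hN⟩ := pow_unbounded_of_one_lt (2 / ((∫ x in U, (β x - α x) ∂μ) - c))
      (one_lt_two (α := ℝ))
    refine ⟨N, lt_of_lt_of_le ?_ (hlow N)⟩
    rw [div_lt_iff₀ (sub_pos.2 hc)] at hN
    linarith
  · rintro ⟨N, hN⟩
    exact lt_of_mul_lt_mul_right (hN.trans_le (hup N)) (by positivity)

end LowerIntegral

/-- A weighted sum is approximated from below by approximating the summands from below. -/
theorem lt_sum_iff_exists_list {n : ℕ} {m : ℕ → ℝ} (hm : ∀ k, 0 ≤ m k) (w : ℕ → ℕ) (c : ℝ) :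
    c < ∑ k ∈ Finset.range n, w k * m k ↔ ∃ (L : ℕ) (B : List ℕ),
      (∀ k < n, B.getD k 0 = 0 ∨ (B.getD k 0 : ℝ) < 2 ^ L * m k) ∧
      c * 2 ^ L < (((List.range n).map fun k => w k * B.getD k 0).sum : ℕ) := by
  have hsum : ∀ B : List ℕ, (((List.range n).map fun k => w k * B.getD k 0).sum : ℕ) =
      ∑ k ∈ Finset.range n, w k * B.getD k 0 := fun B => by
    rw [← List.sum_toFinset _ List.nodup_range, List.toFinset_range]
  simp only [hsum]
  constructor
  · intro h
    -- Rounding loses at most one unit of `2⁻ᴸ` per summand, in total the sum of the weights.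
    obtain ⟨L, hL⟩ := pow_unbounded_of_one_lt ((∑ k ∈ Finset.range n, (w k : ℝ)) /
      ((∑ k ∈ Finset.range n, w k * m k) - c)) (one_lt_two (α := ℝ))
    rw [div_lt_iff₀ (sub_pos.2 h)] at hL
    -- This is the largest natural number strictly below `2ᴸ m k`, or 0 if there is none; the
    -- alternative `B = 0` admits summands that vanish.
    refine ⟨L, (List.range n).map fun k => ⌈2 ^ L * m k⌉₊ - 1, fun k hk => ?_, ?_⟩
    · rw [List.getD_eq_getElem _ _ (by simpa using hk)]
      simp only [List.getElem_map, List.getElem_range]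
      by_cases h0 : ⌈2 ^ L * m k⌉₊ - 1 = 0
      · exact Or.inl h0
      · exact Or.inr (Nat.lt_ceil.1 (by omega))
    · have h1 : ∀ k ∈ Finset.range n, 2 ^ L * (w k * m k) - w k ≤
          w k * ((((List.range n).map fun k => ⌈2 ^ L * m k⌉₊ - 1).getD k 0 : ℕ) : ℝ) := by
        intro k hk
        rw [List.getD_eq_getElem _ _ (by simpa using hk)]
        simp only [List.getElem_map, List.getElem_range]
        have h2 := Nat.le_ceil (2 ^ L * m k)
        have h3 : ((⌈2 ^ L * m k⌉₊ : ℕ) : ℝ) ≤ (⌈2 ^ L * m k⌉₊ - 1 : ℕ) + 1 := by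
          norm_cast; omega
        have h4 := mul_le_mul_of_nonneg_left (h2.trans h3) (Nat.cast_nonneg (α := ℝ) (w k))
        linarith
      have h4 := Finset.sum_le_sum h1
      rw [Finset.sum_sub_distrib, ← Finset.mul_sum] at h4
      push_cast
      linarith
  · rintro ⟨L, B, h1, h2⟩
    have h3 : ((∑ k ∈ Finset.range n, w k * B.getD k 0 : ℕ) : ℝ) ≤
        (∑ k ∈ Finset.range n, w k * m k) * 2 ^ L := by
      rw [Finset.sum_mul]
      push_cast
      refine Finset.sum_le_sum fun k hk => ?_
      rw [mul_assoc, mul_comm (m k)]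
      refine mul_le_mul_of_nonneg_left ?_ (Nat.cast_nonneg _)
      rcases h1 k (Finset.mem_range.1 hk) with h | h
      · rw [h, Nat.cast_zero]
        exact mul_nonneg (by positivity) (hm k)
      · exact h.le
    exact lt_of_mul_lt_mul_right (h2.trans_le h3) (by positivity)

/-! ### The Fan metric -/

namespace RandomVariable

/-- For variables given by open preimages, a finite union of rectangles again has an open preimage,
and it is contained in `E`. -/
theorem jointProb_le {X Y : Type*} [TopologicalSpace X] [TopologicalSpace Y] {Z : RandomVariable X}
    {T : RandomVariable Y} {A : Opens X → Opens Cantor} {B : Opens Y → Opens Cantor}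
    (hZ : ∀ U, Z.preimage U = LowerMeasurableSet.ofOpen (A U))
    (hT : ∀ V, T.preimage V = LowerMeasurableSet.ofOpen (B V)) {W : Set (X × Y)} {E : Set Cantor}
    (h : ∀ (U : Opens X) (V : Opens Y), (U : Set X) ×ˢ (V : Set Y) ⊆ W →
      ∀ ω, ω ∈ A U → ω ∈ B V → ω ∈ E) :
    jointProb Z T W ≤ coin E := by
  refine iSup₂_le fun l hl => ?_
  have h1 : ∃ O : Opens Cantor, (O : Set Cantor) ⊆ E ∧
      (l.map fun R => (Z.preimage R.1).inf (T.preimage R.2)).foldr LowerMeasurableSet.sup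
        (LowerMeasurableSet.ofOpen ⊥) = LowerMeasurableSet.ofOpen O := by
    induction l with
    | nil => exact ⟨⊥, by simp, rfl⟩
    | cons R l ih =>
      obtain ⟨O, hO, e⟩ := ih fun R hR => hl R (List.mem_cons_of_mem _ hR)
      refine ⟨(A R.1 ⊓ B R.2) ⊔ O, ?_, ?_⟩
      · rw [Opens.coe_sup]
        refine union_subset (fun ω hω => ?_) hO
        exact h R.1 R.2 (hl R List.mem_cons_self) ω hω.1 hω.2
      · rw [LowerMeasurableSet.sup_ofOpen, ← e, LowerMeasurableSet.inf_ofOpen, ← hZ, ← hT]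
        rfl
  obtain ⟨O, hO, e⟩ := h1
  rw [e, LowerMeasurableSet.measure_ofOpen]
  exact measure_mono hO

theorem fanDist_le {X : Type*} [MetricSpace X] {Z T : RandomVariable X} {c : ℝ≥0∞}
    (h : ∀ ε : ℚ, c < ENNReal.ofReal (ε : ℝ) →
      jointProb Z T {z | (ε : ℝ) < dist z.1 z.2} ≤ c) : fanDist Z T ≤ c := by
  refine sSup_le ?_
  rintro e ⟨ε, -, rfl, he⟩
  by_contra! hlt
  exact (he.trans_le (h ε hlt)).not_gt hlt

end RandomVariable

theorem ENNReal.inv_two_pow_lt_ofReal_iff {n : ℕ} {ε : ℝ} :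
    (2 : ℝ≥0∞)⁻¹ ^ n < ENNReal.ofReal ε ↔ (2 : ℝ)⁻¹ ^ n < ε := by
  have : (2 : ℝ≥0∞)⁻¹ ^ n = ENNReal.ofReal (2⁻¹ ^ n) := by
    rw [ENNReal.ofReal_pow (by norm_num), ENNReal.ofReal_inv_of_pos (by norm_num),
      ENNReal.ofReal_ofNat]
  rw [this]
  refine ⟨fun h => (ENNReal.ofReal_lt_ofReal_iff_of_nonneg (by positivity)).1 h,
    fun h => (ENNReal.ofReal_lt_ofReal_iff_of_nonneg (by positivity)).2 h⟩

/-! ### Fan distance of functions that follow the tree. -/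

section Approximation

variable {X : Type*} [MetricSpace X] [MeasurableSpace X] [BorelSpace X] (ξ : ℕ → X)
  (hξ : DenseRange ξ) (μ : Measure X) [IsProbabilityMeasure μ]

/-- The function `f` follows the nodes of level `n + 4` except on a set of measure `2⁻ⁿ⁻³`. -/
def FollowsTree (n : ℕ) (f : Cantor → X) : Prop :=
  ∃ E : Set Cantor, coin E ≤ (2 : ℝ≥0∞)⁻¹ ^ (n + 3) ∧ ∀ ω, ω ∉ E → ∃ s : List ℕ,
    s.length = n + 4 ∧ ω ∈ ((denseTree ξ hξ).mean μ).cell s ∧ f ω = ξ (s.getD (n + 3) 0)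

variable {ξ hξ μ}

/-- A nonempty cell has positive mean mass, so the node is visible at some point. -/
theorem exists_mem_support_of_mem_cell {s : List ℕ} {ω : Cantor}
    (h : ω ∈ ((denseTree ξ hξ).mean μ).cell s) : ∃ x, x ∈ (denseTree ξ hξ).support s := by
  by_contra! h0
  refine ((denseTree ξ hξ).mean μ).mass_ne_zero_of_mem h ?_
  rw [← (denseTree ξ hξ).setLIntegral_mass_of_support_subset μ (U := ∅) fun x hx => h0 x hx]
  simp

/-- The nodes are comparable, and a point of the support of the deeper one serves both. This point
replaces the missing value of the random variable. -/
theorem exists_mem_support_of_mem_cells {s t : List ℕ} {ω : Cantor}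
    (hs : ω ∈ ((denseTree ξ hξ).mean μ).cell s) (ht : ω ∈ ((denseTree ξ hξ).mean μ).cell t) :
    ∃ x, x ∈ (denseTree ξ hξ).support s ∧ x ∈ (denseTree ξ hξ).support t := by
  rcases ((denseTree ξ hξ).mean μ).comparable_of_mem hs ht with h | h
  · obtain ⟨x, hx⟩ := exists_mem_support_of_mem_cell ht
    exact ⟨x, (denseTree ξ hξ).support_subset_of_prefix h hx, hx⟩
  · obtain ⟨x, hx⟩ := exists_mem_support_of_mem_cell hs
    exact ⟨x, hx, (denseTree ξ hξ).support_subset_of_prefix h hx⟩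

/-- Outside `E ∪ E'` both values are close to one point `x` at which both nodes are visible. -/
theorem fanDist_ofContinuous_lt {m n : ℕ} {f g : C(Cantor, X)} (hf : FollowsTree ξ hξ μ m f)
    (hg : FollowsTree ξ hξ μ n g) : RandomVariable.fanDist (RandomVariable.ofContinuous f)
      (RandomVariable.ofContinuous g) < (2 : ℝ≥0∞)⁻¹ ^ min m n := by
  obtain ⟨E, hE, hf⟩ := hf
  obtain ⟨E', hE', hg⟩ := hg
  have hhalf : (2 : ℝ≥0∞)⁻¹ < 1 := by simp
  have hm : (2 : ℝ≥0∞)⁻¹ ^ (m + 3) ≤ 2⁻¹ ^ (min m n + 1 + 1) :=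
    pow_le_pow_of_le_one zero_le hhalf.le (by omega)
  have hn : (2 : ℝ≥0∞)⁻¹ ^ (n + 3) ≤ 2⁻¹ ^ (min m n + 1 + 1) :=
    pow_le_pow_of_le_one zero_le hhalf.le (by omega)
  -- Two errors of at most `2⁻ᵏ⁻²`, with `k = min m n`, bound both the distance and the exceptional
  -- measure by `2⁻ᵏ⁻¹`; the spare factor 2 yields strictness.
  refine lt_of_le_of_lt (b := (2 : ℝ≥0∞)⁻¹ ^ (min m n + 1)) ?_ (by
    rw [← LowerCauchySeq.two_halves (min m n)]
    exact ENNReal.lt_add_right (by simp) (by simp))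
  refine RandomVariable.fanDist_le fun ε hε => ?_
  rw [ENNReal.inv_two_pow_lt_ofReal_iff] at hε
  refine (RandomVariable.jointProb_le (A := fun U => U.comap f) (B := fun U => U.comap g)
    (E := E ∪ E') (fun _ => rfl) (fun _ => rfl) fun U V hUV ω hU hV => ?_).trans ?_
  · by_contra hω
    rw [mem_union, not_or] at hω
    obtain ⟨s, hs, hsω, hfω⟩ := hf ω hω.1
    obtain ⟨t, ht, htω, hgω⟩ := hg ω hω.2
    obtain ⟨x, hxs, hxt⟩ := exists_mem_support_of_mem_cells hsω htω
    have h1 := denseTree_dist_lt ξ hξ hxs (i := m + 3) (by omega)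
    have h2 := denseTree_dist_lt ξ hξ hxt (i := n + 3) (by omega)
    rw [← hfω] at h1
    rw [← hgω] at h2
    have h3 : (ε : ℝ) < dist (f ω) (g ω) := hUV (show (f ω, g ω) ∈ (U : Set X) ×ˢ (V : Set X) from
      ⟨hU, hV⟩)
    have h4 := dist_triangle_left (f ω) (g ω) x
    have h5 : (2 : ℝ)⁻¹ ^ (m + 3) ≤ 2⁻¹ ^ (min m n + 1 + 1) :=
      pow_le_pow_of_le_one (by norm_num) (by norm_num) (by omega)
    have h6 : (2 : ℝ)⁻¹ ^ (n + 3) ≤ 2⁻¹ ^ (min m n + 1 + 1) :=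
      pow_le_pow_of_le_one (by norm_num) (by norm_num) (by omega)
    have h7 : (2 : ℝ)⁻¹ ^ (min m n + 1 + 1) = 2⁻¹ ^ (min m n + 1) * 2⁻¹ := pow_succ _ _
    linarith
  · refine (measure_union_le _ _).trans ?_
    rw [← LowerCauchySeq.two_halves]
    exact add_le_add (hE.trans hm) (hE'.trans hn)

/-- If `ω` is in the preimage of `V` through a node `t`, any point visible at both `t` and the node
followed by `f` lies in `V`. That point is paired with `f ω` to contradict the rectangle. -/
theorem fanDist_randomVariable_le {n : ℕ} {f : C(Cantor, X)} (hf : FollowsTree ξ hξ μ n f) :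
    RandomVariable.fanDist (RandomVariable.ofContinuous f)
      ((denseTree ξ hξ).randomVariable μ) ≤ (2 : ℝ≥0∞)⁻¹ ^ n := by
  obtain ⟨E, hE, hf⟩ := hf
  refine RandomVariable.fanDist_le fun ε hε => ?_
  rw [ENNReal.inv_two_pow_lt_ofReal_iff] at hε
  refine (RandomVariable.jointProb_le (A := fun U => U.comap f)
    (B := fun U => ⟨(denseTree ξ hξ).preimage μ U, (denseTree ξ hξ).isOpen_preimage μ U⟩)
    (E := E) (fun _ => rfl) (fun _ => rfl) fun U V hUV ω hU hV => ?_).trans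
    (hE.trans (pow_le_pow_of_le_one zero_le (by simp) (by omega)))
  by_contra hω
  obtain ⟨s, hs, hsω, hfω⟩ := hf ω hω
  obtain ⟨t, ht, htω⟩ := ((denseTree ξ hξ).mean μ).mem_cells.1 hV
  obtain ⟨x, hxs, hxt⟩ := exists_mem_support_of_mem_cells hsω htω
  have h1 := denseTree_dist_lt ξ hξ hxs (i := n + 3) (by omega)
  rw [← hfω, dist_comm] at h1
  have h3 : (ε : ℝ) < dist (f ω) x := hUV (show (f ω, x) ∈ (U : Set X) ×ˢ (V : Set X) from
    ⟨hU, ht hxt⟩)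
  have h5 : (2 : ℝ)⁻¹ ^ (n + 3) ≤ 2⁻¹ ^ n :=
    pow_le_pow_of_le_one (by norm_num) (by norm_num) (by omega)
  linarith

end Approximation

/-! ### Semidecidability of the basic relations -/

theorem Maps.eq_iff {p q r : ℕ → ℕ} (h : Maps p q r) {n v : ℕ} :
    r n = v ↔ ∃ m, (wordFun p (seqPrefix q m))[n]? = some v := by
  constructor
  · rintro rfl
    obtain ⟨m, k, hk, e⟩ := h.2 (n + 1)
    exact ⟨m, by rw [e, getElem?_seqPrefix_eq_some]; exact ⟨hk, rfl⟩⟩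
  · rintro ⟨m, hm⟩
    obtain ⟨k, e⟩ := h.1 m
    rw [e, getElem?_seqPrefix_eq_some] at hm
    exact hm.2

namespace SemiDec

variable {I J α β : Type*} [Primcodable α] [Primcodable β] {orc : I → ℕ → ℕ}

theorem graph_pairSeq {f g : I → α → ℕ → ℕ}
    (hf : SemiDec orc fun i (p : α × ℕ × ℕ) => f i p.1 p.2.1 = p.2.2)
    (hg : SemiDec orc fun i (p : α × ℕ × ℕ) => g i p.1 p.2.1 = p.2.2) :
    SemiDec orc fun i (p : α × ℕ × ℕ) => pairSeq (f i p.1) (g i p.1) p.2.1 = p.2.2 := by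
  have h1 := (of_primrec (orc := orc) (P := fun p : α × ℕ × ℕ => p.2.1 % 2 = 0)
    (by fun_prop)).and (hf.comp (g := fun p : α × ℕ × ℕ => (p.1, p.2.1 / 2, p.2.2)) (by fun_prop))
  have h2 := (of_primrec (orc := orc) (P := fun p : α × ℕ × ℕ => ¬ p.2.1 % 2 = 0)
    (by fun_prop)).and (hg.comp (g := fun p : α × ℕ × ℕ => (p.1, p.2.1 / 2, p.2.2)) (by fun_prop))
  refine (h1.or h2).congr fun i p => ?_
  by_cases h : p.2.1 % 2 = 0 <;> simp [pairSeq, h]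

theorem wordFun_output {P : I → ℕ → ℕ} {Q : I → α → ℕ → ℕ}
    (hP : SemiDec orc fun i (p : ℕ × ℕ) => P i p.1 = p.2)
    (hQ : SemiDec orc fun i (p : α × ℕ × ℕ) => Q i p.1 p.2.1 = p.2.2) :
    SemiDec orc fun i (p : α × ℕ × ℕ) =>
      ∃ m, (wordFun (P i) (seqPrefix (Q i p.1) m))[p.2.1]? = some p.2.2 := by
  -- The search is for the length of an input prefix, the prefix itself and the table entry at its
  -- code.
  have h := (SemiDec.ex (R := fun i (p : α × ℕ × ℕ) (b : ℕ × List ℕ × ℕ) =>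
    seqPrefix (Q i p.1) b.1 = b.2.1 ∧ P i (Encodable.encode b.2.1) = b.2.2 ∧
      (Denumerable.ofNat (List ℕ) b.2.2)[p.2.1]? = some p.2.2)
    ((hQ.graph_prefix.comp (g := fun q : (α × ℕ × ℕ) × ℕ × List ℕ × ℕ =>
        ((q.1.1, q.2.1), q.2.2.1)) (by fun_prop)).and
      ((hP.comp (g := fun q : (α × ℕ × ℕ) × ℕ × List ℕ × ℕ =>
        (Encodable.encode q.2.2.1, q.2.2.2)) (by fun_prop)).and (of_primrec (by fun_prop)))))
  refine h.congr fun i p => ?_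
  constructor
  · rintro ⟨m, hm⟩
    exact ⟨(m, _, _), rfl, rfl, hm⟩
  · rintro ⟨⟨m, w, c⟩, h1, h2, h⟩
    dsimp only at h1 h2 h
    exact ⟨m, by rw [wordFun, h1, h2]; exact h⟩

/-- A semidecidable relation remains so if a point is added to the instances. -/
theorem lift {X : Type*} {A : Naming X} {R : I → α → Prop} (hR : SemiDec orc R) :
    SemiDec (fun t : I × NamedPoint A => pairSeq (orc t.1) t.2.name) fun t => R t.1 :=
  (hR.pull fun t : I × NamedPoint A => t.1).of_graph fst_oracle

theorem graph_const {f : I → ℕ → ℕ} (hf : SemiDec orc fun i (p : ℕ × ℕ) => f i p.1 = p.2) :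
    SemiDec orc fun i (p : α × ℕ × ℕ) => f i p.2.1 = p.2.2 :=
  hf.comp (g := fun p : α × ℕ × ℕ => p.2) (by fun_prop)

end SemiDec

/-- Clearing denominators and moving negative terms across leaves a comparison of natural numbers,
which is primitive recursive. -/
theorem ratOfNat_add_lt_iff (v n B D : ℕ) : (ratOfNat v : ℝ) + (2 : ℝ)⁻¹ ^ n < B / 2 ^ D ↔
    (v.unpair.1.unpair.1 * 2 ^ n + (v.unpair.2 + 1)) * 2 ^ D <
      B * 2 ^ n * (v.unpair.2 + 1) + v.unpair.1.unpair.2 * 2 ^ n * 2 ^ D := by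
  rw [ratOfNat, inv_pow]
  generalize v.unpair.1.unpair.1 = a
  generalize v.unpair.1.unpair.2 = b
  generalize v.unpair.2 = z
  rw [← Nat.cast_lt (α := ℝ)]
  push_cast
  have hz : (0 : ℝ) < z + 1 := by positivity
  have hn : (0 : ℝ) < 2 ^ n := by positivity
  have hD : (0 : ℝ) < 2 ^ D := by positivity
  rw [lt_div_iff₀ hD, ← mul_lt_mul_iff_left₀ (mul_pos hz hn)]
  rw [show (((a : ℝ) - b) / (z + 1) + (2 ^ n)⁻¹) * 2 ^ D * ((z + 1) * 2 ^ n) =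
    (((a : ℝ) - b) * 2 ^ n + (z + 1)) * 2 ^ D by field_simp]
  constructor <;> intro h <;> linarith

theorem lt_ratOfNat_sub_iff (v n B D : ℕ) : (B : ℝ) / 2 ^ D < (ratOfNat v : ℝ) - (2 : ℝ)⁻¹ ^ n ↔
    (B * 2 ^ n + 2 ^ D) * (v.unpair.2 + 1) + v.unpair.1.unpair.2 * 2 ^ n * 2 ^ D <
      v.unpair.1.unpair.1 * 2 ^ n * 2 ^ D := by
  rw [ratOfNat, inv_pow]
  generalize v.unpair.1.unpair.1 = a
  generalize v.unpair.1.unpair.2 = b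
  generalize v.unpair.2 = z
  rw [← Nat.cast_lt (α := ℝ)]
  push_cast
  have hz : (0 : ℝ) < z + 1 := by positivity
  have hn : (0 : ℝ) < 2 ^ n := by positivity
  have hD : (0 : ℝ) < 2 ^ D := by positivity
  rw [div_lt_iff₀ hD, ← mul_lt_mul_iff_left₀ (mul_pos hz hn)]
  rw [show (((a : ℝ) - b) / (z + 1) - (2 ^ n)⁻¹) * 2 ^ D * ((z + 1) * 2 ^ n) =
    (((a : ℝ) - b) * 2 ^ n - (z + 1)) * 2 ^ D by field_simp]
  constructor <;> intro h <;> linarith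

theorem realNaming.lt_iff {r : ℕ → ℕ} {x : ℝ} (h : realNaming r x) (c : ℝ) :
    x < c ↔ ∃ n, (ratOfNat (r n) : ℝ) + (2 : ℝ)⁻¹ ^ n < c := by
  constructor
  · intro hx
    obtain ⟨n, hn⟩ := exists_pow_lt_of_lt_one (half_pos (sub_pos.2 hx))
      (show (2 : ℝ)⁻¹ < 1 by norm_num)
    exact ⟨n, by linarith [(abs_le.1 (h n)).2]⟩
  · rintro ⟨n, hn⟩
    linarith [(abs_le.1 (h n)).1]

theorem realNaming.gt_iff {r : ℕ → ℕ} {x : ℝ} (h : realNaming r x) (c : ℝ) :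
    c < x ↔ ∃ n, c < (ratOfNat (r n) : ℝ) - (2 : ℝ)⁻¹ ^ n := by
  constructor
  · intro hx
    obtain ⟨n, hn⟩ := exists_pow_lt_of_lt_one (half_pos (sub_pos.2 hx))
      (show (2 : ℝ)⁻¹ < 1 by norm_num)
    exact ⟨n, by linarith [(abs_le.1 (h n)).1]⟩
  · rintro ⟨n, hn⟩
    linarith [(abs_le.1 (h n)).2]

/-- Codes of the distance and of a sequence of points. -/
structure MetricData {X : Type*} [MetricSpace X] (δ : TTERepresentation X) where
  distCode : ℕ → ℕ
  isName_dist : Naming.fn (Naming.prod δ.IsName δ.IsName) realNaming distCode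
    fun z => dist z.1 z.2
  pointCode : ℕ → ℕ
  point : ℕ → X
  isName_point : Naming.seq δ.IsName pointCode point

/-! ### Thresholds for distances, bumps and endpoints at a named point. -/

section Points

variable {X : Type*} [MetricSpace X] {δ : TTERepresentation X} (D : MetricData δ)
  {K : Type*} {orc : K → ℕ → ℕ} {x : K → NamedPoint δ.IsName}

/-- The oracle computes the codes of the metric data. -/
structure KnowsMetric (orc : K → ℕ → ℕ) : Prop where
  dist : SemiDec orc fun _ (p : ℕ × ℕ) => D.distCode p.1 = p.2
  point : SemiDec orc fun _ (p : ℕ × ℕ) => D.pointCode p.1 = p.2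

variable {D} (hD : KnowsMetric D orc) (hx : SemiDec orc fun k (p : ℕ × ℕ) => (x k).name p.1 = p.2)

theorem MetricData.exists_distance_name (D : MetricData δ) (y : NamedPoint δ.IsName) (i : ℕ) :
    ∃ r, Maps D.distCode (pairSeq y.name fun l => D.pointCode (Nat.pair i l)) r ∧
      realNaming r (dist y.point (D.point i)) := by
  refine D.isName_dist _ (y.point, D.point i) ⟨?_, ?_⟩
  · convert y.isName using 1
    ext l
    simp [fstSeq, pairSeq]
  · convert D.isName_point i using 1
    ext l
    simp [sndSeq, pairSeq, Nat.add_mod, show (2 * l + 1) / 2 = l by omega]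

include hD hx

theorem semiDec_distance_output : SemiDec orc fun k (p : ℕ × ℕ × ℕ) =>
    ∃ m, (wordFun D.distCode (seqPrefix (pairSeq (x k).name fun l =>
      D.pointCode (Nat.pair p.1 l)) m))[p.2.1]? = some p.2.2 :=
  SemiDec.wordFun_output (P := fun _ => D.distCode)
    (Q := fun k i => pairSeq (x k).name fun l => D.pointCode (Nat.pair i l)) hD.dist
    (SemiDec.graph_pairSeq (f := fun k _ => (x k).name)
      (g := fun _ i l => D.pointCode (Nat.pair i l)) hx.graph_const
      (hD.point.comp (g := fun p : ℕ × ℕ × ℕ => (Nat.pair p.1 p.2.1, p.2.2)) (by fun_prop)))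

theorem semiDec_dist_lt : SemiDec orc fun k (p : ℕ × ℕ × ℕ) =>
    dist (x k).point (D.point p.1) < (p.2.1 : ℝ) / 2 ^ p.2.2 := by
  have h := SemiDec.ex (R := fun k (p : ℕ × ℕ × ℕ) (b : ℕ × ℕ) =>
    (∃ m, (wordFun D.distCode (seqPrefix (pairSeq (x k).name fun l =>
      D.pointCode (Nat.pair p.1 l)) m))[b.1]? = some b.2) ∧
    (b.2.unpair.1.unpair.1 * 2 ^ b.1 + (b.2.unpair.2 + 1)) * 2 ^ p.2.2 <
      p.2.1 * 2 ^ b.1 * (b.2.unpair.2 + 1) + b.2.unpair.1.unpair.2 * 2 ^ b.1 * 2 ^ p.2.2)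
    (((semiDec_distance_output hD hx).comp
      (g := fun q : (ℕ × ℕ × ℕ) × ℕ × ℕ => (q.1.1, q.2.1, q.2.2)) (by fun_prop)).and
      (SemiDec.of_primrec (by fun_prop)))
  refine h.congr fun k p => ?_
  obtain ⟨r, hr, hr'⟩ := D.exists_distance_name (x k) p.1
  simp only [hr'.lt_iff, ← hr.eq_iff, ratOfNat_add_lt_iff]
  exact ⟨fun ⟨n, hn⟩ => ⟨(n, r n), rfl, hn⟩, fun ⟨⟨n, v⟩, h1, h2⟩ => ⟨n, by
    simp only at h1; subst h1; exact h2⟩⟩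

theorem semiDec_lt_dist : SemiDec orc fun k (p : ℕ × ℕ × ℕ) =>
    (p.2.1 : ℝ) / 2 ^ p.2.2 < dist (x k).point (D.point p.1) := by
  have h := SemiDec.ex (R := fun k (p : ℕ × ℕ × ℕ) (b : ℕ × ℕ) =>
    (∃ m, (wordFun D.distCode (seqPrefix (pairSeq (x k).name fun l =>
      D.pointCode (Nat.pair p.1 l)) m))[b.1]? = some b.2) ∧
    (p.2.1 * 2 ^ b.1 + 2 ^ p.2.2) * (b.2.unpair.2 + 1) +
      b.2.unpair.1.unpair.2 * 2 ^ b.1 * 2 ^ p.2.2 < b.2.unpair.1.unpair.1 * 2 ^ b.1 * 2 ^ p.2.2)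
    (((semiDec_distance_output hD hx).comp
      (g := fun q : (ℕ × ℕ × ℕ) × ℕ × ℕ => (q.1.1, q.2.1, q.2.2)) (by fun_prop)).and
      (SemiDec.of_primrec (by fun_prop)))
  refine h.congr fun k p => ?_
  obtain ⟨r, hr, hr'⟩ := D.exists_distance_name (x k) p.1
  simp only [hr'.gt_iff, ← hr.eq_iff, lt_ratOfNat_sub_iff]
  exact ⟨fun ⟨n, hn⟩ => ⟨(n, r n), rfl, hn⟩, fun ⟨⟨n, v⟩, h1, h2⟩ => ⟨n, by
    simp only at h1; subst h1; exact h2⟩⟩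

/-- Arguments: numerator and exponent of the threshold, level and index. -/
theorem semiDec_lt_bumpMax : SemiDec orc fun k (p : ℕ × ℕ × ℕ × ℕ) =>
    (p.1 : ℝ) / 2 ^ p.2.1 < bumpMax D.point p.2.2.1 p.2.2.2 (x k).point := by
  have h := SemiDec.exists_lt (R := fun k (p : ℕ × ℕ × ℕ × ℕ) i => p.1 < 2 ^ p.2.1 ∧
    dist (x k).point (D.point i) <
      ((2 * 2 ^ p.2.1 - p.1 : ℕ) : ℝ) / 2 ^ (p.2.2.1 + 1 + p.2.1)) (f := fun p => p.2.2.2)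
    ((SemiDec.of_primrec (by fun_prop)).and ((semiDec_dist_lt hD hx).comp
      (g := fun q : (ℕ × ℕ × ℕ × ℕ) × ℕ =>
        (q.2, 2 * 2 ^ q.1.2.1 - q.1.1, q.1.2.2.1 + 1 + q.1.2.1)) (by fun_prop))) (by fun_prop)
  refine h.congr fun k p => ?_
  rw [lt_bumpMax_iff _ (by positivity)]
  simp only [div_two_pow_lt_bump_iff]

theorem semiDec_bumpMax_lt : SemiDec orc fun k (p : ℕ × ℕ × ℕ × ℕ) =>
    bumpMax D.point p.2.2.1 p.2.2.2 (x k).point < (p.1 : ℝ) / 2 ^ p.2.1 := by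
  have h := (SemiDec.of_primrec (orc := orc) (P := fun p : ℕ × ℕ × ℕ × ℕ => 0 < p.1)
    (by fun_prop)).and (SemiDec.forall_lt (R := fun k (p : ℕ × ℕ × ℕ × ℕ) i => 2 ^ p.2.1 < p.1 ∨
    p.1 ≤ 2 ^ p.2.1 ∧ ((2 * 2 ^ p.2.1 - p.1 : ℕ) : ℝ) / 2 ^ (p.2.2.1 + 1 + p.2.1) <
      dist (x k).point (D.point i)) (f := fun p => p.2.2.2)
    ((SemiDec.of_primrec (by fun_prop)).or ((SemiDec.of_primrec (by fun_prop)).and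
      ((semiDec_lt_dist hD hx).comp (g := fun q : (ℕ × ℕ × ℕ × ℕ) × ℕ =>
        (q.2, 2 * 2 ^ q.1.2.1 - q.1.1, q.1.2.2.1 + 1 + q.1.2.1)) (by fun_prop)))) (by fun_prop))
  refine h.congr fun k p => ?_
  -- No bump maximum is below the threshold 0, in agreement with the test `0 < p.1`.
  rcases Nat.eq_zero_or_pos p.1 with h0 | h0
  · simp [h0, bumpMax_nonneg]
  · rw [bumpMax_lt_iff _ (div_pos (by exact_mod_cast h0) (by positivity))]
    simp only [h0, true_and, bump_lt_div_two_pow_iff _ h0]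

/-- Arguments: numerator and exponent of the threshold, and the node. -/
theorem semiDec_lt_endpoint (e : ℕ) : SemiDec orc fun k (p : ℕ × ℕ × List ℕ) =>
    (p.1 : ℝ) / 2 ^ p.2.1 < endpoint D.point e p.2.2 0 (x k).point := by
  have hb := semiDec_lt_bumpMax hD hx
  have h := (SemiDec.exists_lt (R := fun k (p : ℕ × ℕ × List ℕ) i =>
      (p.1 : ℝ) / 2 ^ p.2.1 < bumpMax D.point i (p.2.2.getD i 0) (x k).point ∧
      ∀ l < i, (p.1 : ℝ) / 2 ^ p.2.1 < bumpMax D.point l (p.2.2.getD l 0 + 1) (x k).point)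
      (f := fun p => p.2.2.length)
      ((hb.comp (g := fun q : (ℕ × ℕ × List ℕ) × ℕ =>
        (q.1.1, q.1.2.1, q.2, q.1.2.2.getD q.2 0)) (by fun_prop)).and
      (SemiDec.forall_lt (R := fun k (q : (ℕ × ℕ × List ℕ) × ℕ) l => (q.1.1 : ℝ) / 2 ^ q.1.2.1 <
        bumpMax D.point l (q.1.2.2.getD l 0 + 1) (x k).point) (f := fun q => q.2)
        (hb.comp (g := fun r : ((ℕ × ℕ × List ℕ) × ℕ) × ℕ =>
          (r.1.1.1, r.1.1.2.1, r.2, r.1.1.2.2.getD r.2 0 + 1)) (by fun_prop)) (by fun_prop)))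
      (by fun_prop)).or
    ((SemiDec.of_primrec (P := fun p : ℕ × ℕ × List ℕ => p.1 < e * 2 ^ p.2.1)
      (by fun_prop)).and
      (SemiDec.forall_lt (R := fun k (p : ℕ × ℕ × List ℕ) i => (p.1 : ℝ) / 2 ^ p.2.1 <
        bumpMax D.point i (p.2.2.getD i 0 + 1) (x k).point) (f := fun p => p.2.2.length)
        (hb.comp (g := fun q : (ℕ × ℕ × List ℕ) × ℕ =>
          (q.1.1, q.1.2.1, q.2, q.1.2.2.getD q.2 0 + 1)) (by fun_prop)) (by fun_prop)))
  refine h.congr fun k p => ?_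
  rw [lt_endpoint_iff, div_lt_iff₀ (by positivity)]
  simp only [zero_add]
  norm_cast

theorem semiDec_endpoint_lt (e : ℕ) : SemiDec orc fun k (p : ℕ × ℕ × List ℕ) =>
    endpoint D.point e p.2.2 0 (x k).point < (p.1 : ℝ) / 2 ^ p.2.1 := by
  have hb := semiDec_bumpMax_lt hD hx
  have h := (SemiDec.exists_lt (R := fun k (p : ℕ × ℕ × List ℕ) i =>
      bumpMax D.point i (p.2.2.getD i 0 + 1) (x k).point < (p.1 : ℝ) / 2 ^ p.2.1 ∧
      ∀ l < i, bumpMax D.point l (p.2.2.getD l 0) (x k).point < (p.1 : ℝ) / 2 ^ p.2.1)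
      (f := fun p => p.2.2.length)
      ((hb.comp (g := fun q : (ℕ × ℕ × List ℕ) × ℕ =>
        (q.1.1, q.1.2.1, q.2, q.1.2.2.getD q.2 0 + 1)) (by fun_prop)).and
      (SemiDec.forall_lt (R := fun k (q : (ℕ × ℕ × List ℕ) × ℕ) l =>
        bumpMax D.point l (q.1.2.2.getD l 0) (x k).point < (q.1.1 : ℝ) / 2 ^ q.1.2.1)
        (f := fun q => q.2)
        (hb.comp (g := fun r : ((ℕ × ℕ × List ℕ) × ℕ) × ℕ =>
          (r.1.1.1, r.1.1.2.1, r.2, r.1.1.2.2.getD r.2 0)) (by fun_prop)) (by fun_prop)))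
      (by fun_prop)).or
    ((SemiDec.of_primrec (P := fun p : ℕ × ℕ × List ℕ => e * 2 ^ p.2.1 < p.1)
      (by fun_prop)).and
      (SemiDec.forall_lt (R := fun k (p : ℕ × ℕ × List ℕ) i =>
        bumpMax D.point i (p.2.2.getD i 0) (x k).point < (p.1 : ℝ) / 2 ^ p.2.1)
        (f := fun p => p.2.2.length)
        (hb.comp (g := fun q : (ℕ × ℕ × List ℕ) × ℕ =>
          (q.1.1, q.1.2.1, q.2, q.1.2.2.getD q.2 0)) (by fun_prop)) (by fun_prop)))
  refine h.congr fun k p => ?_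
  rw [endpoint_lt_iff, lt_div_iff₀ (by positivity)]
  simp only [zero_add]
  norm_cast

end Points

/-! ### Semidecidability of lower bounds for measures and integrals -/

/-- A probability valuation with a name and the measure that extends it. -/
structure NamedValuation {X : Type*} [TopologicalSpace X] [MeasurableSpace X] (A : Naming X) where
  valuation : OpenValuation X
  name : ℕ → ℕ
  isName : valuationNaming A name valuation
  measure : Measure X
  isProb : IsProbabilityMeasure measure
  measure_eq : ∀ U : Opens X, measure U = valuation.toFun U

attribute [instance] NamedValuation.isProb

theorem lowerNaming.lt_iff {r : ℕ → ℕ} {a : ℝ≥0∞} (h : lowerNaming r a) (ha : a ≠ ∞) (A M : ℕ) :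
    (A : ℝ) < 2 ^ M * a.toReal ↔
      ∃ n, A * ((r n).unpair.2 + 1) < 2 ^ M * (r n).unpair.1 := by
  have h1 : (A : ℝ) < 2 ^ M * a.toReal ↔ ENNReal.ofReal (A / 2 ^ M) < a := by
    rw [ENNReal.ofReal_lt_iff_lt_toReal (by positivity) ha, div_lt_iff₀' (by positivity)]
  rw [h1, ← h.2, lt_iSup_iff]
  refine exists_congr fun n => ?_
  have h0 : (0 : ℝ) ≤ A / 2 ^ M := by positivity
  rw [ENNReal.ofReal_lt_ofReal_iff_of_nonneg h0, nnratOfNat, ← Nat.cast_lt (α := ℝ)]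
  push_cast
  rw [div_lt_div_iff₀ (by positivity) (by positivity), mul_comm (2 ^ M : ℝ)]

section Measures

variable {X : Type*} [TopologicalSpace X] [MeasurableSpace X] [BorelSpace X] {N : Naming X}
  {J α : Type*} [Primcodable α] {orc : J → ℕ → ℕ} {ν : J → NamedValuation N}
  (hν : SemiDec orc fun j (p : ℕ × ℕ) => (ν j).name p.1 = p.2)

include hν

-- A name of the open set is computed by `exists_name` and fed to the name of the valuation, whose
-- output lists lower bounds.
omit [BorelSpace X] in
theorem semiDec_lt_measure {V : J → α → Set X} (hV : ∀ j a, IsOpen (V j a))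
    (h : SemiDecOpen N orc V) : SemiDec orc fun j (p : α × ℕ × ℕ) =>
      (p.2.1 : ℝ) < 2 ^ p.2.2 * (ν j).measure.real (V j p.1) := by
  obtain ⟨u, hu, hg⟩ := h.exists_name
  have h1 := SemiDec.ex (R := fun j (p : α × ℕ × ℕ) (b : ℕ × ℕ) =>
    (∃ m, (wordFun (ν j).name (seqPrefix (u j p.1) m))[b.1]? = some b.2) ∧
      p.2.1 * (b.2.unpair.2 + 1) < 2 ^ p.2.2 * b.2.unpair.1)
    (((SemiDec.wordFun_output (Q := u) hν hg).comp
      (g := fun q : (α × ℕ × ℕ) × ℕ × ℕ => (q.1.1, q.2.1, q.2.2)) (by fun_prop)).and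
      (SemiDec.of_primrec (by fun_prop)))
  refine h1.congr fun j p => ?_
  obtain ⟨r, hr, hr'⟩ := (ν j).isName (u j p.1) ⟨V j p.1, hV j p.1⟩ (hu j p.1)
  rw [← (ν j).measure_eq] at hr'
  change lowerNaming r ((ν j).measure (V j p.1)) at hr'
  rw [Measure.real, hr'.lt_iff (measure_ne_top _ _)]
  simp only [← hr.eq_iff]
  exact ⟨fun ⟨n, hn⟩ => ⟨(n, r n), rfl, hn⟩, fun ⟨⟨n, v⟩, h1, h2⟩ => ⟨n, by
    simp only at h1; subst h1; exact h2⟩⟩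

/-- A lower bound for the integral is witnessed by a mesh, a precision and a list of dyadic lower
bounds for the measures of the grid sets, which are open with semidecidable membership. -/
theorem semiDec_lt_integral {U : J → Set X} (hUo : ∀ j, IsOpen (U j)) {f g : α → X → ℝ}
    (hf : ∀ a, Continuous (f a)) (hg : ∀ a, Continuous (g a)) (h0 : ∀ a x, 0 ≤ f a x)
    (hfg : ∀ a x, f a x ≤ g a x) (h1 : ∀ a x, g a x ≤ 1)
    (hU : SemiDecOpen N orc fun j (_ : Unit) => U j)
    (hf' : SemiDec (fun t : J × NamedPoint N => pairSeq (orc t.1) t.2.name)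
      fun t (p : ℕ × ℕ × α) => f p.2.2 t.2.point < (p.1 : ℝ) / 2 ^ p.2.1)
    (hg' : SemiDec (fun t : J × NamedPoint N => pairSeq (orc t.1) t.2.name)
      fun t (p : ℕ × ℕ × α) => (p.1 : ℝ) / 2 ^ p.2.1 < g p.2.2 t.2.point) :
    SemiDec orc fun j (p : α × ℕ × ℕ) =>
      (p.2.1 : ℝ) < 2 ^ p.2.2 * ∫ x in U j, (g p.1 x - f p.1 x) ∂(ν j).measure := by
  have hcell : SemiDecOpen N orc fun j (q : α × ℕ × ℕ) =>
      gridSet (U j) (f q.1) (g q.1) q.2.1 q.2.2 :=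
    (SemiDec.comp hU (g := fun _ : α × ℕ × ℕ => ()) (by fun_prop)).and
      ((hf'.comp (g := fun q : α × ℕ × ℕ => (q.2.2, q.2.1, q.1)) (by fun_prop)).and
        (hg'.comp (g := fun q : α × ℕ × ℕ => (q.2.2 + 1, q.2.1, q.1)) (by fun_prop)))
  have hm := semiDec_lt_measure hν
    (V := fun j (q : α × ℕ × ℕ) => gridSet (U j) (f q.1) (g q.1) q.2.1 q.2.2)
    (fun j q => isOpen_gridSet (hUo j) (hf q.1) (hg q.1) q.2.1 q.2.2) hcell
  have h2 := SemiDec.ex (R := fun j (p : α × ℕ × ℕ) (b : ℕ × ℕ × List ℕ) =>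
    (∀ k < 2 ^ b.1, b.2.2.getD k 0 = 0 ∨ ((b.2.2.getD k 0 : ℕ) : ℝ) <
      2 ^ b.2.1 * (ν j).measure.real (gridSet (U j) (f p.1) (g p.1) b.1 k)) ∧
    p.2.1 * 2 ^ b.1 * 2 ^ b.2.1 <
      2 ^ p.2.2 * ((List.range (2 ^ b.1)).map fun k => 1 * b.2.2.getD k 0).sum)
    ((SemiDec.forall_lt (R := fun j (q : (α × ℕ × ℕ) × ℕ × ℕ × List ℕ) k =>
      q.2.2.2.getD k 0 = 0 ∨ ((q.2.2.2.getD k 0 : ℕ) : ℝ) <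
        2 ^ q.2.2.1 * (ν j).measure.real (gridSet (U j) (f q.1.1) (g q.1.1) q.2.1 k))
      (f := fun q => 2 ^ q.2.1) ((SemiDec.of_primrec (by fun_prop)).or
        (hm.comp (g := fun r : ((α × ℕ × ℕ) × ℕ × ℕ × List ℕ) × ℕ =>
          ((r.1.1.1, r.1.2.1, r.2), r.1.2.2.2.getD r.2 0, r.1.2.2.1)) (by fun_prop)))
      (by fun_prop)).and (SemiDec.of_primrec (by fun_prop)))
  refine h2.congr fun j p => ?_
  have e1 : (p.2.1 : ℝ) < 2 ^ p.2.2 * ∫ x in U j, (g p.1 x - f p.1 x) ∂(ν j).measure ↔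
      (p.2.1 : ℝ) / 2 ^ p.2.2 < ∫ x in U j, (g p.1 x - f p.1 x) ∂(ν j).measure := by
    rw [div_lt_iff₀' (by positivity)]
  rw [e1, lt_integral_iff_exists_grid _ (hUo j) (hf p.1) (hg p.1) (h0 p.1) (hfg p.1) (h1 p.1)]
  have e2 : ∀ n : ℕ, (p.2.1 : ℝ) / 2 ^ p.2.2 * 2 ^ n < ∑ k ∈ Finset.range (2 ^ n),
      (ν j).measure.real (gridSet (U j) (f p.1) (g p.1) n k) ↔ ∃ (L : ℕ) (B : List ℕ),
      (∀ k < 2 ^ n, B.getD k 0 = 0 ∨ ((B.getD k 0 : ℕ) : ℝ) <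
        2 ^ L * (ν j).measure.real (gridSet (U j) (f p.1) (g p.1) n k)) ∧
      p.2.1 * 2 ^ n * 2 ^ L <
        2 ^ p.2.2 * ((List.range (2 ^ n)).map fun k => 1 * B.getD k 0).sum := by
    intro n
    have := lt_sum_iff_exists_list (n := 2 ^ n)
      (m := fun k => (ν j).measure.real (gridSet (U j) (f p.1) (g p.1) n k))
      (fun k => measureReal_nonneg) (fun _ => 1) ((p.2.1 : ℝ) / 2 ^ p.2.2 * 2 ^ n)
    simp only [Nat.cast_one, one_mul] at this ⊢
    rw [this]
    refine exists₂_congr fun L B => and_congr_right fun _ => ?_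
    rw [div_mul_eq_mul_div, div_mul_eq_mul_div, div_lt_iff₀' (by positivity)]
    norm_cast
  simp only [e2]
  constructor
  · rintro ⟨n, L, B, h⟩
    exact ⟨(n, L, B), h⟩
  · rintro ⟨⟨n, L, B⟩, h⟩
    exact ⟨n, L, B, h⟩

end Measures

/-! ### Semidecidability for the tree of a dense sequence -/

theorem KnowsMetric.lift {X J Y : Type*} [MetricSpace X] {A : Naming Y} {δ : TTERepresentation X}
    {D : MetricData δ} {orc : J → ℕ → ℕ} (hD : KnowsMetric D orc) : KnowsMetric D
    fun t : J × NamedPoint A => pairSeq (orc t.1) t.2.name :=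
  ⟨hD.dist.lift, hD.point.lift⟩

section Tree

variable {X : Type*} [MetricSpace X] [MeasurableSpace X] [BorelSpace X] {δ : TTERepresentation X}
  {D : MetricData δ} (hξ : DenseRange D.point) {J : Type*} {orc : J → ℕ → ℕ}
  {ν : J → NamedValuation δ.IsName} (hD : KnowsMetric D orc)
  (hν : SemiDec orc fun j (p : ℕ × ℕ) => (ν j).name p.1 = p.2)

/-- The mean tree of a valuation. -/
noncomputable def meanTree (μ : Measure X) [IsProbabilityMeasure μ] : IntervalTree :=
  (denseTree D.point hξ).mean μ

include hξ hD hν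

theorem semiDec_lt_setIntegral_mass {U : J → Set X} (hUo : ∀ j, IsOpen (U j))
    (hU : SemiDecOpen δ.IsName orc fun j (_ : Unit) => U j) :
    SemiDec orc fun j (p : List ℕ × ℕ × ℕ) => (p.2.1 : ℝ) < 2 ^ p.2.2 * ∫ x in U j,
      (endpoint D.point 1 p.1 0 x - endpoint D.point 0 p.1 0 x) ∂(ν j).measure := by
  have h0 := semiDec_endpoint_lt hD.lift SemiDec.snd_oracle 0
  have h1 := semiDec_lt_endpoint hD.lift SemiDec.snd_oracle 1
  simp only [Nat.cast_zero, Nat.cast_one] at h0 h1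
  exact semiDec_lt_integral hν hUo (f := fun s => endpoint D.point 0 s 0)
    (g := fun s => endpoint D.point 1 s 0) (fun s => continuous_endpoint _ _ s 0)
    (fun s => continuous_endpoint _ _ s 0) (fun s x => (pointTree D.point hξ x).lo_nonneg s)
    (fun s x => (pointTree D.point hξ x).lo_le_hi s)
    (fun s x => (pointTree D.point hξ x).hi_le_one s) hU h0 h1

theorem semiDec_lt_lo : SemiDec orc fun j (p : List ℕ × ℕ × ℕ) =>
    (p.2.1 : ℝ) < 2 ^ p.2.2 * (meanTree hξ (ν j).measure).lo p.1 := by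
  have h1 := semiDec_lt_endpoint hD.lift SemiDec.snd_oracle 0
  simp only [Nat.cast_zero] at h1
  refine (semiDec_lt_integral hν (U := fun _ => univ) (fun _ => isOpen_univ) (f := fun _ _ => 0)
    (g := fun s => endpoint D.point 0 s 0) (fun s => continuous_const)
    (fun s => continuous_endpoint _ _ s 0) (fun s x => le_rfl)
    (fun s x => (pointTree D.point hξ x).lo_nonneg s)
    (fun s x => (pointTree D.point hξ x).lo_le_one s)
    ((SemiDec.of_primrec (P := fun _ => True) .const_true).congr fun _ _ => by simp)
    ((SemiDec.of_primrec (P := fun p : ℕ × ℕ × List ℕ => 0 < p.1) (by fun_prop)).congr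
      fun _ p => by simp [div_pos_iff_of_pos_right]) h1).congr fun j p => ?_
  simp only [setIntegral_univ, sub_zero]
  rfl

/-- Upper bounds for an endpoint are lower bounds for the integral of `1 - lo`. Here total mass 1 is
used; valuations alone give lower bounds only. -/
theorem semiDec_lt_one_sub_lo : SemiDec orc fun j (p : List ℕ × ℕ × ℕ) =>
    (p.2.1 : ℝ) < 2 ^ p.2.2 * (1 - (meanTree hξ (ν j).measure).lo p.1) := by
  have h0 := semiDec_endpoint_lt hD.lift SemiDec.snd_oracle 0
  simp only [Nat.cast_zero] at h0
  refine (semiDec_lt_integral hν (U := fun _ => univ) (fun _ => isOpen_univ) (g := fun _ _ => 1)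
    (f := fun s => endpoint D.point 0 s 0) (fun s => continuous_endpoint _ _ s 0)
    (fun s => continuous_const) (fun s x => (pointTree D.point hξ x).lo_nonneg s)
    (fun s x => (pointTree D.point hξ x).lo_le_one s) (fun s x => le_rfl)
    ((SemiDec.of_primrec (P := fun _ => True) .const_true).congr fun _ _ => by simp) h0
    ((SemiDec.of_primrec (P := fun p : ℕ × ℕ × List ℕ => p.1 < 2 ^ p.2.1) (by fun_prop)).congr
      fun _ p => by rw [div_lt_one (by positivity)]; norm_cast)).congr fun j p => ?_
  have h2 := integral_sub (integrable_const (1 : ℝ))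
    (show Integrable (fun x => endpoint D.point 0 p.1 0 x) (ν j).measure from
      (denseTree D.point hξ).integrable_lo (ν j).measure p.1)
  rw [setIntegral_univ, h2]
  simp only [integral_const, probReal_univ, smul_eq_mul, mul_one]
  rfl

theorem semiDec_lt_hi : SemiDec orc fun j (p : List ℕ × ℕ × ℕ) =>
    (p.2.1 : ℝ) < 2 ^ p.2.2 * (meanTree hξ (ν j).measure).hi p.1 := by
  have h1 := semiDec_lt_endpoint hD.lift SemiDec.snd_oracle 1
  simp only [Nat.cast_one] at h1
  refine (semiDec_lt_integral hν (U := fun _ => univ) (fun _ => isOpen_univ) (f := fun _ _ => 0)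
    (g := fun s => endpoint D.point 1 s 0) (fun s => continuous_const)
    (fun s => continuous_endpoint _ _ s 0) (fun s x => le_rfl)
    (fun s x => (pointTree D.point hξ x).hi_nonneg s)
    (fun s x => (pointTree D.point hξ x).hi_le_one s)
    ((SemiDec.of_primrec (P := fun _ => True) .const_true).congr fun _ _ => by simp)
    ((SemiDec.of_primrec (P := fun p : ℕ × ℕ × List ℕ => 0 < p.1) (by fun_prop)).congr
      fun _ p => by simp [div_pos_iff_of_pos_right]) h1).congr fun j p => ?_
  simp only [setIntegral_univ, sub_zero]
  rfl

theorem semiDec_lt_one_sub_hi : SemiDec orc fun j (p : List ℕ × ℕ × ℕ) =>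
    (p.2.1 : ℝ) < 2 ^ p.2.2 * (1 - (meanTree hξ (ν j).measure).hi p.1) := by
  have h0 := semiDec_endpoint_lt hD.lift SemiDec.snd_oracle 1
  simp only [Nat.cast_one] at h0
  refine (semiDec_lt_integral hν (U := fun _ => univ) (fun _ => isOpen_univ) (g := fun _ _ => 1)
    (f := fun s => endpoint D.point 1 s 0) (fun s => continuous_endpoint _ _ s 0)
    (fun s => continuous_const) (fun s x => (pointTree D.point hξ x).hi_nonneg s)
    (fun s x => (pointTree D.point hξ x).hi_le_one s) (fun s x => le_rfl)
    ((SemiDec.of_primrec (P := fun _ => True) .const_true).congr fun _ _ => by simp) h0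
    ((SemiDec.of_primrec (P := fun p : ℕ × ℕ × List ℕ => p.1 < 2 ^ p.2.1) (by fun_prop)).congr
      fun _ p => by rw [div_lt_one (by positivity)]; norm_cast)).congr fun j p => ?_
  have h2 := integral_sub (integrable_const (1 : ℝ))
    (show Integrable (fun x => endpoint D.point 1 p.1 0 x) (ν j).measure from
      (denseTree D.point hξ).integrable_hi (ν j).measure p.1)
  rw [setIntegral_univ, h2]
  simp only [integral_const, probReal_univ, smul_eq_mul, mul_one]
  rfl

/-- The dyadic interval `(v, N)` is strictly inside the interval of the node. -/
theorem semiDec_dyadic_inside : SemiDec orc fun j (p : List ℕ × ℕ × ℕ) =>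
    p.2.1 < 2 ^ p.2.2 ∧ (meanTree hξ (ν j).measure).lo p.1 * 2 ^ p.2.2 < p.2.1 ∧
      (p.2.1 : ℝ) + 1 < (meanTree hξ (ν j).measure).hi p.1 * 2 ^ p.2.2 := by
  -- The bound `lo · 2ᴺ < v` is rewritten as `2ᴺ - v < 2ᴺ (1 - lo)`, a lower bound; `v < 2ᴺ` makes
  -- the natural subtraction exact.
  refine ((SemiDec.of_primrec (P := fun p : List ℕ × ℕ × ℕ => p.2.1 < 2 ^ p.2.2)
    (by fun_prop)).and (((semiDec_lt_one_sub_lo hξ hD hν).comp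
      (g := fun p : List ℕ × ℕ × ℕ => (p.1, 2 ^ p.2.2 - p.2.1, p.2.2)) (by fun_prop)).and
    ((semiDec_lt_hi hξ hD hν).comp
      (g := fun p : List ℕ × ℕ × ℕ => (p.1, p.2.1 + 1, p.2.2)) (by fun_prop)))).congr
    fun j p => ?_
  refine and_congr_right fun h => ?_
  dsimp only
  rw [Nat.cast_sub h.le]
  push_cast
  refine and_congr ?_ ?_ <;> constructor <;> intro h <;> linarith

end Tree

/-! ### Assignment of nodes to dyadic intervals -/

namespace IntervalTree

variable (T : IntervalTree)

/-- The masses of the nodes of level `m` add up to the mass of the root. -/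
theorem coin_cells_level (m : ℕ) : coin (T.cells fun s => s.length = m) = 1 := by
  refine le_antisymm prob_le_one ?_
  have h := le_of_le_on_level (Φ := T.mass)
    (Ψ := fun s => coin (T.cell s ∩ T.cells fun s => s.length = m)) (N := m)
    (fun s => (T.tsum_mass_snoc s).symm)
    (fun s => T.coin_inter_cell s (T.isOpen_cells _).measurableSet)
    (fun s hs => by
      rw [inter_eq_left.2 fun ω hω => T.mem_cells.2 ⟨s, hs, hω⟩, T.coin_cell]) [] (Nat.zero_le m)
  rwa [T.coin_inter_cell_nil, T.mass_nil] at h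

/-- The list `p.2` assigns to all dyadic intervals of level `p.1`, up to the fraction `2⁻ⁿ`, nodes
of level `m` whose intervals contain them. -/
def Assigns (m n : ℕ) (p : ℕ × List (List ℕ)) : Prop :=
  (∀ v < 2 ^ p.1, p.2.getD v [] = [] ∨ (p.2.getD v []).length = m ∧ v < 2 ^ p.1 ∧
    T.lo (p.2.getD v []) * 2 ^ p.1 < v ∧ (v : ℝ) + 1 < T.hi (p.2.getD v []) * 2 ^ p.1) ∧
  ((List.range (2 ^ p.1)).map fun v => if p.2.getD v [] = [] then 1 else 0).sum * 2 ^ n ≤ 2 ^ p.1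

theorem sum_map_range_ite (l : List (List ℕ)) (k : ℕ) :
    ((List.range k).map fun v => if l.getD v [] = [] then 1 else 0).sum =
      ((Finset.range k).filter fun v => l.getD v [] = []).card := by
  rw [← List.sum_toFinset _ List.nodup_range, List.toFinset_range, Finset.card_filter]

theorem natCast_mul_inv_two_pow_le_iff (c N n : ℕ) :
    (c : ℝ≥0∞) * 2⁻¹ ^ N ≤ 2⁻¹ ^ n ↔ c * 2 ^ n ≤ 2 ^ N := by
  rw [← ENNReal.inv_pow, ← ENNReal.inv_pow, ← div_eq_mul_inv,
    ENNReal.div_le_iff (by simp) (by simp), mul_comm, ← div_eq_mul_inv,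
    ENNReal.le_div_iff_mul_le (by simp) (by simp)]
  norm_cast

/-- The dyadic intervals inside cells of level `m` increase to a set of measure 1, so some finite
level `N` covers more than `1 - 2⁻ⁿ`. As the empty list marks unassigned intervals, `m ≠ 0` is
needed. -/
theorem exists_assigns {m : ℕ} (hm : m ≠ 0) (n : ℕ) : ∃ p, T.Assigns m n p := by
  classical
  let A : ℕ → Set Cantor := fun N =>
    ⋃ (s : List ℕ) (_ : s.length = m), intervalStage (T.lo s) (T.hi s) N
  have hA : Monotone A := fun M N h =>
    iUnion₂_mono fun s _ => intervalStage_mono _ _ h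
  have hU : ⋃ N, A N = T.cells fun s => s.length = m := by
    ext ω
    simp only [A, cells, cell, intervalSet, mem_iUnion]
    tauto
  have ht := tendsto_measure_iUnion_atTop (μ := coin) hA
  rw [hU, T.coin_cells_level] at ht
  obtain ⟨N, hN⟩ := (ht.eventually (lt_mem_nhds (ENNReal.sub_lt_self ENNReal.one_ne_top
    one_ne_zero (show (2 : ℝ≥0∞)⁻¹ ^ n ≠ 0 by simp)))).exists
  let g : ℕ → List ℕ := fun v => if h : ∃ s : List ℕ, s.length = m ∧ T.lo s * 2 ^ N < v ∧
    (v : ℝ) + 1 < T.hi s * 2 ^ N then h.choose else []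
  have hg : ∀ v < 2 ^ N, ((List.range (2 ^ N)).map g).getD v [] = g v := fun v hv => by
    simp [List.getD_eq_getElem?_getD, hv]
  refine ⟨(N, (List.range (2 ^ N)).map g), fun v hv => ?_, ?_⟩
  · rw [hg v hv]
    by_cases h : ∃ s : List ℕ, s.length = m ∧ T.lo s * 2 ^ N < v ∧ (v : ℝ) + 1 < T.hi s * 2 ^ N
    · right
      simp only [g, dif_pos h]
      exact ⟨h.choose_spec.1, hv, h.choose_spec.2⟩
    · left
      simp only [g, dif_neg h]
  · dsimp only
    rw [sum_map_range_ite, ← natCast_mul_inv_two_pow_le_iff, ← coin_cantorVal_mem _ fun v hv =>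
      Finset.mem_range.1 (Finset.mem_filter.1 hv).1]
    have hAm : MeasurableSet (A N) := by
      have : A N = cantorVal N ⁻¹' {v | ∃ s : List ℕ, s.length = m ∧ T.lo s * 2 ^ N < v ∧
          (v : ℝ) + 1 < T.hi s * 2 ^ N} := by
        ext ω; simp only [A, intervalStage, mem_iUnion, exists_prop]; rfl
      rw [this]
      exact ((isOpen_discrete _).preimage (continuous_cantorVal N)).measurableSet
    calc _ ≤ coin (A N)ᶜ := measure_mono fun ω hω hA' => by
          rw [mem_ofPred_eq, Finset.mem_filter] at hω
          have h1 := hω.2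
          rw [hg _ (cantorVal_lt N ω)] at h1
          simp only [A, mem_iUnion] at hA'
          obtain ⟨s, hs, hs'⟩ := hA'
          have h : ∃ s : List ℕ, s.length = m ∧ T.lo s * 2 ^ N < cantorVal N ω ∧
            (cantorVal N ω : ℝ) + 1 < T.hi s * 2 ^ N := ⟨s, hs, hs'⟩
          simp only [g, dif_pos h] at h1
          have h2 := h.choose_spec.1
          rw [h1] at h2
          exact hm h2.symm
      _ = 1 - coin (A N) := by rw [measure_compl hAm (measure_ne_top _ _), measure_univ]
      _ ≤ 2⁻¹ ^ n := by
          rw [tsub_le_iff_left]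
          exact (tsub_le_iff_right.1 hN.le)

end IntervalTree

/-! ### Selection of a witness -/

namespace SemiDec

variable {I α β : Type*} [Primcodable α] [Primcodable β] {orc : I → ℕ → ℕ}

/-- A semidecidable total relation contains a function with semidecidable graph. -/
theorem exists_selection {R : I → α → β → Prop} (hR : SemiDec orc fun i (p : α × β) => R i p.1 p.2)
    (ht : ∀ i a, ∃ b, R i a b) : ∃ g : I → α → β, (∀ i a, R i a (g i a)) ∧
      SemiDec orc fun i (p : α × β) => g i p.1 = p.2 := by
  classical
  obtain ⟨T, hT, -, eT⟩ := hR.exists_stage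
  -- The number `c` codes a candidate together with a stage accepting it. The least such `c` can be
  -- recognised from the oracle prefix of length `c`, which makes the choice a function of the
  -- oracle.
  let P : List ℕ → α → ℕ → Prop := fun w a c =>
    ∃ b, (Encodable.decode c.unpair.1 : Option β) = some b ∧
    T (w.take c.unpair.2, a, b)
  have hP : PrimrecPred fun q : List ℕ × α × ℕ => P q.1 q.2.1 q.2.2 := by
    dsimp only [P]; fun_prop
  have hex : ∀ i a, ∃ c, P (seqPrefix (orc i) c) a c := fun i a => by
    obtain ⟨b, hb⟩ := ht i a
    obtain ⟨n, hn⟩ := (eT i (a, b)).1 hb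
    refine ⟨Nat.pair (Encodable.encode b) n, b, by simp, ?_⟩
    simpa [min_eq_left (Nat.right_le_pair _ n)] using hn
  choose g hg using fun i a => Nat.find_spec (hex i a)
  refine ⟨g, fun i a => (eT i (a, g i a)).2 ?_, ?_⟩
  · have := (hg i a).2
    rw [take_seqPrefix] at this
    exact ⟨_, this⟩
  · let Q : List ℕ × (α × β) × ℕ → Prop := fun r =>
      (Encodable.decode r.2.2.unpair.1 : Option β) = some r.2.1.2 ∧ P r.1 r.2.1.1 r.2.2 ∧
        ∀ c < r.2.2, ¬ P (r.1.take c) r.2.1.1 c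
    have hQ : PrimrecPred Q := by
      refine PrimrecPred.and (by fun_prop) (PrimrecPred.and ?_ ?_)
      · exact hP.comp_rule (f := fun r : List ℕ × (α × β) × ℕ => (r.1, r.2.1.1, r.2.2))
          (by fun_prop)
      · exact PrimrecPred.forall_lt_rule (by fun_prop) (PrimrecPred.not (hP.comp_rule
          (f := fun r : (List ℕ × (α × β) × ℕ) × ℕ => (r.1.1.take r.2, r.1.2.1.1, r.2))
            (by fun_prop)))
    refine (SemiDec.ex (R := fun i (p : α × β) c => Q (seqPrefix (orc i) c, p, c))
      (of_prefix (f := fun q => q.2) hQ (by fun_prop))).congr fun i p => ?_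
    have e : ∀ c, ((P (seqPrefix (orc i) c) p.1 c ∧
        ∀ c' < c, ¬ P ((seqPrefix (orc i) c).take c') p.1 c') ↔ Nat.find (hex i p.1) = c) := by
      intro c
      rw [Nat.find_eq_iff]
      refine and_congr_right fun _ => forall₂_congr fun c' hc' => ?_
      rw [take_seqPrefix, min_eq_left hc'.le]
    simp only [Q, e]
    constructor
    · rintro h
      exact ⟨_, by rw [(hg i p.1).1, h], rfl⟩
    · rintro ⟨c, h1, rfl⟩
      exact Option.some_injective _ ((hg i p.1).1.symm.trans h1)

end SemiDec

/-! ### The Cantor space -/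

theorem cantorVal_eq_foldl {q : ℕ → ℕ} {ω : Cantor} (h : cantorNaming q ω) (N : ℕ) :
    (seqPrefix q N).foldl (fun a b => 2 * a + b) 0 = cantorVal N ω := by
  induction N with
  | zero => rfl
  | succ N ih =>
    rw [seqPrefix, List.range_succ, List.map_append, List.foldl_append, ← seqPrefix, ih]
    simp [cantorVal, h N]

theorem semiDec_cantorVal {J : Type*} {orc : J → ℕ → ℕ} :
    SemiDec (fun t : J × NamedPoint cantorNaming => pairSeq (orc t.1) t.2.name)
      fun t (p : ℕ × ℕ) => cantorVal p.1 t.2.point = p.2 := by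
  have hp : Primrec fun w : List ℕ => w.foldl (fun a b => 2 * a + b) 0 :=
    Primrec.list_foldl (f := fun w : List ℕ => w) (g := fun _ => 0)
      (h := fun _ p => 2 * p.1 + p.2) Primrec.id (Primrec.const 0)
      (show Primrec fun q : List ℕ × ℕ × ℕ => 2 * q.2.1 + q.2.2 by fun_prop)
  have h := (SemiDec.snd_oracle (o1 := fun t : J × NamedPoint cantorNaming => orc t.1)
    (o2 := fun t => t.2.name)).graph_const (α := Unit)
    (f := fun t : J × NamedPoint cantorNaming => t.2.name)
  have h2 := SemiDec.ex (R := fun (t : J × NamedPoint cantorNaming) (p : ℕ × ℕ) (w : List ℕ) =>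
    seqPrefix t.2.name p.1 = w ∧ w.foldl (fun a b => 2 * a + b) 0 = p.2)
    (((SemiDec.graph_prefix (f := fun (t : J × NamedPoint cantorNaming) (_ : Unit) => t.2.name)
      h).comp (g := fun q : (ℕ × ℕ) × List ℕ => (((), q.1.1), q.2))
      (by fun_prop)).and (SemiDec.of_primrec (P := fun q : (ℕ × ℕ) × List ℕ =>
        q.2.foldl (fun a b => 2 * a + b) 0 = q.1.2)
        (PrimrecPred.eq_rule (hp.comp Primrec.snd) (by fun_prop))))
  refine h2.congr fun t p => ?_
  simp only [exists_eq_left', cantorVal_eq_foldl t.2.isName]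

/-! ### Open sets from names -/

theorem semiDecOpen_of_name {X J : Type*} {A : Naming X} {orc : J → ℕ → ℕ} {u : J → ℕ → ℕ}
    {U : J → Set X} (hu : ∀ j, openNaming A (u j) (U j))
    (hg : SemiDec orc fun j (p : ℕ × ℕ) => u j p.1 = p.2) :
    SemiDecOpen A orc fun j (_ : Unit) => U j := by
  have h := SemiDec.ex (R := fun (t : J × NamedPoint A) (_ : Unit) (b : ℕ × ℕ) =>
    (∃ m, (wordFun (u t.1) (seqPrefix t.2.name m))[b.1]? = some b.2) ∧ b.2 ≠ 0)
    (((SemiDec.wordFun_output (P := fun t : J × NamedPoint A => u t.1)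
      (Q := fun t (_ : Unit) => t.2.name) hg.lift SemiDec.snd_oracle.graph_const).comp
      (g := fun q : Unit × ℕ × ℕ => ((), q.2.1, q.2.2)) (by fun_prop)).and
      (SemiDec.of_primrec (P := fun q : Unit × ℕ × ℕ => ¬ q.2.2 = 0) (by fun_prop)))
  refine h.congr fun t _ => ?_
  obtain ⟨r, hr, hr'⟩ := hu t.1 t.2.name t.2.point t.2.isName
  have hr' : (∃ n, r n ≠ 0) ↔ t.2.point ∈ U t.1 := hr'
  rw [← hr']
  simp only [← hr.eq_iff]
  exact ⟨fun ⟨n, hn⟩ => ⟨(n, r n), rfl, hn⟩, fun ⟨⟨n, v⟩, h1, h2⟩ => ⟨n, by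
    simp only at h1; subst h1; exact h2⟩⟩

/-! ### The random variable -/

/-- After multiplication by `2ⁿ`, the length is moved to the right as `a + (1 - b)`. What remains is
a lower bound for a weighted sum of `I`, `a` and `1 - b`, each of which can be approximated from
below. -/
theorem ENNReal.one_sub_inv_two_pow_mul_lt_iff {a b I : ℝ} (hab : a ≤ b) (n : ℕ) :
    (1 - (2 : ℝ≥0∞)⁻¹ ^ n) * ENNReal.ofReal (b - a) < ENNReal.ofReal I ↔
      ((2 ^ n - 1 : ℕ) : ℝ) < (2 ^ n : ℕ) * I + (2 ^ n - 1 : ℕ) * a +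
        (2 ^ n - 1 : ℕ) * (1 - b) := by
  have h2 : (0 : ℝ) < 2 ^ n := by positivity
  have h1 : (2 : ℝ)⁻¹ ^ n ≤ 1 := pow_le_one₀ (by norm_num) (by norm_num)
  have e : (1 - (2 : ℝ≥0∞)⁻¹ ^ n) = ENNReal.ofReal (1 - 2⁻¹ ^ n) := by
    rw [ENNReal.ofReal_sub _ (by positivity), ENNReal.ofReal_one,
      ENNReal.ofReal_pow (by norm_num), ENNReal.ofReal_inv_of_pos (by norm_num),
      ENNReal.ofReal_ofNat]
  rw [e, ← ENNReal.ofReal_mul (sub_nonneg.2 h1), ENNReal.ofReal_lt_ofReal_iff_of_nonneg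
    (mul_nonneg (sub_nonneg.2 h1) (sub_nonneg.2 hab)), ← mul_lt_mul_iff_right₀ h2, ← mul_assoc,
    show (2 : ℝ) ^ n * (1 - 2⁻¹ ^ n) = 2 ^ n - 1 by rw [mul_sub, mul_one, ← mul_pow]; norm_num,
    Nat.cast_sub Nat.one_le_two_pow]
  push_cast
  constructor <;> intro h <;> linarith

section Tree

variable {X : Type*} [MetricSpace X] [MeasurableSpace X] [BorelSpace X] {δ : TTERepresentation X}
  {D : MetricData δ} (hξ : DenseRange D.point) {J : Type*} {orc : J → ℕ → ℕ}
  {ν : J → NamedValuation δ.IsName} (hD : KnowsMetric D orc)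
  (hν : SemiDec orc fun j (p : ℕ × ℕ) => (ν j).name p.1 = p.2)

/-- The three entries of `B` are lower bounds, in units of `2⁻ᴸ`, for the integral over `U`, for
`lo` and for `1 - hi`. -/
theorem outer_condition_iff (μ : Measure X) [IsProbabilityMeasure μ] (U : Set X) (s : List ℕ)
    (n : ℕ) : (1 - (2 : ℝ≥0∞)⁻¹ ^ n) * (meanTree hξ μ).mass s <
        ∫⁻ x in U, ((denseTree D.point hξ).tree x).mass s ∂μ ↔ ∃ (L : ℕ) (B : List ℕ),
      ((B.getD 0 0 = 0 ∨ (B.getD 0 0 : ℝ) < 2 ^ L * ∫ x in U,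
        (endpoint D.point 1 s 0 x - endpoint D.point 0 s 0 x) ∂μ) ∧
      (B.getD 1 0 = 0 ∨ (B.getD 1 0 : ℝ) < 2 ^ L * (meanTree hξ μ).lo s) ∧
      (B.getD 2 0 = 0 ∨ (B.getD 2 0 : ℝ) < 2 ^ L * (1 - (meanTree hξ μ).hi s))) ∧
      (2 ^ n - 1) * 2 ^ L < 2 ^ n * B.getD 0 0 + (2 ^ n - 1) * B.getD 1 0 +
        (2 ^ n - 1) * B.getD 2 0 := by
  have hi : Integrable (fun x => endpoint D.point 1 s 0 x - endpoint D.point 0 s 0 x) μ :=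
    ((denseTree D.point hξ).integrable_hi μ s).sub ((denseTree D.point hξ).integrable_lo μ s)
  have h0 : ∀ x, 0 ≤ endpoint D.point 1 s 0 x - endpoint D.point 0 s 0 x := fun x =>
    sub_nonneg.2 ((pointTree D.point hξ x).lo_le_hi s)
  have e : ∫⁻ x in U, ((denseTree D.point hξ).tree x).mass s ∂μ = ENNReal.ofReal (∫ x in U,
      (endpoint D.point 1 s 0 x - endpoint D.point 0 s 0 x) ∂μ) :=
    (ofReal_integral_eq_lintegral_ofReal hi.restrict (Eventually.of_forall h0)).symm
  have hI : 0 ≤ ∫ x in U, (endpoint D.point 1 s 0 x - endpoint D.point 0 s 0 x) ∂μ :=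
    integral_nonneg h0
  rw [e, IntervalTree.mass,
    ENNReal.one_sub_inv_two_pow_mul_lt_iff ((meanTree hξ μ).lo_le_hi s)]
  generalize ∫ x in U, (endpoint D.point 1 s 0 x - endpoint D.point 0 s 0 x) ∂μ = I at hI ⊢
  have h := lt_sum_iff_exists_list (n := 3)
    (m := fun k => if k = 0 then I else if k = 1 then (meanTree hξ μ).lo s else
      1 - (meanTree hξ μ).hi s) (fun k => by
        split_ifs
        · exact hI
        · exact (meanTree hξ μ).lo_nonneg s
        · exact sub_nonneg.2 ((meanTree hξ μ).hi_le_one s))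
    (fun k => if k = 0 then 2 ^ n else 2 ^ n - 1) ((2 ^ n - 1 : ℕ) : ℝ)
  simp only [Finset.sum_range_succ, Finset.sum_range_zero, zero_add, if_true, one_ne_zero,
    if_false, OfNat.ofNat_ne_zero, OfNat.ofNat_ne_one] at h
  rw [h]
  refine exists₂_congr fun L B => and_congr ?_ ?_
  · constructor
    · intro h
      exact ⟨by simpa using h 0 (by norm_num), by simpa using h 1 (by norm_num),
        by simpa using h 2 (by norm_num)⟩
    · rintro ⟨h0, h1, h2⟩ k hk
      interval_cases k
      · simpa using h0
      · simpa using h1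
      · simpa using h2
  · generalize 2 ^ n - 1 = c
    generalize 2 ^ n = d
    simp only [List.range_succ, List.range_zero, List.map_append, List.map_cons, List.map_nil,
      List.sum_append, List.sum_cons, List.sum_nil, List.nil_append, add_zero, if_true,
      one_ne_zero, if_false, OfNat.ofNat_ne_zero]
    norm_cast

include hD hν

/-- Membership is witnessed by a node satisfying the outer condition and a dyadic interval that
contains the point and is strictly inside the interval of the node. -/
theorem semiDecOpen_outer {U : J → Opens X}
    (hU : SemiDecOpen δ.IsName orc fun j (_ : Unit) => (U j : Set X)) :
    SemiDecOpen cantorNaming orc fun j n =>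
      (denseTree D.point hξ).outer (ν j).measure (U j) n := by
  have c0 := semiDec_lt_setIntegral_mass hξ hD hν (fun j => (U j).isOpen) hU
  have c1 := semiDec_lt_lo hξ hD hν
  have c2 := semiDec_lt_one_sub_hi hξ hD hν
  have c3 := semiDec_dyadic_inside hξ hD hν
  have hc := SemiDec.ex (R := fun j (p : List ℕ × ℕ) (b : ℕ × List ℕ) =>
      ((b.2.getD 0 0 = 0 ∨ (b.2.getD 0 0 : ℝ) < 2 ^ b.1 * ∫ x in U j,
        (endpoint D.point 1 p.1 0 x - endpoint D.point 0 p.1 0 x) ∂(ν j).measure) ∧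
      (b.2.getD 1 0 = 0 ∨ (b.2.getD 1 0 : ℝ) < 2 ^ b.1 * (meanTree hξ (ν j).measure).lo p.1) ∧
      (b.2.getD 2 0 = 0 ∨
        (b.2.getD 2 0 : ℝ) < 2 ^ b.1 * (1 - (meanTree hξ (ν j).measure).hi p.1))) ∧
      (2 ^ p.2 - 1) * 2 ^ b.1 < 2 ^ p.2 * b.2.getD 0 0 + (2 ^ p.2 - 1) * b.2.getD 1 0 +
        (2 ^ p.2 - 1) * b.2.getD 2 0)
    (((SemiDec.or (SemiDec.of_primrec (by fun_prop)) (c0.comp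
        (g := fun q : (List ℕ × ℕ) × ℕ × List ℕ => (q.1.1, q.2.2.getD 0 0, q.2.1))
          (by fun_prop))).and
      ((SemiDec.or (SemiDec.of_primrec (by fun_prop)) (c1.comp
        (g := fun q : (List ℕ × ℕ) × ℕ × List ℕ => (q.1.1, q.2.2.getD 1 0, q.2.1))
          (by fun_prop))).and
      (SemiDec.or (SemiDec.of_primrec (by fun_prop)) (c2.comp
        (g := fun q : (List ℕ × ℕ) × ℕ × List ℕ => (q.1.1, q.2.2.getD 2 0, q.2.1))
          (by fun_prop))))).and (SemiDec.of_primrec (by fun_prop)))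
  have hc' : SemiDec orc fun j (p : List ℕ × ℕ) =>
      (1 - (2 : ℝ≥0∞)⁻¹ ^ p.2) * (meanTree hξ (ν j).measure).mass p.1 <
        ∫⁻ x in U j, ((denseTree D.point hξ).tree x).mass p.1 ∂(ν j).measure :=
    hc.congr fun j p => by
      rw [outer_condition_iff hξ]
      exact ⟨fun ⟨L, B, h⟩ => ⟨(L, B), h⟩, fun ⟨⟨L, B⟩, h⟩ => ⟨L, B, h⟩⟩
  have h := SemiDec.ex (R := fun (t : J × NamedPoint cantorNaming) (n : ℕ)
      (b : List ℕ × ℕ × ℕ) => cantorVal b.2.2 t.2.point = b.2.1 ∧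
      ((1 - (2 : ℝ≥0∞)⁻¹ ^ n) * (meanTree hξ (ν t.1).measure).mass b.1 <
        ∫⁻ x in U t.1, ((denseTree D.point hξ).tree x).mass b.1 ∂(ν t.1).measure) ∧
      b.2.1 < 2 ^ b.2.2 ∧ (meanTree hξ (ν t.1).measure).lo b.1 * 2 ^ b.2.2 < b.2.1 ∧
      (b.2.1 : ℝ) + 1 < (meanTree hξ (ν t.1).measure).hi b.1 * 2 ^ b.2.2)
    ((semiDec_cantorVal.comp (g := fun q : ℕ × List ℕ × ℕ × ℕ => (q.2.2.2, q.2.2.1))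
      (by fun_prop)).and
      ((hc'.lift.comp (g := fun q : ℕ × List ℕ × ℕ × ℕ => (q.2.1, q.1)) (by fun_prop)).and
        (c3.lift.comp (g := fun q : ℕ × List ℕ × ℕ × ℕ => q.2) (by fun_prop))))
  refine SemiDec.congr h fun t n => ?_
  change t.2.point ∈ (meanTree hξ (ν t.1).measure).cells _ ↔ _
  rw [IntervalTree.mem_cells]
  simp only [IntervalTree.cell, intervalSet, mem_iUnion, intervalStage, mem_ofPred_eq]
  constructor
  · rintro ⟨s, h1, N, h2⟩
    exact ⟨(s, _, N), rfl, h1, cantorVal_lt _ _, h2⟩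
  · rintro ⟨⟨s, v, N⟩, h1, h2, -, h3⟩
    dsimp only at h1 h2 h3
    subst h1
    exact ⟨s, h2, N, h3⟩

theorem exists_randomVariable_code : ∃ C : List ℕ × Unit × ℕ → ℕ, Primrec C ∧ ∀ j,
    RandomVariable.naming δ.IsName (fun k => C (seqPrefix (orc j) k, (), k))
      ((denseTree D.point hξ).randomVariable (ν j).measure) := by
  let B : Naming (Opens X) := fun u U => openNaming δ.IsName u (U : Set X)
  have hU : SemiDecOpen δ.IsName (fun t : J × NamedPoint B => pairSeq (orc t.1) t.2.name)
      fun t (_ : Unit) => (t.2.point : Set X) :=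
    semiDecOpen_of_name (u := fun t => t.2.name) (fun t => t.2.isName) SemiDec.snd_oracle
  -- The named open set is made part of the instance, so its name serves first as oracle and then,
  -- through `exists_code`, as input of the operator.
  obtain ⟨u, hu, hg⟩ := (semiDecOpen_outer hξ (ν := fun t => ν t.1) hD.lift hν.lift hU).exists_name
  obtain ⟨C, hC, hm⟩ := exists_code (α := Unit) Prod.fst orc (fun t : J × NamedPoint B => t.2.name)
    (fun t _ k => u t k.unpair.1 k.unpair.2)
    (hg.comp (g := fun p : Unit × ℕ × ℕ => (p.2.1.unpair.1, p.2.1.unpair.2, p.2.2))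
      (by fun_prop))
  refine ⟨C, hC, fun j q U hq => ⟨_, hm (j, ⟨q, U, hq⟩) (), ?_⟩⟩
  refine ⟨(denseTree D.point hξ).outerSeq (ν j).measure U, TreeFamily.mk_outerSeq _ _ _,
    fun n => ?_⟩
  simp only [Nat.unpair_pair]
  exact hu (j, ⟨q, U, hq⟩) n

end Tree

/-! ### The simple random variables -/

/-- The simple random variable of an assignment of nodes of level `n + 4`. -/
def simpleVariable {X : Type*} [TopologicalSpace X] (ξ : ℕ → X) (n : ℕ) (p : ℕ × List (List ℕ)) :
    C(Cantor, X) where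
  toFun ω := ξ ((p.2.getD (cantorVal p.1 ω) []).getD (n + 3) 0)
  continuous_toFun := (continuous_of_discreteTopology
    (f := fun v => ξ ((p.2.getD v []).getD (n + 3) 0))).comp (continuous_cantorVal p.1)

theorem finite_range_simpleVariable {X : Type*} [TopologicalSpace X] (ξ : ℕ → X) (n : ℕ)
    (p : ℕ × List (List ℕ)) : (Set.range (simpleVariable ξ n p)).Finite := by
  refine ((Set.finite_Iio (2 ^ p.1)).image fun v => ξ ((p.2.getD v []).getD (n + 3) 0)).subset ?_
  rintro _ ⟨ω, rfl⟩
  exact ⟨cantorVal p.1 ω, cantorVal_lt _ _, rfl⟩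

section Tree

variable {X : Type*} [MetricSpace X] [MeasurableSpace X] [BorelSpace X] {δ : TTERepresentation X}
  {D : MetricData δ} (hξ : DenseRange D.point) {J : Type*} {orc : J → ℕ → ℕ}
  {ν : J → NamedValuation δ.IsName} (hD : KnowsMetric D orc)
  (hν : SemiDec orc fun j (p : ℕ × ℕ) => (ν j).name p.1 = p.2)

/-- The exceptional set consists of the points whose dyadic interval is unassigned. -/
theorem followsTree_simpleVariable {μ : Measure X} [IsProbabilityMeasure μ] {n : ℕ}
    {p : ℕ × List (List ℕ)} (h : (meanTree hξ μ).Assigns (n + 4) (n + 3) p) :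
    FollowsTree D.point hξ μ n (simpleVariable D.point n p) := by
  refine ⟨{ω | cantorVal p.1 ω ∈ (Finset.range (2 ^ p.1)).filter fun v => p.2.getD v [] = []},
    ?_, fun ω hω => ?_⟩
  · have h2 := h.2
    rwa [IntervalTree.sum_map_range_ite, ← IntervalTree.natCast_mul_inv_two_pow_le_iff,
      ← coin_cantorVal_mem _ fun v hv => Finset.mem_range.1 (Finset.mem_filter.1 hv).1] at h2
  · have h1 := h.1 _ (cantorVal_lt p.1 ω)
    simp only [mem_ofPred_eq, Finset.mem_filter, Finset.mem_range, cantorVal_lt, true_and] at hω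
    obtain ⟨h2, -, h3⟩ := h1.resolve_left hω
    exact ⟨_, h2, mem_iUnion.2 ⟨p.1, h3⟩, rfl⟩

include hD hν

theorem semiDec_assigns : SemiDec orc fun j (q : ℕ × ℕ × List (List ℕ)) =>
    (meanTree hξ (ν j).measure).Assigns (q.1 + 4) (q.1 + 3) q.2 := by
  refine (SemiDec.forall_lt (R := fun j (q : ℕ × ℕ × List (List ℕ)) v => q.2.2.getD v [] = [] ∨
      (q.2.2.getD v []).length = q.1 + 4 ∧ v < 2 ^ q.2.1 ∧
      (meanTree hξ (ν j).measure).lo (q.2.2.getD v []) * 2 ^ q.2.1 < v ∧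
      (v : ℝ) + 1 < (meanTree hξ (ν j).measure).hi (q.2.2.getD v []) * 2 ^ q.2.1)
    (f := fun q => 2 ^ q.2.1)
    ((SemiDec.of_primrec (by fun_prop)).or ((SemiDec.of_primrec (by fun_prop)).and
      ((semiDec_dyadic_inside hξ hD hν).comp (g := fun r : (ℕ × ℕ × List (List ℕ)) × ℕ =>
        (r.1.2.2.getD r.2 [], r.2, r.1.2.1)) (by fun_prop)))) (by fun_prop)).and
    (SemiDec.of_primrec (by fun_prop))

theorem exists_simpleVariable_code : ∃ C : List ℕ × ℕ × ℕ → ℕ, Primrec C ∧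
    ∃ S : J → ℕ → C(Cantor, X), ∀ j n,
      continuousRVNaming δ.IsName (fun k => C (seqPrefix (orc j) k, n, k)) (S j n) ∧
      (Set.range (S j n)).Finite ∧ FollowsTree D.point hξ (ν j).measure n (S j n) := by
  -- The assignment is chosen from the oracle alone, hence is the same for all points of the Cantor
  -- space; it may depend on the name of the valuation.
  obtain ⟨g, hg, hgs⟩ := SemiDec.exists_selection
    (R := fun j n p => (meanTree hξ (ν j).measure).Assigns (n + 4) (n + 3) p)
    (semiDec_assigns hξ hD hν)
    fun j n => (meanTree hξ (ν j).measure).exists_assigns (Nat.succ_ne_zero (n + 3)) (n + 3)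
  have h := SemiDec.ex (R := fun (t : J × NamedPoint cantorNaming) (p : ℕ × ℕ × ℕ)
      (b : (ℕ × List (List ℕ)) × ℕ) => g t.1 p.1 = b.1 ∧ cantorVal b.1.1 t.2.point = b.2 ∧
      D.pointCode (Nat.pair ((b.1.2.getD b.2 []).getD (p.1 + 3) 0) p.2.1) = p.2.2)
    ((hgs.lift.comp (g := fun q : (ℕ × ℕ × ℕ) × (ℕ × List (List ℕ)) × ℕ => (q.1.1, q.2.1))
      (by fun_prop)).and
      ((semiDec_cantorVal.comp (g := fun q : (ℕ × ℕ × ℕ) × (ℕ × List (List ℕ)) × ℕ =>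
        (q.2.1.1, q.2.2)) (by fun_prop)).and
        (hD.lift.point.comp (g := fun q : (ℕ × ℕ × ℕ) × (ℕ × List (List ℕ)) × ℕ =>
          (Nat.pair ((q.2.1.2.getD q.2.2 []).getD (q.1.1 + 3) 0) q.1.2.1, q.1.2.2))
          (by fun_prop))))
  obtain ⟨C, hC, hm⟩ := exists_code (α := ℕ) Prod.fst orc
    (fun t : J × NamedPoint cantorNaming => t.2.name)
    (fun t n k => D.pointCode (Nat.pair
      (((g t.1 n).2.getD (cantorVal (g t.1 n).1 t.2.point) []).getD (n + 3) 0) k))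
    (h.congr fun t p => by
      constructor
      · intro h
        exact ⟨(_, _), rfl, rfl, h⟩
      · rintro ⟨⟨b, c⟩, h1, h2, h3⟩
        dsimp only at h1 h2 h3
        subst h1 h2
        exact h3)
  refine ⟨C, hC, fun j n => simpleVariable D.point n (g j n), fun j n => ⟨fun q ω hq => ⟨_,
    hm (j, ⟨q, ω, hq⟩) n, D.isName_point _⟩, finite_range_simpleVariable _ _ _,
    followsTree_simpleVariable hξ (hg j n)⟩⟩

end Tree

/-! ### The operator -/

theorem exists_operator_code {X : Type*} [MetricSpace X] [MeasurableSpace X] [BorelSpace X]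
    {δ : TTERepresentation X} (D : MetricData δ) (hξ : DenseRange D.point) :
    ∃ C : List ℕ × Unit × ℕ → ℕ, Primrec C ∧ ∀ ν : NamedValuation δ.IsName, ∃ q : ℕ → ℕ,
      Maps (fun k => C (seqPrefix (pairSeq D.distCode D.pointCode) k, (), k)) ν.name q ∧
      RandomVariable.naming δ.IsName (fstSeq q)
        ((denseTree D.point hξ).randomVariable ν.measure) ∧
      ∃ S : ℕ → C(Cantor, X), Naming.seq (continuousRVNaming δ.IsName) (sndSeq q) S ∧
        (∀ n, (Set.range (S n)).Finite) ∧ ∀ n, FollowsTree D.point hξ ν.measure n (S n) := by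
  let orc : NamedValuation δ.IsName → ℕ → ℕ := fun ν =>
    pairSeq (pairSeq D.distCode D.pointCode) ν.name
  have hD : KnowsMetric D orc :=
    ⟨(SemiDec.fst_oracle (o1 := fun _ : NamedValuation δ.IsName => D.distCode)).of_graph
      SemiDec.fst_oracle, (SemiDec.snd_oracle
        (o2 := fun _ : NamedValuation δ.IsName => D.pointCode)).of_graph SemiDec.fst_oracle⟩
  have hν : SemiDec orc fun ν (p : ℕ × ℕ) => ν.name p.1 = p.2 := SemiDec.snd_oracle
  obtain ⟨CZ, hCZ, hZ⟩ := exists_randomVariable_code hξ (ν := fun ν => ν) hD hν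
  obtain ⟨CS, hCS, S, hS⟩ := exists_simpleVariable_code hξ (ν := fun ν => ν) hD hν
  -- The oracle is now split: the metric data go into the code of the operator, and the name of the
  -- valuation is its input.
  obtain ⟨C, hC, hm⟩ := exists_code (α := Unit) (fun _ : NamedValuation δ.IsName => ())
    (fun _ => pairSeq D.distCode D.pointCode) (fun ν => ν.name)
    (fun ν _ => pairSeq (fun k => CZ (seqPrefix (orc ν) k, (), k))
      fun k => CS (seqPrefix (orc ν) k.unpair.2, k.unpair.1, k.unpair.2))
    (SemiDec.graph_pairSeq (orc := orc) (f := fun ν (_ : Unit) k => CZ (seqPrefix (orc ν) k, (), k))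
      (g := fun ν (_ : Unit) k => CS (seqPrefix (orc ν) k.unpair.2, k.unpair.1, k.unpair.2))
      (SemiDec.graph_of_primrec hCZ)
      ((SemiDec.graph_of_primrec hCS).comp
        (g := fun p : Unit × ℕ × ℕ => (p.2.1.unpair.1, p.2.1.unpair.2, p.2.2)) (by fun_prop)))
  refine ⟨C, hC, fun ν => ⟨_, hm ν (), ?_, S ν, fun n => ?_, fun n => (hS ν n).2.1,
    fun n => (hS ν n).2.2⟩⟩
  · convert hZ ν using 1
    ext k
    simp [fstSeq, pairSeq]
  · convert (hS ν n).1 using 1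
    ext k
    simp [sndSeq, pairSeq, Nat.add_mod, show (2 * Nat.pair n k + 1) / 2 = Nat.pair n k by omega]

theorem mainTheorem2 {X : Type*} [MetricSpace X] (δ : TTERepresentation X)
    (hX : IsComputableMetricSpace δ) (hsep : IsEffectivelySeparable δ) :
    ∃ F : ℕ → ℕ, Computable F ∧
      ∀ (ν : OpenValuation X) (p : ℕ → ℕ), valuationNaming δ.IsName p ν → ν.toFun ⊤ = 1 →
        ∃ q, Maps F p q ∧
          ∃ (Z : RandomVariable X) (S : ℕ → C(Cantor, X)),
            RandomVariable.naming δ.IsName (fstSeq q) Z ∧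
            Naming.seq (continuousRVNaming δ.IsName) (sndSeq q) S ∧
            (∀ U : Opens X, Z.prob U = ν.toFun U) ∧
            (∀ n, (Set.range (S n)).Finite) ∧
            (∀ m n, RandomVariable.fanDist (RandomVariable.ofContinuous (S m))
              (RandomVariable.ofContinuous (S n)) < (2 : ℝ≥0∞)⁻¹ ^ min m n) ∧
            (∀ n, RandomVariable.fanDist (RandomVariable.ofContinuous (S n)) Z ≤
              (2 : ℝ≥0∞)⁻¹ ^ n) := by
  let _ : MeasurableSpace X := borel X
  have : BorelSpace X := ⟨rfl⟩
  obtain ⟨d, hd, hd'⟩ := hX.dist_computable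
  obtain ⟨ξ, ⟨x, hx, hx'⟩, hξ⟩ := hsep
  obtain ⟨C, hC, h⟩ := exists_operator_code (δ := δ) ⟨d, hd', x, ξ, hx'⟩ hξ
  -- The metric data have computable names, so the code built from their prefixes is computable.
  refine ⟨_, hC.to_comp.comp ((hd.pairSeq hx).seqPrefix.pair
    ((Computable.const ()).pair Computable.id)), fun ν p hp h1 => ?_⟩
  obtain ⟨μ, hμ⟩ := ν.exists_measure
  have : IsProbabilityMeasure μ := ⟨(hμ ⊤).trans h1⟩
  obtain ⟨q, hq, hZ, S, hS, hf, hS'⟩ := h ⟨ν, p, hp, μ, this, hμ⟩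
  exact ⟨q, hq, _, S, hZ, hS, fun U => (TreeFamily.prob_randomVariable _ _ _).trans (hμ U), hf,
    fun m n => fanDist_ofContinuous_lt (hS' m) (hS' n), fun n => fanDist_randomVariable_le (hS' n)⟩
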